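/- Let $\varepsilon\in(0,\tfrac13)$. There is $\lambda_0\in(0,1)$, depending only on $\varepsilon$, such that the following holds for every $\lambda\in(0,\lambda_0)$. **The market.** On a complete probability space $(\Omega,\mathcal F,P)$ let $\xi,\eta,\theta$ be independent random variables with $P[\xi=3]=\frac56$, $P[\xi=\frac12]=\frac16$, $P[\eta=2]=1-\varepsilon$, $P[\eta=\frac1n]=\varepsilon2^{-n}$ for $n\ge1$, and $\theta$ exponentially distributed with mean $1$. Put $\sigma=(\theta+\frac12)\wedge1$, $a_t=\frac13-\frac13(t-\frac12)$ and let the ask price be $$S_t=\big(1+(\xi-1)1_{\{\frac12\le t\}}\big)\big(1+a_\sigma(\eta-1)1_{\{\sigma\le t\}}\big),\qquad t\in[0,1],$$ so that a.s. $S_0=1$, $S_{1/2}=S_{\sigma-}=\xi$. The filtration $(\mathcal F_t)_{0\le t\le1}$ is the one generated by $S$ and $1_{\{\sigma\le t\}}$, completed and made right continuous. A $\lambda$-consistent price system is a pair $(Z^0,Z^1)$ where $Z^0$ is the density process of a probability measure $Q\sim P$, $Z^1=Z^0\widetilde S$, and $\widetilde S$ is a $Q$-local martingale with values in $[(1-\lambda)S,S]$.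 **The dual optimiser.** Let $\widehat\varphi_{1/2}=\frac{19-\lambda}{12(1+\lambda)}$ (the maximiser of $\ell\mapsto\frac16\log(1+\ell(\frac{1-\lambda}2-1))+\frac56\log(1+2\ell)$), and let $W_{1/2}=1+\widehat\varphi_{1/2}(\xi-1)$ on $\{\xi=3\}$ and $W_{1/2}=1+\widehat\varphi_{1/2}((1-\lambda)\xi-1)$ on $\{\xi=\frac12\}$. Let $\widehat\varphi_{1/2+}=\frac{W_{1/2}}{\xi}\frac{1}{\lambda+(1-\lambda)a_{1/2}}$ on $\{\xi=3\}$ and $\widehat\varphi_{1/2+}=\frac{W_{1/2}}{(1-\lambda)\xi}\frac1{a_{1/2}}$ on $\{\xi=\frac12\}$, let $W_{1/2+}=W_{1/2}+\lambda\xi\,\widehat\varphi_{1/2+}1_{\{\xi=1/2\}}$ and $$\widehat\varphi_\sigma=\widehat\varphi_{1/2+}+\int_{1/2}^{\sigma}\frac{W_{1/2+}}{\xi}\,\frac{1-\lambda}{(\lambda+(1-\lambda)a_r)^2}\,\frac13\,dr .$$ Define $$(\widehat S_t,\widehat W_t)=\begin{cases}(1,1)&0\le t<\frac12,\\ (\xi1_{\{\xi=3\}}+(1-\lambda)\xi1_{\{\xi=1/2\}},\,W_{1/2})&t=\frac12,\\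 (\xi,\,W_{1/2+})&\frac12<t<\sigma,\\ \big((1-\lambda)S_\sigma,\ W_{1/2+}+\widehat\varphi_\sigma((1-\lambda)S_\sigma-\xi)\big)&\sigma\le t\le1,\end{cases}$$ and $\widehat Y^0=1/\widehat W$, $\widehat Y^1=\widehat S/\widehat W$. **The approximating processes.** Let $(\widetilde\eta^n)$ be strictly positive $\sigma(\eta)$-measurable random variables with $E[\widetilde\eta^n]=1$ and $b_n:=E[\widetilde\eta^n(\eta-1)]\searrow-1$. Put $$\widetilde Z^n_t=\widehat Y^0_{\frac12\wedge t}\exp\big(-(n-1)(\sigma\wedge t-\tfrac12)^+\big)\big(1+(n\widetilde\eta^n-1)1_{\{\sigma\le t\}}\big),$$ $$\widetilde A^n_t=(1-\lambda)\xi\,e^{n(t-\frac12)}\int_{1/2}^t n a_rb_n e^{-n(r-\frac12)}dr,$$ i.e. the solution of $\widetilde A^n_t=\int_{1/2}^t((1-\lambda)\xi a_rb_n+\widetilde A^n_r)\,n\,dr$, and let $\widetilde M^n_t=\widehat S_t$ for $t\le\frac12$, $\widetilde M^n_t=(1-\lambda)\xi-\widetilde A^n_t$ for $\frac12<t<\sigma$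 and $\widetilde M^n_t=(1-\lambda)S_\sigma$ for $\sigma\le t\le1$. Let $\widetilde\sigma_n=\inf\{t\in(\frac12,\sigma):\widetilde M^n_t>\xi\}$ (with $\inf\emptyset=1$) on $\{\xi=\frac12\}$ and $\widetilde\sigma_n=\frac12$ on $\{\xi=3\}$. Let $\eta^n=\eta\vee\frac1n$, let $\widehat\ell^n_t$ be the maximiser over $\ell\in\mathbb R$ of $E[\log(1+\ell((1-\lambda)(1+a_t(\eta^n-1))-1))]$ (with $\log y=-\infty$ for $y\le0$), and $$\widehat\eta^n_t=\frac1{1+\widehat\ell^n_t\big((1-\lambda)(1+a_t(\eta^n-1))-1\big)}.$$ Finally let $(Z^{0,n}_t,Z^{1,n}_t)=(\widehat Y^0_t,\widehat Y^1_t)$ for $0\le t\le\frac12$, $(Z^{0,n}_t,Z^{1,n}_t)=(\widetilde Z^n_t,\widetilde Z^n_t\widetilde M^n_t)$ for $\frac12<t\le\widetilde\sigma_n$, and, for $\widetilde\sigma_n<t\le1$, $$Z^{0,n}_t=\widetilde Z^n_{\widetilde\sigma_n}\big(1+(\widehat\eta^n_\sigma-1)1_{\{\sigma\le t\}}\big),\qquad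 Z^{1,n}_t=\widetilde Z^n_{\widetilde\sigma_n}\Big(1+\big(\widehat\eta^n_\sigma(1-\lambda)(1+a_\sigma(\eta^n-1))-1\big)1_{\{\sigma\le t\}}\Big)\xi .$$ **Claim.** 1. For all sufficiently large $n$, $Z^{0,n}$ and $Z^{1,n}$ are càdlàg martingales and $(Z^{0,n},Z^{1,n})$ is a $\lambda$-consistent price system for $S$. 2. For every $[0,1]$-valued stopping time $\tau$, $(Z^{0,n}_\tau,Z^{1,n}_\tau)\to(\widehat Y^0_\tau,\widehat Y^1_\tau)$ in probability as $n\to\infty$. 3. The limit $(\widehat Y^0,\widehat Y^1)$ has làdlàg paths a.s., and on $\{\xi=\frac12\}$ (an event of probability $\frac16$) it has, a.s., the strictly negative right jumps at time $\frac12$ $$\widehat Y^0_{\frac12+}-\widehat Y^0_{\frac12}=-\widehat Y^0_{\frac12}\frac{\lambda}{\lambda+(1-\lambda)a_{1/2}},\qquad \widehat Y^1_{\frac12+}-\widehat Y^1_{\frac12}=-\widehat Y^1_{\frac12}\frac{\lambda(1-a_{1/2})}{\lambda+(1-\lambda)a_{1/2}}.$$ -/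

import Mathlib

open MeasureTheory ProbabilityTheory Filter Topology Set

noncomputable section

namespace LadlagExample

/-! ### Path properties and consistent price systems, time horizon `[0,1]` -/

/-- Right continuous with left limits, on `[0,1]`. -/
def IsCadlagPath (f : unitInterval → ℝ) : Prop :=
  ∀ t, ContinuousWithinAt f (Ici t) t ∧ ∃ l, Tendsto f (𝓝[<] t) (𝓝 l)

/-- With left and right limits, on `[0,1]`. -/
def IsLadlagPath (f : unitInterval → ℝ) : Prop :=
  ∀ t, (∃ l, Tendsto f (𝓝[<] t) (𝓝 l)) ∧ ∃ r, Tendsto f (𝓝[>] t) (𝓝 r)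

/-- A martingale on `[0,1]` with (almost surely) càdlàg paths. -/
def IsCadlagMartingale {Ω : Type*} {m : MeasurableSpace Ω} (X : unitInterval → Ω → ℝ)
    (𝓕 : Filtration unitInterval m) (P : Measure Ω) : Prop :=
  Martingale X 𝓕 P ∧ ∀ᵐ ω ∂P, IsCadlagPath (fun t => X t ω)

/-- A local martingale on `[0,1]`. -/
def IsLocalMartingale {Ω : Type*} {m : MeasurableSpace Ω} (X : unitInterval → Ω → ℝ)
    (𝓕 : Filtration unitInterval m) (P : Measure Ω) : Prop :=
  Locally (fun Y => IsCadlagMartingale Y 𝓕 P) 𝓕 X P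

/-- `Z` is the (càdlàg) density process of `Q` with respect to `P`. -/
structure IsDensityProcess {Ω : Type*} {m : MeasurableSpace Ω} (Z : unitInterval → Ω → ℝ)
    (𝓕 : Filtration unitInterval m) (Q P : Measure Ω) : Prop where
  adapted : StronglyAdapted 𝓕 Z
  cadlag : ∀ᵐ ω ∂P, IsCadlagPath (fun t => Z t ω)
  integrable : ∀ t, Integrable (Z t) P
  density : ∀ t, ∀ A, MeasurableSet[𝓕 t] A → Q.real A = ∫ ω in A, Z t ω ∂P

/-- `(Z⁰, Z¹)` is a `lam`-consistent price system for the ask price `S`: `Z⁰` is the density process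
of a measure `Q` equivalent to `P` under which some process `T` with values in the bid-ask spread
`[(1 - lam) S, S]` is a local martingale, and `Z¹ = Z⁰ T`. -/
def IsConsistentPriceSystem {Ω : Type*} {m : MeasurableSpace Ω} (P : Measure Ω)
    (𝓕 : Filtration unitInterval m) (lam : ℝ) (S Z0 Z1 : unitInterval → Ω → ℝ) : Prop :=
  ∃ (Q : Measure Ω) (T : unitInterval → Ω → ℝ),
    IsProbabilityMeasure Q ∧ Q ≪ P ∧ P ≪ Q ∧
    IsDensityProcess Z0 𝓕 Q P ∧
    IsLocalMartingale T 𝓕 Q ∧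
    (∀ᵐ ω ∂P, ∀ t, T t ω ∈ Icc ((1 - lam) * S t ω) (S t ω)) ∧
    ∀ᵐ ω ∂P, ∀ t, Z1 t ω = Z0 t ω * T t ω

/-! ### The market

Below, `x`, `e`, `s` stand for the values `ξ(ω)`, `η(ω)`, `σ(ω)` and `t` for time.
Almost surely `σ > 1/2`, so that `S_{1/2-} = 1` and `S_{1/2} = S_{σ-} = ξ`. -/

/-- `a_t = 1/3 - (t - 1/2)/3`. -/
def coefA (t : ℝ) : ℝ := 1 / 3 - 1 / 3 * (t - 1 / 2)

/-- `σ = (θ + 1/2) ∧ 1`. -/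
def jumpTime (u : ℝ) : ℝ := min (u + 1 / 2) 1

/-- The ask price `S_t = (1 + (ξ - 1) 1_{t ≥ 1/2}) (1 + a_σ (η - 1) 1_{t ≥ σ})`. -/
def ask (x e s t : ℝ) : ℝ :=
  (1 + (x - 1) * (if 1 / 2 ≤ t then 1 else 0)) *
    (1 + coefA s * (e - 1) * (if s ≤ t then 1 else 0))

/-- The probabilistic assumptions on `ξ`, `η` and the exponential variable `θ`. -/
structure IsModel {Ω : Type*} [MeasurableSpace Ω] (P : Measure Ω) (ε : ℝ) (ξ η θ : Ω → ℝ) :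
    Prop where
  measurable_xi : Measurable ξ
  measurable_eta : Measurable η
  measurable_theta : Measurable θ
  xi_up : P.real {ω | ξ ω = 3} = 5 / 6
  xi_down : P.real {ω | ξ ω = 1 / 2} = 1 / 6
  eta_up : P.real {ω | η ω = 2} = 1 - ε
  eta_down : ∀ n : ℕ, 1 ≤ n → P.real {ω | η ω = 1 / (n : ℝ)} = ε * (1 / 2) ^ n
  theta_exp : P.map θ = expMeasure 1
  indep : iIndepFun ![ξ, η, θ] P

/-- The ask price as a process on `[0,1]`. -/
def askProcess {Ω : Type*} (ξ η θ : Ω → ℝ) (t : unitInterval) (ω : Ω) : ℝ :=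
  ask (ξ ω) (η ω) (jumpTime (θ ω)) t

/-- The observed process `(S_t, 1_{σ ≤ t})`. -/
def observed {Ω : Type*} (ξ η θ : Ω → ℝ) (t : unitInterval) (ω : Ω) : ℝ × ℝ :=
  (askProcess ξ η θ t ω, if jumpTime (θ ω) ≤ t then 1 else 0)

lemma measurable_jumpTime : Measurable jumpTime := by
  unfold jumpTime; fun_prop

lemma measurable_observed {Ω : Type*} [MeasurableSpace Ω] {ξ η θ : Ω → ℝ}
    (hξ : Measurable ξ) (hη : Measurable η) (hθ : Measurable θ) (t : unitInterval) :
    Measurable (observed ξ η θ t) := by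
  have hs : MeasurableSet {ω | jumpTime (θ ω) ≤ (t : ℝ)} :=
    measurableSet_le (measurable_jumpTime.comp hθ) measurable_const
  have hi : Measurable (fun ω => if jumpTime (θ ω) ≤ (t : ℝ) then (1 : ℝ) else 0) :=
    Measurable.ite hs measurable_const measurable_const
  have ha : Measurable (fun ω => coefA (jumpTime (θ ω))) := by
    have := measurable_jumpTime.comp hθ
    unfold coefA
    exact measurable_const.sub (measurable_const.mul (this.sub measurable_const))
  refine Measurable.prodMk ?_ hi
  unfold askProcess ask
  exact (measurable_const.add ((hξ.sub measurable_const).mul measurable_const)).mul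
    (measurable_const.add ((ha.mul (hη.sub measurable_const)).mul hi))

/-- The σ-algebra generated by the `P`-null sets. -/
abbrev nullSigma {Ω : Type*} [MeasurableSpace Ω] (P : Measure Ω) : MeasurableSpace Ω :=
  MeasurableSpace.generateFrom {A | P A = 0}

lemma nullSigma_le {Ω : Type*} [m : MeasurableSpace Ω] (P : Measure Ω) [P.IsComplete] :
    nullSigma P ≤ m :=
  MeasurableSpace.generateFrom_le fun A hA => Measure.IsComplete.out' A hA

/-- The filtration generated by `S` and `1_{⟦σ,1⟧}`, completed and made right continuous.
The indicator is needed for `σ` to be a stopping time: on `{η = 1}` the price does not jump at `σ`. -/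
def marketFiltration {Ω : Type*} [m : MeasurableSpace Ω] (P : Measure Ω) [P.IsComplete]
    {ε : ℝ} {ξ η θ : Ω → ℝ} (h : IsModel P ε ξ η θ) : Filtration unitInterval m :=
  (Filtration.natural (observed ξ η θ) (fun t =>
      (measurable_observed h.measurable_xi h.measurable_eta h.measurable_theta
        t).stronglyMeasurable) ⊔
    Filtration.const unitInterval (nullSigma P) (nullSigma_le P)).rightCont

/-! ### The dual optimiser -/

/-- The optimal stock holdings on `(0,1/2]`: the maximiser of
`ℓ ↦ (1/6) log (1 + ℓ ((1 - lam)/2 - 1)) + (5/6) log (1 + 2 ℓ)`. -/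
def holdHalf (lam : ℝ) : ℝ := (19 - lam) / (12 * (1 + lam))

/-- The optimal wealth, evaluated at the shadow price, at time `1/2`. -/
def wealthHalf (lam x : ℝ) : ℝ :=
  if 1 < x then 1 + holdHalf lam * (x - 1) else 1 + holdHalf lam * ((1 - lam) * x - 1)

/-- The optimal stock holdings immediately after time `1/2`. -/
def holdPlus (lam x : ℝ) : ℝ :=
  if 1 < x then wealthHalf lam x / x * (1 / (lam + (1 - lam) * coefA (1 / 2)))
  else wealthHalf lam x / ((1 - lam) * x) * (1 / coefA (1 / 2))

/-- The optimal wealth, evaluated at the shadow price, immediately after time `1/2`. -/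
def wealthPlus (lam x : ℝ) : ℝ :=
  wealthHalf lam x + (if 1 < x then 0 else holdPlus lam x * (x - (1 - lam) * x))

/-- The optimal stock holdings. -/
def hold (lam x s t : ℝ) : ℝ :=
  if t ≤ 0 then 0
  else if t ≤ 1 / 2 then holdHalf lam
  else holdPlus lam x + ∫ r in (1 / 2 : ℝ)..(min s t),
    wealthPlus lam x / x * ((1 - lam) / (lam + (1 - lam) * coefA r) ^ 2) * (1 / 3)

/-- The candidate shadow price. -/
def shadow (lam x e s t : ℝ) : ℝ :=
  if t < 1 / 2 then 1
  else if t = 1 / 2 then (if 1 < x then x else (1 - lam) * x)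
  else if t < s then x
  else (1 - lam) * ask x e s s

/-- The optimal wealth, evaluated at the shadow price. -/
def wealth (lam x e s t : ℝ) : ℝ :=
  if t < 1 / 2 then 1
  else if t = 1 / 2 then wealthHalf lam x
  else if t < s then wealthPlus lam x
  else wealthPlus lam x + hold lam x s s * ((1 - lam) * ask x e s s - x)

/-- First component of the dual optimiser. -/
def dualY0 (lam x e s t : ℝ) : ℝ := 1 / wealth lam x e s t

/-- Second component of the dual optimiser. -/
def dualY1 (lam x e s t : ℝ) : ℝ := shadow lam x e s t / wealth lam x e s t

/-! ### The approximating processes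

`g` stands for the value of the density `η̃ⁿ`, and `b` for `bₙ = E[η̃ⁿ (η - 1)]`. -/

/-- Strictly positive `σ(η)`-measurable densities `η̃ⁿ` with `E[η̃ⁿ (η - 1)]` decreasing to `-1`. -/
structure IsTilting {Ω : Type*} [MeasurableSpace Ω] (P : Measure Ω) (η : Ω → ℝ)
    (etaT : ℕ → Ω → ℝ) : Prop where
  pos : ∀ n ω, 0 < etaT n ω
  measurable : ∀ n, Measurable[MeasurableSpace.comap η inferInstance] (etaT n)
  mean : ∀ n, ∫ ω, etaT n ω ∂P = 1
  antitone : Antitone fun n => ∫ ω, etaT n ω * (η ω - 1) ∂P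
  tendsto : Tendsto (fun n => ∫ ω, etaT n ω * (η ω - 1) ∂P) atTop (𝓝 (-1))

/-- The process `Z̃ⁿ`. -/
def tildeZ (lam x e s : ℝ) (n : ℕ) (g t : ℝ) : ℝ :=
  dualY0 lam x e s (min (1 / 2) t) * Real.exp (-((n : ℝ) - 1) * max (min s t - 1 / 2) 0) *
    (1 + (n * g - 1) * (if s ≤ t then 1 else 0))

/-- The compensator `Ãⁿ` before time `σ`: the solution, null at `1/2`, of
`dÃ_t = ((1 - lam) S_{1/2} a_t bₙ + Ã_t) n dt`. -/
def tildeA (lam x : ℝ) (n : ℕ) (b t : ℝ) : ℝ :=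
  (1 - lam) * x * Real.exp (n * (t - 1 / 2)) *
    ∫ r in (1 / 2 : ℝ)..t, n * coefA r * b * Real.exp (-(n * (r - 1 / 2)))

/-- The process `M̃ⁿ`. -/
def tildeM (lam x e s : ℝ) (n : ℕ) (b t : ℝ) : ℝ :=
  if t ≤ 1 / 2 then shadow lam x e s t
  else if t < s then (1 - lam) * x - tildeA lam x n b t
  else (1 - lam) * ask x e s s

/-- The time `σ̃ₙ`: on `{ΔS_{1/2} < 0}` the first time after `1/2` and before the jump at `σ` at
which `M̃ⁿ` exceeds `S_{1/2}` (and `1` if there is none), and `1/2` on `{ΔS_{1/2} > 0}`. -/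
def tildeSigma (lam x e s : ℝ) (n : ℕ) (b : ℝ) : ℝ :=
  if x < 1 then sInf ({t | 1 / 2 < t ∧ t < s ∧ x < tildeM lam x e s n b t} ∪ {1}) else 1 / 2

/-- `ηⁿ = η ∨ (1/n)`. -/
def truncEta (n : ℕ) (e : ℝ) : ℝ := max e (1 / (n : ℝ))

/-- One-period return `(1 - lam) (1 + a_t (e - 1)) - 1`. -/
def oneReturn (lam t e : ℝ) : ℝ := (1 - lam) * (1 + coefA t * (e - 1)) - 1

/-- `ℓ` maximises `E[log (1 + ℓ ((1 - lam) (1 + a_t (ηⁿ - 1)) - 1))]`, where `log y = -∞` for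
`y ≤ 0`. -/
def IsLogOptimal {Ω : Type*} [MeasurableSpace Ω] (P : Measure Ω) (η : Ω → ℝ) (lam : ℝ) (n : ℕ)
    (t ℓ : ℝ) : Prop :=
  (∀ᵐ ω ∂P, 0 < 1 + ℓ * oneReturn lam t (truncEta n (η ω))) ∧
  ∀ k : ℝ, (∀ᵐ ω ∂P, 0 < 1 + k * oneReturn lam t (truncEta n (η ω))) →
    ∫ ω, Real.log (1 + k * oneReturn lam t (truncEta n (η ω))) ∂P ≤
      ∫ ω, Real.log (1 + ℓ * oneReturn lam t (truncEta n (η ω))) ∂P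

/-- The one-period log-optimiser `ℓ̂ⁿ_t`. -/
def logOpt {Ω : Type*} [MeasurableSpace Ω] (P : Measure Ω) (η : Ω → ℝ) (lam : ℝ) (n : ℕ)
    (t : ℝ) : ℝ :=
  Classical.epsilon (IsLogOptimal P η lam n t)

/-- `η̂ⁿ_t = 1 / (1 + ℓ̂ⁿ_t ((1 - lam) (1 + a_t (ηⁿ - 1)) - 1))`. -/
def hatEta {Ω : Type*} [MeasurableSpace Ω] (P : Measure Ω) (η : Ω → ℝ) (lam : ℝ) (n : ℕ)
    (t : ℝ) (ω : Ω) : ℝ :=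
  1 / (1 + logOpt P η lam n t * oneReturn lam t (truncEta n (η ω)))

/-- First component `Ŷ⁰` of the dual optimiser as a process on `[0,1]`. -/
def Y0 {Ω : Type*} (lam : ℝ) (ξ η θ : Ω → ℝ) (t : unitInterval) (ω : Ω) : ℝ :=
  dualY0 lam (ξ ω) (η ω) (jumpTime (θ ω)) t

/-- Second component `Ŷ¹` of the dual optimiser as a process on `[0,1]`. -/
def Y1 {Ω : Type*} (lam : ℝ) (ξ η θ : Ω → ℝ) (t : unitInterval) (ω : Ω) : ℝ :=
  dualY1 lam (ξ ω) (η ω) (jumpTime (θ ω)) t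

/-- The process `Z^{0,n}`. -/
def Z0 {Ω : Type*} [MeasurableSpace Ω] (P : Measure Ω) (lam : ℝ) (ξ η θ : Ω → ℝ)
    (etaT : ℕ → Ω → ℝ) (n : ℕ) (t : unitInterval) (ω : Ω) : ℝ :=
  let x := ξ ω
  let e := η ω
  let s := jumpTime (θ ω)
  let g := etaT n ω
  let b := ∫ ω', etaT n ω' * (η ω' - 1) ∂P
  let r := tildeSigma lam x e s n b
  if (t : ℝ) ≤ 1 / 2 then dualY0 lam x e s t
  else if (t : ℝ) ≤ r then tildeZ lam x e s n g t
  else tildeZ lam x e s n g r *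
    (1 + (hatEta P η lam n s ω - 1) * (if s ≤ t then 1 else 0))

/-- The process `Z^{1,n}`. -/
def Z1 {Ω : Type*} [MeasurableSpace Ω] (P : Measure Ω) (lam : ℝ) (ξ η θ : Ω → ℝ)
    (etaT : ℕ → Ω → ℝ) (n : ℕ) (t : unitInterval) (ω : Ω) : ℝ :=
  let x := ξ ω
  let e := η ω
  let s := jumpTime (θ ω)
  let g := etaT n ω
  let b := ∫ ω', etaT n ω' * (η ω' - 1) ∂P
  let r := tildeSigma lam x e s n b
  if (t : ℝ) ≤ 1 / 2 then dualY1 lam x e s t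
  else if (t : ℝ) ≤ r then tildeZ lam x e s n g t * tildeM lam x e s n b t
  else tildeZ lam x e s n g r *
    (1 + (hatEta P η lam n s ω * ((1 - lam) * (1 + coefA s * (truncEta n e - 1))) - 1) *
      (if s ≤ t then 1 else 0)) * x

/-- The time `1/2` in `[0,1]`. -/
def halfTime : unitInterval := ⟨1 / 2, by norm_num, by norm_num⟩

end LadlagExample

end

set_option linter.unusedSectionVars false

namespace LadlagExample

/-! ### The laws of `ξ`, `η` and `σ` -/

section Laws

variable {Ω : Type*} [MeasurableSpace Ω] {P : Measure Ω} {ε : ℝ} {ξ η θ : Ω → ℝ}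

/-! Prices move only at time `1/2` and at `σ`. Given `ξ`, each approximating process is therefore a
deterministic function of time from `1/2` until `σ`, and a function of `(η, σ)` from then on, which
makes the whole argument explicit. Three mechanisms carry it.

One-period problem. Write the return at `σ` as `R = k ηⁿ - c` with `k = (1 - λ) a_t` and `c = λ +
k`. The first-order condition `E[R / (1 + ℓ R)] = 0` of the log-optimiser says that both `1 / (1 + ℓ
R)` and `(1 + R) / (1 + ℓ R)` have mean one: `η̂ⁿ` is a density, and under it the price jump is
fair. Since `E[1/η] = (1 + 3ε)/2 < 1`, for small `λ` the marginal utility is still positive at `ℓ =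
1/c`. It becomes negative near `1/(c - k/n)`, where the wealth at the lowest atom `1/n` would
vanish. So the optimiser is squeezed between these two values and tends to `1/c`
(`IsBoundedReturn.exists_score_eq_zero`, `IsModel.logOpt_spec`, `IsModel.tendsto_logOpt`). The
wealth after the jump that belongs to `ℓ = 1/c` is exactly `Ŵ` (`wealth_late`).

Fast transport from bid to ask. On `{ξ = 1/2}` the shadow price is at the bid at time `1/2` and must
be at the ask immediately afterwards. The measure change raises the intensity of `σ` to `n` and
tilts the jump downwards, so in the absence of a jump the price must drift upwards to remain a
martingale. It reaches the ask at a deterministic time `rₙ = 1/2 + O(1/n)`, where `e^{n (rₙ - 1/2)}`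
tends to `1 + 3λ/(1 - λ) = W_{1/2+}/W_{1/2}`. Meanwhile the density has lost the factor
`e^{-(n-1)(rₙ - 1/2)}`, whose limit is `W_{1/2}/W_{1/2+}` (`tendsto_exp_switchTime`). This loss in
vanishing time is the negative right jump of the limit. Since `σ > 1/2` almost surely, eventually
`rₙ < σ`, and every path converges at every time.

Martingale criterion. The event `{s < σ, ξ = v}` is an atom of the market filtration at time `s`
(`market_atom`). Hence the martingale property reduces to `E[J; s < σ] = e^{-(s - 1/2)} K(s)`, with
`K` the value before and `J` the value after the jump, together with one mean condition at time
`1/2` (`IsMartingaleData.isCadlagMartingale`). Before `rₙ` the criterion is an elementary integral,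
after `rₙ` it is the unit mean of the two jump factors, and the two regimes match because the price
equals the ask at `rₙ`. The ratio `Z¹/Z⁰` stays in the spread and is bounded, so it is a true
martingale under the new measure (`martingale_withDensity`). -/

lemma IsModel.indep_xi (h : IsModel P ε ξ η θ) : IndepFun ξ (fun ω => (η ω, θ ω)) P := by
  have := h.indep.indepFun_prodMk (fun i => by
    fin_cases i
    · exact h.measurable_xi
    · exact h.measurable_eta
    · exact h.measurable_theta) 1 2 0 (by decide) (by decide)
  exact this.symm

lemma IsModel.indep_eta_theta (h : IsModel P ε ξ η θ) : IndepFun η θ P :=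
  h.indep.indepFun (i := 1) (j := 2) (by decide)

variable [IsProbabilityMeasure P]

lemma IsModel.ae_xi (h : IsModel P ε ξ η θ) : ∀ᵐ ω ∂P, ξ ω = 3 ∨ ξ ω = 1 / 2 := by
  have h3 : MeasurableSet {ω | ξ ω = 3} := h.measurable_xi (measurableSet_singleton 3)
  have h2 : MeasurableSet {ω | ξ ω = 1 / 2} := h.measurable_xi (measurableSet_singleton _)
  have hd : Disjoint {ω | ξ ω = 3} {ω | ξ ω = 1 / 2} := by
    rw [Set.disjoint_left]
    intro ω h1 h2
    simp only [mem_ofPred_eq] at h1 h2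
    rw [h1] at h2; norm_num at h2
  have hu : P.real ({ω | ξ ω = 3} ∪ {ω | ξ ω = 1 / 2}) = 1 := by
    rw [measureReal_union hd h2, h.xi_up, h.xi_down]; norm_num
  have h1 : P ({ω | ξ ω = 3} ∪ {ω | ξ ω = 1 / 2}) = 1 := by
    rw [measureReal_def] at hu
    exact (ENNReal.toReal_eq_one_iff _).1 hu
  exact (mem_ae_iff_prob_eq_one (h3.union h2)).2 h1

/-- The atoms of the law of `η`. -/
noncomputable def etaAtom (k : ℕ) : ℝ := if k = 0 then 2 else 1 / (k : ℝ)

/-- The weights of the law of `η`. -/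
noncomputable def etaWeight (ε : ℝ) (k : ℕ) : ℝ := if k = 0 then 1 - ε else ε * (1 / 2) ^ k

lemma etaAtom_pos (k : ℕ) : 0 < etaAtom k := by
  unfold etaAtom
  split_ifs with hk
  · norm_num
  · have : (0 : ℝ) < k := by exact_mod_cast Nat.pos_of_ne_zero hk
    positivity

lemma etaAtom_le (k : ℕ) : etaAtom k ≤ 2 := by
  unfold etaAtom
  split_ifs with hk
  · norm_num
  · have : (1 : ℝ) ≤ k := by exact_mod_cast Nat.pos_of_ne_zero hk
    rw [div_le_iff₀ (by linarith)]; linarith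

lemma etaAtom_injective : Function.Injective etaAtom := by
  have key : ∀ k : ℕ, k ≠ 0 → etaAtom k ≤ 1 := by
    intro k hk
    have : (1 : ℝ) ≤ k := by exact_mod_cast Nat.pos_of_ne_zero hk
    simp only [etaAtom, hk, if_false]
    rw [div_le_iff₀ (by linarith)]; linarith
  have h0 : etaAtom 0 = 2 := by simp [etaAtom]
  intro j k hjk
  by_cases hj : j = 0 <;> by_cases hk : k = 0
  · rw [hj, hk]
  · have := key k hk; rw [← hjk, hj, h0] at this; norm_num at this
  · have := key j hj; rw [hjk, hk, h0] at this; norm_num at this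
  · simpa [etaAtom, hj, hk] using hjk

lemma IsModel.measure_etaAtom (h : IsModel P ε ξ η θ) (k : ℕ) :
    P {ω | η ω = etaAtom k} = ENNReal.ofReal (etaWeight ε k) := by
  have : P.real {ω | η ω = etaAtom k} = etaWeight ε k := by
    unfold etaAtom etaWeight
    split_ifs with hk
    · exact h.eta_up
    · exact h.eta_down k (Nat.pos_of_ne_zero hk)
  rw [← this, measureReal_def, ENNReal.ofReal_toReal (measure_ne_top _ _)]

lemma etaWeight_pos (hε : ε ∈ Set.Ioo (0 : ℝ) (1 / 3)) (k : ℕ) : 0 < etaWeight ε k := by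
  obtain ⟨h0, h1⟩ := hε
  unfold etaWeight
  split_ifs
  · linarith
  · positivity

lemma hasSum_etaWeight : HasSum (etaWeight ε) 1 := by
  -- The geometric series gives weight `ε` to `k = 0`, where `1 - ε` is wanted; the second summand
  -- is the difference.
  have h1 := (hasSum_geometric_two.mul_left ε).add (hasSum_ite_eq (0 : ℕ) (1 - 2 * ε))
  convert! h1 using 1
  · ext k
    unfold etaWeight
    by_cases hk : k = 0
    · simp only [hk, if_true, pow_zero]; ring
    · simp [hk]
  · ring

/-- This is `E[1/η] = (1 - ε)/2 + ε ∑ k 2⁻ᵏ`. It is below `1` precisely when `ε < 1/3`, which is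
where the restriction on `ε` comes from. -/
lemma hasSum_etaWeight_div :
    HasSum (fun k => etaWeight ε k / etaAtom k) ((1 + 3 * ε) / 2) := by
  have h0 := hasSum_coe_mul_geometric_of_norm_lt_one (r := (1 / 2 : ℝ)) (by norm_num)
  have h1 := (h0.mul_left ε).add (hasSum_ite_eq (0 : ℕ) ((1 - ε) / 2))
  convert! h1 using 1
  · ext k
    unfold etaWeight etaAtom
    by_cases hk : k = 0
    · simp [hk]
    · simp only [hk, if_false]; field_simp; ring
  · norm_num; ring

lemma IsModel.ae_eta (hε : ε ∈ Set.Ioo (0 : ℝ) (1 / 3)) (h : IsModel P ε ξ η θ) :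
    ∀ᵐ ω ∂P, ∃ k, η ω = etaAtom k := by
  have hm : ∀ k, MeasurableSet {ω | η ω = etaAtom k} := fun k =>
    h.measurable_eta (measurableSet_singleton _)
  have hd : Pairwise (Function.onFun Disjoint fun k => {ω | η ω = etaAtom k}) := by
    intro j k hjk
    rw [Function.onFun, Set.disjoint_left]
    intro ω h1 h2
    exact hjk (etaAtom_injective (h1.symm.trans h2))
  have : P (⋃ k, {ω | η ω = etaAtom k}) = 1 := by
    rw [measure_iUnion hd hm]
    simp_rw [h.measure_etaAtom]
    rw [← ENNReal.ofReal_tsum_of_nonneg (fun k => (etaWeight_pos hε k).le) hasSum_etaWeight.summable,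
      hasSum_etaWeight.tsum_eq, ENNReal.ofReal_one]
  have h2 := (mem_ae_iff_prob_eq_one (MeasurableSet.iUnion hm)).2 this
  filter_upwards [h2] with ω hω
  simpa using hω

lemma IsModel.ae_eta_mem (hε : ε ∈ Set.Ioo (0 : ℝ) (1 / 3)) (h : IsModel P ε ξ η θ) :
    ∀ᵐ ω ∂P, η ω ∈ Set.Ioc (0 : ℝ) 2 := by
  filter_upwards [h.ae_eta hε] with ω ⟨k, hk⟩
  rw [hk]; exact ⟨etaAtom_pos k, etaAtom_le k⟩

lemma IsModel.lintegral_inv_eta (hε : ε ∈ Set.Ioo (0 : ℝ) (1 / 3)) (h : IsModel P ε ξ η θ) :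
    ∫⁻ ω, ENNReal.ofReal (1 / η ω) ∂P = ENNReal.ofReal ((1 + 3 * ε) / 2) := by
  have hm : ∀ k, MeasurableSet {ω | η ω = etaAtom k} := fun k =>
    h.measurable_eta (measurableSet_singleton _)
  have hd : Pairwise (Function.onFun Disjoint fun k => {ω | η ω = etaAtom k}) := by
    intro j k hjk
    rw [Function.onFun, Set.disjoint_left]
    intro ω h1 h2
    exact hjk (etaAtom_injective (h1.symm.trans h2))
  have hu : (⋃ k, {ω | η ω = etaAtom k}) =ᵐ[P] (univ : Set Ω) := by
    rw [eventuallyEq_univ]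
    filter_upwards [h.ae_eta hε] with ω hω
    simpa using hω
  rw [← setLIntegral_univ, ← setLIntegral_congr hu, lintegral_iUnion hm hd]
  have : ∀ k, ∫⁻ ω in {ω | η ω = etaAtom k}, ENNReal.ofReal (1 / η ω) ∂P
      = ENNReal.ofReal (etaWeight ε k / etaAtom k) := by
    intro k
    rw [setLIntegral_congr_fun (hm k) (g := fun _ => ENNReal.ofReal (1 / etaAtom k)),
      setLIntegral_const, h.measure_etaAtom, ← ENNReal.ofReal_mul]
    · congr 1; ring
    · exact (one_div_pos.2 (etaAtom_pos k)).le
    · intro ω hω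
      simp only [mem_ofPred_eq] at hω
      simp only [hω]
  simp_rw [this]
  rw [← ENNReal.ofReal_tsum_of_nonneg (fun k => (div_pos (etaWeight_pos hε k) (etaAtom_pos k)).le)
    hasSum_etaWeight_div.summable, hasSum_etaWeight_div.tsum_eq]

/-- Truncation from below can only decrease `1/η`, so the bound is uniform in `n`. -/
lemma IsModel.integral_inv_truncEta_le (hε : ε ∈ Set.Ioo (0 : ℝ) (1 / 3)) (h : IsModel P ε ξ η θ)
    (n : ℕ) : ∫ ω, 1 / truncEta n (η ω) ∂P ≤ (1 + 3 * ε) / 2 := by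
  have hpos : (0 : ℝ) ≤ (1 + 3 * ε) / 2 := by linarith [hε.1]
  have hmeas : Measurable fun ω => 1 / truncEta n (η ω) := by
    have := h.measurable_eta
    unfold truncEta; fun_prop
  rw [integral_eq_lintegral_of_nonneg_ae]
  · refine ENNReal.toReal_le_of_le_ofReal hpos ?_
    rw [← h.lintegral_inv_eta hε]
    refine lintegral_mono_ae ?_
    filter_upwards [h.ae_eta_mem hε] with ω hω
    exact ENNReal.ofReal_le_ofReal (one_div_le_one_div_of_le hω.1 (le_max_left _ _))
  · filter_upwards [h.ae_eta_mem hε] with ω hω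
    exact one_div_nonneg.2 (hω.1.le.trans (le_max_left _ _))
  · exact hmeas.aestronglyMeasurable

lemma jumpTime_le_one (u : ℝ) : jumpTime u ≤ 1 := min_le_right _ _

lemma IsModel.measure_theta_le (h : IsModel P ε ξ η θ) (u : ℝ) :
    P.real {ω | θ ω ≤ u} = if 0 ≤ u then 1 - Real.exp (-u) else 0 := by
  have := cdf_expMeasure_eq (r := 1) one_pos u
  have hprob := isProbabilityMeasure_expMeasure (r := 1) one_pos
  rw [cdf_eq_real (expMeasure 1), ← h.theta_exp, map_measureReal_apply h.measurable_theta measurableSet_Iic,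
    one_mul] at this
  exact this

lemma IsModel.ae_theta_pos (h : IsModel P ε ξ η θ) : ∀ᵐ ω ∂P, 0 < θ ω := by
  have := h.measure_theta_le 0
  rw [if_pos le_rfl] at this
  simp only [neg_zero, Real.exp_zero, sub_self] at this
  rw [measureReal_eq_zero_iff] at this
  rw [ae_iff]; simpa using this

lemma IsModel.ae_half_lt_jumpTime (h : IsModel P ε ξ η θ) :
    ∀ᵐ ω ∂P, 1 / 2 < jumpTime (θ ω) := by
  filter_upwards [h.ae_theta_pos] with ω hω
  unfold jumpTime
  exact lt_min (by linarith) (by norm_num)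

lemma lt_jumpTime_iff {u s : ℝ} (hs : s < 1) : s < jumpTime u ↔ s - 1 / 2 < u := by
  unfold jumpTime
  rw [lt_min_iff]
  constructor
  · intro h; linarith [h.1]
  · intro h; exact ⟨by linarith, hs⟩

lemma IsModel.measure_lt_jumpTime (h : IsModel P ε ξ η θ) {s : ℝ} (hs : 1 / 2 ≤ s) (hs1 : s < 1) :
    P.real {ω | s < jumpTime (θ ω)} = Real.exp (-(s - 1 / 2)) := by
  have h1 : {ω | s < jumpTime (θ ω)} = {ω | θ ω ≤ s - 1 / 2}ᶜ := by
    ext ω; simp [lt_jumpTime_iff hs1]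
  rw [h1, probReal_compl_eq_one_sub (measurableSet_le h.measurable_theta measurable_const), h.measure_theta_le,
    if_pos (by linarith)]
  ring

/-- The condition `r < 1` keeps away from the atom of `σ` at `1`: on the event considered `σ = θ +
1/2`, with a shifted exponential density. -/
lemma IsModel.setIntegral_jumpTime (h : IsModel P ε ξ η θ) {s r : ℝ} (hs : 1 / 2 ≤ s) (hsr : s ≤ r)
    (hr : r < 1) {f : ℝ → ℝ} (hf : Measurable f) :
    ∫ ω in {ω | s < jumpTime (θ ω) ∧ jumpTime (θ ω) ≤ r}, f (jumpTime (θ ω)) ∂P =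
      ∫ u in s..r, f u * Real.exp (-(u - 1 / 2)) := by
  have hset : {ω | s < jumpTime (θ ω) ∧ jumpTime (θ ω) ≤ r}
      = θ ⁻¹' (Ioc (s - 1 / 2) (r - 1 / 2)) := by
    ext ω
    simp only [mem_ofPred_eq, mem_preimage, mem_Ioc]
    rw [lt_jumpTime_iff (hsr.trans_lt hr), ← not_lt, lt_jumpTime_iff hr, not_lt]
  have hmeas : MeasurableSet (Ioc (s - 1 / 2) (r - 1 / 2)) := measurableSet_Ioc
  rw [hset, setIntegral_congr_fun (g := fun ω => f (θ ω + 1 / 2)) (h.measurable_theta hmeas),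
    ← setIntegral_map (f := fun y => f (y + 1 / 2)) hmeas
      (hf.comp (measurable_id.add_const _)).aestronglyMeasurable h.measurable_theta.aemeasurable, h.theta_exp, expMeasure, gammaMeasure]
  · change ∫ y in Ioc (s - 1 / 2) (r - 1 / 2), f (y + 1 / 2)
      ∂(volume.withDensity fun x => ENNReal.ofReal (gammaPDFReal 1 1 x)) = _
    rw [setIntegral_withDensity_eq_setIntegral_toReal_smul]
    · rw [← intervalIntegral.integral_of_le (by linarith)]
      have := intervalIntegral.integral_comp_add_right
        (a := s - 1 / 2) (b := r - 1 / 2) (fun u => f u * Real.exp (-(u - 1 / 2))) (1 / 2)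
      rw [sub_add_cancel, sub_add_cancel] at this
      rw [← this]
      refine intervalIntegral.integral_congr_ae ?_
      filter_upwards with y hy
      rw [uIoc_of_le (by linarith)] at hy
      have hy0 : 0 ≤ y := by linarith [hy.1]
      have : gammaPDFReal 1 1 y = Real.exp (-y) := by simp [gammaPDFReal, hy0]
      simp only [this, smul_eq_mul]
      rw [ENNReal.toReal_ofReal (Real.exp_pos _).le]
      ring_nf
    · exact (measurable_gammaPDFReal 1 1).ennreal_ofReal
    · filter_upwards with y; exact ENNReal.ofReal_lt_top
    · exact hmeas
  · intro ω hω
    simp only [mem_preimage, mem_Ioc] at hω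
    have : jumpTime (θ ω) = θ ω + 1 / 2 := by
      unfold jumpTime; exact min_eq_left (by linarith [hω.2])
    simp only [this]

end Laws

/-! ### One-period log-optimal investment

The return is `k X - c`, where `X` takes values in `[m, 2]` and charges both end points. -/

section LogOptimal

variable {Ω : Type*} [MeasurableSpace Ω] {P : Measure Ω}

/-- The derivative of the expected logarithmic utility. -/
noncomputable def score (P : Measure Ω) (X : Ω → ℝ) (k c l : ℝ) : ℝ :=
  ∫ ω, (k * X ω - c) / (1 + l * (k * X ω - c)) ∂P

/-- A random variable with values in `[m, 2]` charging the end points, and a return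
`k X - c` which is negative at the lower end point. -/
structure IsBoundedReturn (P : Measure Ω) (X : Ω → ℝ) (m k c : ℝ) : Prop where
  measurable : Measurable X
  m_pos : 0 < m
  mem : ∀ᵐ ω ∂P, X ω ∈ Icc m 2
  low : P {ω | X ω = m} ≠ 0
  high : P {ω | X ω = 2} ≠ 0
  k_pos : 0 < k
  lt_c : k * m < c

variable {X : Ω → ℝ} {m k c : ℝ}

lemma exists_of_ae_of_measure_ne_zero {p : Ω → Prop} {A : Set Ω} (hp : ∀ᵐ ω ∂P, p ω)
    (hA : P A ≠ 0) : ∃ ω ∈ A, p ω := by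
  by_contra! hcon
  refine hA (measure_mono_null ?_ (ae_iff.1 hp))
  intro ω hω
  exact hcon ω hω

lemma IsBoundedReturn.c_pos (h : IsBoundedReturn P X m k c) : 0 < c :=
  (mul_pos h.k_pos h.m_pos).trans h.lt_c

lemma IsBoundedReturn.le_factor (h : IsBoundedReturn P X m k c) {l x : ℝ} (hl : 0 ≤ l)
    (hx : m ≤ x) : 1 - l * (c - k * m) ≤ 1 + l * (k * x - c) := by
  have := mul_le_mul_of_nonneg_left hx h.k_pos.le
  nlinarith

lemma IsBoundedReturn.abs_return_le (h : IsBoundedReturn P X m k c) {x : ℝ} (hx : x ∈ Icc m 2) :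
    |k * x - c| ≤ 2 * k + c := by
  have h1 := mul_le_mul_of_nonneg_left hx.2 h.k_pos.le
  have h2 := mul_nonneg h.k_pos.le (h.m_pos.le.trans hx.1)
  rw [abs_le]; constructor <;> linarith [h.c_pos, h.k_pos]

lemma IsBoundedReturn.bound (h : IsBoundedReturn P X m k c) {l x δ : ℝ} (hl : 0 ≤ l) (hδ : 0 < δ)
    (hld : δ ≤ 1 - l * (c - k * m)) (hx : x ∈ Icc m 2) :
    ‖(k * x - c) / (1 + l * (k * x - c))‖ ≤ (2 * k + c) / δ := by
  have h1 := h.le_factor hl hx.1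
  rw [Real.norm_eq_abs, abs_div, abs_of_pos (a := 1 + _) (by linarith)]
  have := h.k_pos
  have := h.c_pos
  exact div_le_div₀ (by linarith) (h.abs_return_le hx) hδ (by linarith)

lemma IsBoundedReturn.ae_pos (h : IsBoundedReturn P X m k c) {l : ℝ} (hl : 0 ≤ l)
    (hld : l * (c - k * m) < 1) : ∀ᵐ ω ∂P, 0 < 1 + l * (k * X ω - c) := by
  filter_upwards [h.mem] with ω hω
  have := h.le_factor hl hω.1
  linarith

variable [IsProbabilityMeasure P]

lemma IsBoundedReturn.integrable_score (h : IsBoundedReturn P X m k c) {l : ℝ} (hl : 0 ≤ l)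
    (hld : l * (c - k * m) < 1) :
    Integrable (fun ω => (k * X ω - c) / (1 + l * (k * X ω - c))) P := by
  have hX := h.measurable
  refine Integrable.of_bound (Measurable.aestronglyMeasurable (by fun_prop)) ((2 * k + c) / (1 - l * (c - k * m))) ?_
  filter_upwards [h.mem] with ω hω
  exact h.bound hl (by linarith) le_rfl hω

/-- Intermediate value theorem for the marginal utility. At `l = 1/c` the factor `1 + l (k X - c)`
is `k X / c`, so the score is `c - (c²/k) E[1/X]`, nonnegative by `hmean`. Near `l = 1/(c - k m)`
the atom at `m` drives it below zero. -/
lemma IsBoundedReturn.exists_score_eq_zero (h : IsBoundedReturn P X m k c)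
    (hmean : c * ∫ ω, 1 / X ω ∂P < k) :
    ∃ l, 1 / c ≤ l ∧ l * (c - k * m) < 1 ∧ score P X k c l = 0 := by
  have hX := h.measurable
  have hc := h.c_pos
  have hk := h.k_pos
  have hm := h.m_pos
  have hd : 0 < c - k * m := by linarith [h.lt_c]
  set d := c - k * m with hd_def
  set p := P.real {ω | X ω = m} with hp_def
  have hp : 0 < p := by
    rw [hp_def, measureReal_def]
    exact ENNReal.toReal_pos h.low (measure_ne_top _ _)
  -- At the right end point `l₁` the factor at `X = m` equals `δ`. The first entry makes the loss `p
  -- d / δ` from this atom at least `2 k + 1`, more than the gain of at most `2 k` from the rest;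
  -- the second entry ensures `1/c ≤ l₁`.
  set δ := min (p * d / (2 * k + 1)) (k * m / c) with hδ
  have hδ0 : 0 < δ := lt_min (by positivity) (by positivity)
  set l₁ := (1 - δ) / d with hl₁
  have hl₁d : l₁ * d = 1 - δ := by rw [hl₁]; field_simp
  have hle : 1 / c ≤ l₁ := by
    rw [hl₁, le_div_iff₀ hd]
    have : δ ≤ k * m / c := min_le_right _ _
    have h2 : 1 / c * d = 1 - k * m / c := by rw [hd_def]; field_simp
    linarith
  have hc0 : 0 < 1 / c := by positivity
  have hcont : ContinuousOn (score P X k c) (Icc (1 / c) l₁) := by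
    refine continuousOn_of_dominated (bound := fun _ => (2 * k + c) / δ) ?_ ?_ ?_ ?_
    · intro l _
      exact Measurable.aestronglyMeasurable (by fun_prop)
    · intro l hl
      filter_upwards [h.mem] with ω hω
      refine h.bound (hc0.le.trans hl.1) hδ0 ?_ hω
      have := mul_le_mul_of_nonneg_right hl.2 hd.le
      rw [← hd_def]; linarith
    · exact integrable_const _
    · filter_upwards [h.mem] with ω hω
      refine ContinuousOn.div continuousOn_const (by fun_prop) ?_
      intro l hl
      have h1 := h.le_factor (hc0.le.trans hl.1) hω.1
      have := mul_le_mul_of_nonneg_right hl.2 hd.le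
      rw [← hd_def] at h1
      linarith
  have hlow : 0 ≤ score P X k c (1 / c) := by
    have hi : Integrable (fun ω => 1 / X ω) P := by
      refine Integrable.of_bound (Measurable.aestronglyMeasurable (by fun_prop)) (1 / m) ?_
      filter_upwards [h.mem] with ω hω
      rw [Real.norm_eq_abs, abs_of_pos (one_div_pos.2 (hm.trans_le hω.1))]
      exact one_div_le_one_div_of_le hm hω.1
    have : score P X k c (1 / c) = ∫ ω, (c - c ^ 2 / k * (1 / X ω)) ∂P := by
      refine integral_congr_ae ?_
      filter_upwards [h.mem] with ω hω
      have : 0 < X ω := hm.trans_le hω.1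
      have h3 : 1 + 1 / c * (k * X ω - c) = k * X ω / c := by field_simp; ring
      rw [h3]; field_simp
    rw [this, integral_sub (integrable_const _) (hi.const_mul _), integral_const_mul]
    simp only [integral_const, probReal_univ, smul_eq_mul]
    have h4 : c ^ 2 / k * ∫ ω, 1 / X ω ∂P = c / k * (c * ∫ ω, 1 / X ω ∂P) := by ring
    rw [h4]
    have h5 : c / k * (c * ∫ ω, 1 / X ω ∂P) ≤ c / k * k :=
      mul_le_mul_of_nonneg_left hmean.le (by positivity)
    rw [div_mul_cancel₀ _ hk.ne'] at h5
    linarith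
  have hhigh : score P X k c l₁ ≤ 0 := by
    have hl₁0 : 0 ≤ l₁ := hc0.le.trans hle
    have hms : MeasurableSet {ω | X ω = m} := h.measurable (measurableSet_singleton _)
    have h1 : score P X k c l₁ ≤ ∫ ω, (2 * k + {ω | X ω = m}.indicator (fun _ => - d / δ) ω) ∂P := by
      refine integral_mono_ae (h.integrable_score hl₁0 (by rw [← hd_def]; linarith)) ?_ ?_
      · exact (integrable_const _).add ((integrable_const _).indicator hms)
      · filter_upwards [h.mem] with ω hω
        by_cases hXm : X ω = m
        · have h6 : k * m - c = - d := by rw [hd_def]; ring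
          have h7 : 1 + l₁ * -d = δ := by linarith
          simp only [indicator, mem_ofPred_eq, hXm, if_true, h6, h7]
          linarith
        · simp only [indicator, mem_ofPred_eq, hXm, if_false, add_zero]
          have h1 := h.le_factor hl₁0 hω.1
          rw [← hd_def] at h1
          have hpos : 0 < 1 + l₁ * (k * X ω - c) := by linarith
          rw [div_le_iff₀ hpos]
          have hX2 := mul_le_mul_of_nonneg_left hω.2 hk.le
          rcases le_total 0 (k * X ω - c) with h0 | h0
          · have := mul_nonneg hl₁0 h0
            nlinarith
          · have := mul_pos hk hpos
            linarith
    rw [integral_add (integrable_const _) ((integrable_const _).indicator hms),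
      integral_indicator_const _ hms] at h1
    simp only [integral_const, probReal_univ, smul_eq_mul, one_mul] at h1
    rw [← hp_def] at h1
    have h8 : 2 * k + 1 ≤ p * d / δ := by
      rw [le_div_iff₀ hδ0, ← le_div_iff₀' (by linarith)]
      exact min_le_left _ _
    have : p * (-d / δ) = - (p * d / δ) := by ring
    linarith
  obtain ⟨l, hl, hl0⟩ := intermediate_value_Icc' hle hcont ⟨hhigh, hlow⟩
  refine ⟨l, hl.1, ?_, hl0⟩
  have := mul_le_mul_of_nonneg_right hl.2 hd.le
  linarith

/-- Both end points are charged, so admissibility makes the factor positive there. Being affine in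
`X`, it then lies between two positive constants, whatever the sign of `l`. -/
lemma IsBoundedReturn.integrable_log (h : IsBoundedReturn P X m k c) {l : ℝ}
    (hl : ∀ᵐ ω ∂P, 0 < 1 + l * (k * X ω - c)) :
    Integrable (fun ω => Real.log (1 + l * (k * X ω - c))) P := by
  have hX := h.measurable
  obtain ⟨ω₁, hω₁, h1⟩ := exists_of_ae_of_measure_ne_zero hl h.low
  obtain ⟨ω₂, hω₂, h2⟩ := exists_of_ae_of_measure_ne_zero hl h.high
  simp only [mem_ofPred_eq] at hω₁ hω₂
  rw [hω₁] at h1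
  rw [hω₂] at h2
  set A := 1 + l * (k * m - c) with hA
  set B := 1 + l * (k * 2 - c) with hB
  have hAB : 0 < min A B := lt_min h1 h2
  refine Integrable.of_bound (Measurable.aestronglyMeasurable (by fun_prop))
    (max |Real.log (min A B)| |Real.log (max A B)|) ?_
  filter_upwards [h.mem] with ω hω
  have hlk : min A B ≤ 1 + l * (k * X ω - c) ∧ 1 + l * (k * X ω - c) ≤ max A B := by
    have e1 := mul_le_mul_of_nonneg_left hω.1 h.k_pos.le
    have e2 := mul_le_mul_of_nonneg_left hω.2 h.k_pos.le
    rcases le_total 0 l with hl | hl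
    · constructor
      · refine (min_le_left _ _).trans ?_
        rw [hA]; nlinarith
      · refine le_trans ?_ (le_max_right _ _)
        rw [hB]; nlinarith
    · constructor
      · refine (min_le_right _ _).trans ?_
        rw [hB]; nlinarith
      · refine le_trans ?_ (le_max_left _ _)
        rw [hA]; nlinarith
  have l1 := Real.log_le_log hAB hlk.1
  have l2 := Real.log_le_log (hAB.trans_le hlk.1) hlk.2
  exact abs_le_max_abs_abs l1 l2

/-- A zero of the score maximises the expected logarithm, and it is the only maximiser. -/
lemma IsBoundedReturn.log_le (h : IsBoundedReturn P X m k c) {l l' : ℝ} (hl : 0 ≤ l)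
    (hld : l * (c - k * m) < 1) (h0 : score P X k c l = 0)
    (hl' : ∀ᵐ ω ∂P, 0 < 1 + l' * (k * X ω - c)) :
    ∫ ω, Real.log (1 + l' * (k * X ω - c)) ∂P ≤ ∫ ω, Real.log (1 + l * (k * X ω - c)) ∂P ∧
    (∫ ω, Real.log (1 + l * (k * X ω - c)) ∂P ≤ ∫ ω, Real.log (1 + l' * (k * X ω - c)) ∂P →
      l' = l) := by
  have hpos := h.ae_pos hl hld
  have i1 := h.integrable_log hl'
  have i2 := h.integrable_log hpos
  have i3 := (h.integrable_score hl hld).const_mul (l' - l)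
  -- With `ρ` the ratio of the two wealths, `g = ρ - 1 - log ρ ≥ 0`. The linear term integrates to
  -- zero because `l` is a zero of the score, so the mean of `g` is the difference of the utilities.
  set g : Ω → ℝ := fun ω => (l' - l) * ((k * X ω - c) / (1 + l * (k * X ω - c))) -
      (Real.log (1 + l' * (k * X ω - c)) - Real.log (1 + l * (k * X ω - c))) with hg
  have key : ∀ ω, 0 < 1 + l * (k * X ω - c) → 0 < 1 + l' * (k * X ω - c) →
      g ω = (1 + l' * (k * X ω - c)) / (1 + l * (k * X ω - c)) - 1 -
        Real.log ((1 + l' * (k * X ω - c)) / (1 + l * (k * X ω - c))) := by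
    intro ω p1 p2
    simp only [hg]
    rw [Real.log_div p2.ne' p1.ne']
    field_simp
    ring
  have hgn : 0 ≤ᵐ[P] g := by
    filter_upwards [hpos, hl'] with ω p1 p2
    simp only [Pi.zero_apply]
    rw [key ω p1 p2]
    linarith [Real.log_le_sub_one_of_pos (div_pos p2 p1)]
  have hgi : Integrable g P := i3.sub (i1.sub i2)
  have hInt : ∫ ω, g ω ∂P = ∫ ω, Real.log (1 + l * (k * X ω - c)) ∂P
      - ∫ ω, Real.log (1 + l' * (k * X ω - c)) ∂P := by
    have e1 := integral_sub i3 (i1.sub i2)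
    have e2 := integral_sub i1 i2
    simp only [Pi.sub_apply] at e1
    rw [integral_const_mul, e2] at e1
    simp only [hg]
    rw [e1]
    rw [score] at h0
    rw [h0]; ring
  have hge : 0 ≤ ∫ ω, g ω ∂P := integral_nonneg_of_ae hgn
  refine ⟨by linarith, fun hle => ?_⟩
  -- Equal utilities force `ρ = 1` almost surely; evaluating on the atom `X = m`, where the return
  -- is nonzero, gives `l' = l`.
  have hz : g =ᵐ[P] 0 := (integral_eq_zero_iff_of_nonneg_ae hgn hgi).1 (by linarith)
  obtain ⟨ω, hω, ⟨p1, p2⟩, p3⟩ := exists_of_ae_of_measure_ne_zero ((hpos.and hl').and hz) h.low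
  simp only [mem_ofPred_eq] at hω
  rw [key ω p1 p2] at p3
  simp only [Pi.zero_apply] at p3
  have hone : (1 + l' * (k * X ω - c)) / (1 + l * (k * X ω - c)) = 1 := by
    by_contra hne
    linarith [Real.log_lt_sub_one_of_pos (div_pos p2 p1) hne]
  rw [div_eq_one_iff_eq p1.ne', hω] at hone
  have hd : k * m - c ≠ 0 := by have := h.lt_c; intro h; linarith
  have : l' * (k * m - c) = l * (k * m - c) := by linarith
  exact mul_right_cancel₀ hd this

/-- The score is strictly decreasing: with `R` the return, the scores at `q` and `l` differ by `(l -
q) E[R² / ((1 + l R)(1 + q R))]`. This turns superlevel sets of the optimiser into sign conditions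
on the score, which is how its measurability in time is obtained. -/
lemma IsBoundedReturn.score_pos_iff (h : IsBoundedReturn P X m k c) {l q : ℝ} (hl : 0 ≤ l)
    (hld : l * (c - k * m) < 1) (h0 : score P X k c l = 0) (hq : 0 ≤ q)
    (hqd : q * (c - k * m) < 1) : 0 < score P X k c q ↔ q < l := by
  have aux : ∀ y, 0 < 1 + l * y → 0 < 1 + q * y →
      y / (1 + q * y) - y / (1 + l * y) = (l - q) * (y ^ 2 / ((1 + l * y) * (1 + q * y))) := by
    intro y h1 h2
    rw [div_sub_div _ _ h2.ne' h1.ne', ← mul_div_assoc,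
      div_eq_div_iff (mul_pos h2 h1).ne' (mul_pos h1 h2).ne']
    ring
  have hdiff : score P X k c q = ∫ ω, (l - q) * ((k * X ω - c) ^ 2 /
      ((1 + l * (k * X ω - c)) * (1 + q * (k * X ω - c)))) ∂P := by
    rw [← sub_zero (score P X k c q), ← h0, score, score,
      ← integral_sub (h.integrable_score hq hqd) (h.integrable_score hl hld)]
    refine integral_congr_ae ?_
    filter_upwards [h.ae_pos hl hld, h.ae_pos hq hqd] with ω p1 p2
    exact aux _ p1 p2
  have hi : Integrable (fun ω => (l - q) * ((k * X ω - c) ^ 2 /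
      ((1 + l * (k * X ω - c)) * (1 + q * (k * X ω - c))))) P := by
    refine ((h.integrable_score hq hqd).sub (h.integrable_score hl hld)).congr ?_
    filter_upwards [h.ae_pos hl hld, h.ae_pos hq hqd] with ω p1 p2
    exact aux _ p1 p2
  constructor
  · intro hs
    by_contra! hle
    rw [hdiff, integral_const_mul] at hs
    have : 0 ≤ ∫ ω, (k * X ω - c) ^ 2 /
      ((1 + l * (k * X ω - c)) * (1 + q * (k * X ω - c))) ∂P := by
      refine integral_nonneg_of_ae ?_
      filter_upwards [h.ae_pos hl hld, h.ae_pos hq hqd] with ω p1 p2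
      simp only [Pi.zero_apply]; positivity
    nlinarith
  · intro hlt
    have hnn : 0 ≤ᵐ[P] fun ω => (l - q) * ((k * X ω - c) ^ 2 /
      ((1 + l * (k * X ω - c)) * (1 + q * (k * X ω - c)))) := by
      filter_upwards [h.ae_pos hl hld, h.ae_pos hq hqd] with ω p1 p2
      have : 0 < l - q := by linarith
      simp only [Pi.zero_apply]; positivity
    rw [hdiff]
    refine lt_of_le_of_ne (integral_nonneg_of_ae hnn) fun hz => ?_
    have hz' := (integral_eq_zero_iff_of_nonneg_ae hnn hi).1 hz.symm
    obtain ⟨ω, hω, ⟨p1, p2⟩, p3⟩ := exists_of_ae_of_measure_ne_zero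
      (((h.ae_pos hl hld).and (h.ae_pos hq hqd)).and hz') h.low
    simp only [mem_ofPred_eq] at hω
    have hd : k * X ω - c ≠ 0 := by rw [hω]; have := h.lt_c; intro h; linarith
    have : 0 < l - q := by linarith
    have : 0 < (k * X ω - c) ^ 2 := by positivity
    have h9 : 0 < (l - q) * ((k * X ω - c) ^ 2 /
      ((1 + l * (k * X ω - c)) * (1 + q * (k * X ω - c)))) := by positivity
    simp only [Pi.zero_apply] at p3
    linarith

/-- With `R` the return, `1/(1 + l R) = 1 - l R/(1 + l R)`, and the last term has mean zero by the
first-order condition. -/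
lemma IsBoundedReturn.integral_inv (h : IsBoundedReturn P X m k c) {l : ℝ} (hl : 0 ≤ l)
    (hld : l * (c - k * m) < 1) (h0 : score P X k c l = 0) :
    ∫ ω, 1 / (1 + l * (k * X ω - c)) ∂P = 1 := by
  have : ∫ ω, 1 / (1 + l * (k * X ω - c)) ∂P =
      ∫ ω, (1 - l * ((k * X ω - c) / (1 + l * (k * X ω - c)))) ∂P := by
    refine integral_congr_ae ?_
    filter_upwards [h.ae_pos hl hld] with ω p1
    field_simp
    ring
  rw [this, integral_sub (integrable_const _) ((h.integrable_score hl hld).const_mul _),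
    integral_const_mul]
  rw [score] at h0
  rw [h0]; simp

end LogOptimal

/-! ### The log-optimiser after time `1/2` -/

lemma coefA_mem {t : ℝ} (ht : t ∈ Icc (1 / 2 : ℝ) 1) : coefA t ∈ Icc (1 / 6 : ℝ) (1 / 3) := by
  unfold coefA; constructor <;> linarith [ht.1, ht.2]

lemma continuous_coefA : Continuous coefA := by unfold coefA; fun_prop

lemma oneReturn_eq (lam t e : ℝ) :
    oneReturn lam t e = (1 - lam) * coefA t * e - (lam + (1 - lam) * coefA t) := by
  unfold oneReturn; ring

/-- The admissible transaction costs. -/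
noncomputable def costBound (ε : ℝ) : ℝ := (1 - 3 * ε) / 14

section Optimiser

variable {Ω : Type*} [MeasurableSpace Ω] {P : Measure Ω} [IsProbabilityMeasure P]
  {ε lam : ℝ} {ξ η θ : Ω → ℝ} {n : ℕ} {t : ℝ}

lemma lam_lt (hε : ε ∈ Ioo (0 : ℝ) (1 / 3)) (hl : lam ∈ Ioo 0 (costBound ε)) :
    lam < 1 / 14 := by
  have := hl.2; unfold costBound at this; linarith [hε.1]

lemma coefK_ge (hε : ε ∈ Ioo (0 : ℝ) (1 / 3)) (hl : lam ∈ Ioo 0 (costBound ε))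
    (ht : t ∈ Icc (1 / 2 : ℝ) 1) : 13 / 84 ≤ (1 - lam) * coefA t := by
  have h1 := lam_lt hε hl
  have h2 := (coefA_mem ht).1
  nlinarith

lemma one_div_natCast_le_one (n : ℕ) : 1 / (n : ℝ) ≤ 1 := by
  rcases Nat.eq_zero_or_pos n with rfl | hn
  · norm_num
  · have : (1 : ℝ) ≤ n := by exact_mod_cast hn
    rw [div_le_one (by linarith)]; exact this

lemma IsModel.isBoundedReturn (hε : ε ∈ Ioo (0 : ℝ) (1 / 3)) (hl : lam ∈ Ioo 0 (costBound ε))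
    (h : IsModel P ε ξ η θ) (hn : n ≠ 0) (ht : t ∈ Icc (1 / 2 : ℝ) 1) :
    IsBoundedReturn P (fun ω => truncEta n (η ω)) (1 / (n : ℝ)) ((1 - lam) * coefA t)
      (lam + (1 - lam) * coefA t) := by
  have hn0 : (0 : ℝ) < n := by exact_mod_cast Nat.pos_of_ne_zero hn
  have hn1 := one_div_natCast_le_one n
  have hk := coefK_ge hε hl ht
  constructor
  · exact h.measurable_eta.max measurable_const
  · positivity
  · filter_upwards [h.ae_eta_mem hε] with ω hω
    exact ⟨le_max_right _ _, max_le hω.2 (by linarith)⟩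
  -- The lower end point `1/n` of the truncated variable is itself an atom of `η`; the upper end
  -- point `2` is atom number `0`.
  · have hw := h.measure_etaAtom n
    refine fun h0 => ?_
    have hz : P {ω | η ω = etaAtom n} = 0 := by
      refine measure_mono_null ?_ h0
      intro ω hω
      simp only [mem_ofPred_eq, etaAtom, hn, if_false] at hω
      simp [truncEta, hω]
    rw [hz] at hw
    exact absurd hw.symm (ENNReal.ofReal_pos.2 (etaWeight_pos hε n)).ne'
  · have hw := h.measure_etaAtom 0
    refine fun h0 => ?_
    have hz : P {ω | η ω = etaAtom 0} = 0 := by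
      refine measure_mono_null ?_ h0
      intro ω hω
      simp only [mem_ofPred_eq, etaAtom, if_true] at hω
      simp only [mem_ofPred_eq, truncEta, hω]
      exact max_eq_left (by linarith)
    rw [hz] at hw
    exact absurd hw.symm (ENNReal.ofReal_pos.2 (etaWeight_pos hε 0)).ne'
  · linarith
  · have := hl.1
    nlinarith

/-- This inequality fixes `costBound`. With `k = (1 - lam) a_t` it suffices that `lam (1 + 3 ε) < k
(1 - 3 ε)`. Here `k ≥ 13/84`, while `lam < (1 - 3 ε)/14` and `1 + 3 ε < 2` give `lam (1 + 3 ε) ≤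
(12/84) (1 - 3 ε)`. -/
lemma IsModel.mean_inv_lt (hε : ε ∈ Ioo (0 : ℝ) (1 / 3)) (hl : lam ∈ Ioo 0 (costBound ε))
    (h : IsModel P ε ξ η θ) (ht : t ∈ Icc (1 / 2 : ℝ) 1) :
    (lam + (1 - lam) * coefA t) * ∫ ω, 1 / truncEta n (η ω) ∂P < (1 - lam) * coefA t := by
  have hk := coefK_ge hε hl ht
  have h1 := h.integral_inv_truncEta_le hε n
  have h2 := hl.2
  have h0 := hl.1
  obtain ⟨e0, e1⟩ := hε
  unfold costBound at h2
  set k := (1 - lam) * coefA t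
  have h3 : (lam + k) * ∫ ω, 1 / truncEta n (η ω) ∂P ≤ (lam + k) * ((1 + 3 * ε) / 2) :=
    mul_le_mul_of_nonneg_left h1 (by linarith)
  have h4 : lam * (1 + 3 * ε) ≤ (1 - 3 * ε) / 7 := by nlinarith
  have h5 : 13 / 84 * (1 - 3 * ε) ≤ k * (1 - 3 * ε) :=
    mul_le_mul_of_nonneg_right hk (by linarith)
  nlinarith

/-- The zero of the score is a log-optimiser, so the choice defining `logOpt` is a choice from a
nonempty set; uniqueness of the maximiser identifies the chosen element with that zero. -/
lemma IsModel.logOpt_spec (hε : ε ∈ Ioo (0 : ℝ) (1 / 3)) (hl : lam ∈ Ioo 0 (costBound ε))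
    (h : IsModel P ε ξ η θ) (hn : n ≠ 0) (ht : t ∈ Icc (1 / 2 : ℝ) 1) :
    1 / (lam + (1 - lam) * coefA t) ≤ logOpt P η lam n t ∧
    logOpt P η lam n t * (lam + (1 - lam) * coefA t - (1 - lam) * coefA t * (1 / (n : ℝ))) < 1 ∧
    score P (fun ω => truncEta n (η ω)) ((1 - lam) * coefA t) (lam + (1 - lam) * coefA t)
      (logOpt P η lam n t) = 0 := by
  have hb := h.isBoundedReturn hε hl hn ht
  obtain ⟨l, l1, l2, l3⟩ := hb.exists_score_eq_zero (h.mean_inv_lt hε hl ht)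
  have hl0 : 0 ≤ l := (one_div_pos.2 hb.c_pos).le.trans l1
  have hopt : IsLogOptimal P η lam n t l := by
    refine ⟨?_, fun q hq => ?_⟩
    · simpa only [oneReturn_eq] using hb.ae_pos hl0 l2
    · simp only [oneReturn_eq] at hq ⊢
      exact (hb.log_le hl0 l2 l3 hq).1
  have hspec : IsLogOptimal P η lam n t (logOpt P η lam n t) := Classical.epsilon_spec ⟨l, hopt⟩
  have heq : logOpt P η lam n t = l := by
    obtain ⟨s1, s2⟩ := hspec
    have s3 := s2 l hopt.1
    simp only [oneReturn_eq] at s1 s3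
    exact (hb.log_le hl0 l2 l3 s1).2 s3
  rw [heq]
  exact ⟨l1, l2, l3⟩

/-- The value of `η̂ⁿ_t` as a function of the value `e` of `η`. -/
noncomputable def jumpDensity (P : Measure Ω) (η : Ω → ℝ) (lam : ℝ) (n : ℕ) (t e : ℝ) : ℝ :=
  1 / (1 + logOpt P η lam n t * oneReturn lam t (truncEta n e))

lemma IsModel.logOpt_nonneg (hε : ε ∈ Ioo (0 : ℝ) (1 / 3)) (hl : lam ∈ Ioo 0 (costBound ε))
    (h : IsModel P ε ξ η θ) (hn : n ≠ 0) (ht : t ∈ Icc (1 / 2 : ℝ) 1) :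
    0 ≤ logOpt P η lam n t :=
  (one_div_pos.2 (h.isBoundedReturn hε hl hn ht).c_pos).le.trans (h.logOpt_spec hε hl hn ht).1

lemma IsModel.jumpDensity_pos (hε : ε ∈ Ioo (0 : ℝ) (1 / 3)) (hl : lam ∈ Ioo 0 (costBound ε))
    (h : IsModel P ε ξ η θ) (hn : n ≠ 0) (ht : t ∈ Icc (1 / 2 : ℝ) 1) (e : ℝ) :
    0 < jumpDensity P η lam n t e := by
  have hb := h.isBoundedReturn hε hl hn ht
  have hs := (h.logOpt_spec hε hl hn ht).2.1
  have := hb.le_factor (h.logOpt_nonneg hε hl hn ht) (x := truncEta n e) (le_max_right _ _)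
  unfold jumpDensity
  rw [oneReturn_eq]
  exact one_div_pos.2 (by linarith)

lemma IsModel.integral_jumpDensity (hε : ε ∈ Ioo (0 : ℝ) (1 / 3))
    (hl : lam ∈ Ioo 0 (costBound ε)) (h : IsModel P ε ξ η θ) (hn : n ≠ 0)
    (ht : t ∈ Icc (1 / 2 : ℝ) 1) : ∫ ω, jumpDensity P η lam n t (η ω) ∂P = 1 := by
  have hs := h.logOpt_spec hε hl hn ht
  simp only [jumpDensity, oneReturn_eq]
  exact (h.isBoundedReturn hε hl hn ht).integral_inv (h.logOpt_nonneg hε hl hn ht) hs.2.1 hs.2.2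

lemma IsModel.integrable_jumpDensity (hε : ε ∈ Ioo (0 : ℝ) (1 / 3))
    (hl : lam ∈ Ioo 0 (costBound ε)) (h : IsModel P ε ξ η θ) (hn : n ≠ 0)
    (ht : t ∈ Icc (1 / 2 : ℝ) 1) : Integrable (fun ω => jumpDensity P η lam n t (η ω)) P := by
  -- A non-integrable function would have Bochner integral `0`, but the integral is `1`.
  by_contra hcon
  have := h.integral_jumpDensity hε hl hn ht
  rw [integral_undef hcon] at this
  norm_num at this

/-- The jump factor `η̂ⁿ_t (1 - lam) (1 + a_t (ηⁿ - 1))` as a function of the value of `η`. -/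
noncomputable def jumpPrice (P : Measure Ω) (η : Ω → ℝ) (lam : ℝ) (n : ℕ) (t e : ℝ) : ℝ :=
  jumpDensity P η lam n t e * ((1 - lam) * (1 + coefA t * (truncEta n e - 1)))

/-- With `R` the return, `(1 + R)/(1 + l R)` is the jump density plus the integrand of the score,
which has mean zero. -/
lemma IsModel.integral_jumpPrice (hε : ε ∈ Ioo (0 : ℝ) (1 / 3))
    (hl : lam ∈ Ioo 0 (costBound ε)) (h : IsModel P ε ξ η θ) (hn : n ≠ 0)
    (ht : t ∈ Icc (1 / 2 : ℝ) 1) : ∫ ω, jumpPrice P η lam n t (η ω) ∂P = 1 := by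
  have hs := h.logOpt_spec hε hl hn ht
  have hb := h.isBoundedReturn hε hl hn ht
  have hi := hb.integrable_score (h.logOpt_nonneg hε hl hn ht) hs.2.1
  have : ∀ ω, jumpPrice P η lam n t (η ω) = jumpDensity P η lam n t (η ω) +
      ((1 - lam) * coefA t * truncEta n (η ω) - (lam + (1 - lam) * coefA t)) /
      (1 + logOpt P η lam n t *
        ((1 - lam) * coefA t * truncEta n (η ω) - (lam + (1 - lam) * coefA t))) := by
    intro ω
    simp only [jumpPrice, jumpDensity, oneReturn_eq]
    ring
  simp_rw [this]
  rw [integral_add (h.integrable_jumpDensity hε hl hn ht) hi, h.integral_jumpDensity hε hl hn ht]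
  have h3 := hs.2.2
  rw [score] at h3
  rw [h3, add_zero]

lemma truncEta_nonneg (n : ℕ) (e : ℝ) : 0 ≤ truncEta n e :=
  le_max_of_le_right (by positivity)

lemma IsModel.jumpPrice_nonneg (hε : ε ∈ Ioo (0 : ℝ) (1 / 3)) (hl : lam ∈ Ioo 0 (costBound ε))
    (h : IsModel P ε ξ η θ) (hn : n ≠ 0) (ht : t ∈ Icc (1 / 2 : ℝ) 1) (e : ℝ) :
    0 ≤ jumpPrice P η lam n t e := by
  have h1 := lam_lt hε hl
  have h2 := coefA_mem ht
  have h3 := mul_nonneg (by linarith [h2.1] : 0 ≤ coefA t) (truncEta_nonneg n e)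
  refine mul_nonneg (h.jumpDensity_pos hε hl hn ht e).le (mul_nonneg (by linarith) ?_)
  nlinarith [h2.2]

lemma IsModel.integrable_jumpPrice (hε : ε ∈ Ioo (0 : ℝ) (1 / 3))
    (hl : lam ∈ Ioo 0 (costBound ε)) (h : IsModel P ε ξ η θ) (hn : n ≠ 0)
    (ht : t ∈ Icc (1 / 2 : ℝ) 1) : Integrable (fun ω => jumpPrice P η lam n t (η ω)) P := by
  by_contra hcon
  have := h.integral_jumpPrice hε hl hn ht
  rw [integral_undef hcon] at this
  norm_num at this

/-- Projection of a time to `[1/2, 1]`. -/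
noncomputable def clampTime (t : ℝ) : ℝ := max (1 / 2) (min t 1)

lemma clampTime_mem (t : ℝ) : clampTime t ∈ Icc (1 / 2 : ℝ) 1 :=
  ⟨le_max_left _ _, max_le (by norm_num) (min_le_right _ _)⟩

lemma clampTime_of_mem (ht : t ∈ Icc (1 / 2 : ℝ) 1) : clampTime t = t := by
  unfold clampTime; rw [min_eq_left ht.2, max_eq_right ht.1]

lemma measurable_clampTime : Measurable clampTime := by unfold clampTime; fun_prop

/-- The optimiser is given only by a choice at each time. For `q ≥ 0` it exceeds `q` exactly when
`q` is below the admissible bound and the score at `q` is positive, and both conditions are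
measurable in time. The clamped time makes the statement meaningful on all of `ℝ`. -/
lemma IsModel.measurable_logOpt (hε : ε ∈ Ioo (0 : ℝ) (1 / 3))
    (hl : lam ∈ Ioo 0 (costBound ε)) (h : IsModel P ε ξ η θ) (hn : n ≠ 0) :
    Measurable fun t => logOpt P η lam n (clampTime t) := by
  have hA : Measurable fun t => coefA (clampTime t) :=
    continuous_coefA.measurable.comp measurable_clampTime
  have hX : Measurable fun ω => truncEta n (η ω) := h.measurable_eta.max measurable_const
  refine measurable_of_Ioi fun q => ?_
  rcases lt_or_ge q 0 with hq | hq
  · convert MeasurableSet.univ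
    ext t
    simp only [mem_preimage, mem_Ioi, mem_univ, iff_true]
    exact hq.trans_le (h.logOpt_nonneg hε hl hn (clampTime_mem t))
  · have hscore : Measurable fun t => score P (fun ω => truncEta n (η ω))
        ((1 - lam) * coefA (clampTime t)) (lam + (1 - lam) * coefA (clampTime t)) q := by
      unfold score
      refine StronglyMeasurable.measurable ?_
      refine StronglyMeasurable.integral_prod_right' (f := fun z : ℝ × Ω =>
        ((1 - lam) * coefA (clampTime z.1) * truncEta n (η z.2) -
          (lam + (1 - lam) * coefA (clampTime z.1))) /
        (1 + q * ((1 - lam) * coefA (clampTime z.1) * truncEta n (η z.2) -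
          (lam + (1 - lam) * coefA (clampTime z.1))))) ?_
      have h1 : Measurable fun z : ℝ × Ω => coefA (clampTime z.1) := hA.comp measurable_fst
      have h2 : Measurable fun z : ℝ × Ω => truncEta n (η z.2) := hX.comp measurable_snd
      exact Measurable.stronglyMeasurable (by fun_prop)
    have hset : (fun t => logOpt P η lam n (clampTime t)) ⁻¹' Ioi q =
        {t | q * (lam + (1 - lam) * coefA (clampTime t) -
          (1 - lam) * coefA (clampTime t) * (1 / (n : ℝ))) < 1} ∩
        {t | 0 < score P (fun ω => truncEta n (η ω)) ((1 - lam) * coefA (clampTime t))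
          (lam + (1 - lam) * coefA (clampTime t)) q} := by
      ext t
      have ht := clampTime_mem t
      have hb := h.isBoundedReturn hε hl hn ht
      have hs := h.logOpt_spec hε hl hn ht
      have h0 := h.logOpt_nonneg hε hl hn ht
      simp only [mem_preimage, mem_Ioi, mem_inter_iff, mem_ofPred_eq]
      constructor
      · intro hlt
        have hd : 0 ≤ lam + (1 - lam) * coefA (clampTime t) -
          (1 - lam) * coefA (clampTime t) * (1 / (n : ℝ)) := by linarith [hb.lt_c]
        have hqd := (mul_le_mul_of_nonneg_right hlt.le hd).trans_lt hs.2.1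
        exact ⟨hqd, (hb.score_pos_iff h0 hs.2.1 hs.2.2 hq hqd).2 hlt⟩
      · rintro ⟨hqd, hpos⟩
        exact (hb.score_pos_iff h0 hs.2.1 hs.2.2 hq hqd).1 hpos
    rw [hset]
    refine MeasurableSet.inter (measurableSet_lt (by fun_prop) measurable_const)
      (measurableSet_lt measurable_const hscore)

lemma IsModel.measurable_jumpDensity (hε : ε ∈ Ioo (0 : ℝ) (1 / 3))
    (hl : lam ∈ Ioo 0 (costBound ε)) (h : IsModel P ε ξ η θ) (hn : n ≠ 0) :
    Measurable fun z : ℝ × ℝ => jumpDensity P η lam n (clampTime z.1) z.2 := by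
  have h1 : Measurable fun z : ℝ × ℝ => logOpt P η lam n (clampTime z.1) :=
    (h.measurable_logOpt hε hl hn).comp measurable_fst
  have h2 : Measurable fun z : ℝ × ℝ => coefA (clampTime z.1) :=
    (continuous_coefA.measurable.comp measurable_clampTime).comp measurable_fst
  unfold jumpDensity oneReturn truncEta
  fun_prop

lemma IsModel.measurable_jumpPrice (hε : ε ∈ Ioo (0 : ℝ) (1 / 3))
    (hl : lam ∈ Ioo 0 (costBound ε)) (h : IsModel P ε ξ η θ) (hn : n ≠ 0) :
    Measurable fun z : ℝ × ℝ => jumpPrice P η lam n (clampTime z.1) z.2 := by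
  have h1 := h.measurable_jumpDensity hε hl hn
  have h2 : Measurable fun z : ℝ × ℝ => coefA (clampTime z.1) :=
    (continuous_coefA.measurable.comp measurable_clampTime).comp measurable_fst
  unfold jumpPrice truncEta
  fun_prop

/-- Squeeze: the lower bound `1/c` does not depend on `n`, and the upper bound `1/(c - k/n)`
decreases to it. -/
lemma IsModel.tendsto_logOpt (hε : ε ∈ Ioo (0 : ℝ) (1 / 3))
    (hl : lam ∈ Ioo 0 (costBound ε)) (h : IsModel P ε ξ η θ) (ht : t ∈ Icc (1 / 2 : ℝ) 1) :
    Tendsto (fun n => logOpt P η lam n t) atTop (𝓝 (1 / (lam + (1 - lam) * coefA t))) := by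
  have hk := coefK_ge hε hl ht
  have hc : lam + (1 - lam) * coefA t ≠ 0 := by linarith [hl.1]
  have hup : Tendsto (fun n : ℕ => 1 / (lam + (1 - lam) * coefA t -
      (1 - lam) * coefA t * (1 / (n : ℝ)))) atTop (𝓝 (1 / (lam + (1 - lam) * coefA t))) := by
    have h1 : Tendsto (fun n : ℕ => lam + (1 - lam) * coefA t -
      (1 - lam) * coefA t * (1 / (n : ℝ))) atTop (𝓝 (lam + (1 - lam) * coefA t -
      (1 - lam) * coefA t * 0)) :=
      (tendsto_one_div_atTop_nhds_zero_nat.const_mul _).const_sub _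
    rw [mul_zero, sub_zero] at h1
    exact tendsto_const_nhds.div h1 hc
  refine tendsto_of_tendsto_of_tendsto_of_le_of_le' tendsto_const_nhds hup ?_ ?_
  · filter_upwards [eventually_ne_atTop 0] with n hn
    exact (h.logOpt_spec hε hl hn ht).1
  · filter_upwards [eventually_ne_atTop 0] with n hn
    have hb := h.isBoundedReturn hε hl hn ht
    rw [le_div_iff₀ (by linarith [hb.lt_c])]
    exact (h.logOpt_spec hε hl hn ht).2.1.le

/-- The limit of the jump densities. -/
lemma IsModel.tendsto_jumpDensity (hε : ε ∈ Ioo (0 : ℝ) (1 / 3))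
    (hl : lam ∈ Ioo 0 (costBound ε)) (h : IsModel P ε ξ η θ) (ht : t ∈ Icc (1 / 2 : ℝ) 1)
    {e : ℝ} (he : 0 < e) :
    Tendsto (fun n => jumpDensity P η lam n t e) atTop
      (𝓝 (1 / (1 + 1 / (lam + (1 - lam) * coefA t) * oneReturn lam t e))) := by
  have hk := coefK_ge hε hl ht
  have hc : 0 < lam + (1 - lam) * coefA t := by linarith [hl.1]
  have htr : ∀ᶠ n : ℕ in atTop, truncEta n e = e := by
    filter_upwards [tendsto_one_div_atTop_nhds_zero_nat.eventually (gt_mem_nhds he)] with n hn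
    exact max_eq_left hn.le
  have hne : 1 + 1 / (lam + (1 - lam) * coefA t) * oneReturn lam t e ≠ 0 := by
    have : 1 + 1 / (lam + (1 - lam) * coefA t) * oneReturn lam t e
      = (1 - lam) * coefA t * e / (lam + (1 - lam) * coefA t) := by
      rw [oneReturn_eq]; field_simp; ring
    rw [this]
    have : 0 < (1 - lam) * coefA t * e := mul_pos (by linarith) he
    positivity
  have h1 : Tendsto (fun n => 1 / (1 + logOpt P η lam n t * oneReturn lam t e)) atTop
      (𝓝 (1 / (1 + 1 / (lam + (1 - lam) * coefA t) * oneReturn lam t e))) :=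
    tendsto_const_nhds.div (((h.tendsto_logOpt hε hl ht).mul_const _).const_add _) hne
  refine h1.congr' ?_
  filter_upwards [htr] with n hn
  rw [jumpDensity, hn]

end Optimiser

/-! ### Atoms of the market filtration -/

/-- The events that are, up to null sets, either disjoint from `D` or contain `D`. -/
@[reducible]
def atomSigma {Ω : Type*} [MeasurableSpace Ω] (P : Measure Ω) (D : Set Ω) : MeasurableSpace Ω where
  MeasurableSet' A := P (D ∩ A) = 0 ∨ P (D \ A) = 0
  measurableSet_empty := by simp
  measurableSet_compl A hA := by
    rcases hA with hA | hA
    · right; simpa [sdiff_eq] using hA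
    · left; simpa [sdiff_eq] using hA
  measurableSet_iUnion A hA := by
    by_cases hex : ∃ i, P (D \ A i) = 0
    · obtain ⟨i, hi⟩ := hex
      exact Or.inr (measure_mono_null (sdiff_subset_sdiff_right (subset_iUnion A i)) hi)
    · push Not at hex
      left
      rw [inter_iUnion]
      exact measure_iUnion_null fun i => (hA i).resolve_right (hex i)

section Filtration

variable {Ω : Type*} [m : MeasurableSpace Ω] {P : Measure Ω} {ε : ℝ} {ξ η θ : Ω → ℝ}

/-- Observing something that is almost surely constant on `D` does not split `D`. -/
lemma comap_le_atomSigma {β : Type*} [MeasurableSpace β] {D : Set Ω} {f : Ω → β} {c : β}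
    (hf : ∀ᵐ ω ∂P, ω ∈ D → f ω = c) : MeasurableSpace.comap f inferInstance ≤ atomSigma P D := by
  rintro _ ⟨B, _, rfl⟩
  have hnull := ae_iff.1 hf
  by_cases hc : c ∈ B
  · refine Or.inr (measure_mono_null ?_ hnull)
    rintro ω ⟨hD, hB⟩ himp
    exact hB (by rw [mem_preimage, himp hD]; exact hc)
  · refine Or.inl (measure_mono_null ?_ hnull)
    rintro ω ⟨hD, hB⟩ himp
    rw [mem_preimage, himp hD] at hB
    exact hc hB

lemma nullSigma_le_atomSigma (D : Set Ω) : nullSigma P ≤ atomSigma P D :=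
  MeasurableSpace.generateFrom_le fun _ hA => Or.inl (measure_mono_null inter_subset_right hA)

variable [P.IsComplete]

/-- The market filtration before it is made right continuous. -/
noncomputable def rawFiltration (h : IsModel P ε ξ η θ) : Filtration unitInterval m :=
  Filtration.natural (observed ξ η θ) (fun t =>
      (measurable_observed h.measurable_xi h.measurable_eta h.measurable_theta
        t).stronglyMeasurable) ⊔
    Filtration.const unitInterval (nullSigma P) (nullSigma_le P)

lemma marketFiltration_eq (h : IsModel P ε ξ η θ) :
    marketFiltration P h = (rawFiltration h).rightCont := rfl

lemma rawFiltration_le_atomSigma (h : IsModel P ε ξ η θ) {u : unitInterval} {D : Set Ω}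
    (hD : ∀ j ≤ u, ∃ c, ∀ᵐ ω ∂P, ω ∈ D → observed ξ η θ j ω = c) :
    rawFiltration h u ≤ atomSigma P D := by
  refine sup_le (iSup₂_le fun j hj => ?_) (nullSigma_le_atomSigma D)
  obtain ⟨c, hc⟩ := hD j hj
  exact comap_le_atomSigma hc

lemma measurable_observed_raw (h : IsModel P ε ξ η θ) {j u : unitInterval} (hj : j ≤ u) :
    Measurable[rawFiltration h u] (observed ξ η θ j) := by
  rw [measurable_iff_comap_le]
  exact le_sup_of_le_left (le_iSup₂_of_le j hj le_rfl)

lemma measurable_observed_market (h : IsModel P ε ξ η θ) {j u : unitInterval} (hj : j ≤ u) :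
    Measurable[marketFiltration P h u] (observed ξ η θ j) :=
  (measurable_observed_raw h hj).mono ((rawFiltration h).le_rightCont u) le_rfl

lemma measurableSet_market_of_null (h : IsModel P ε ξ η θ) (u : unitInterval) {A : Set Ω}
    (hA : P A = 0) : MeasurableSet[marketFiltration P h u] A := by
  have : nullSigma P ≤ marketFiltration P h u :=
    le_trans (le_sup_right (a := (Filtration.natural (observed ξ η θ) _ : Filtration _ _) u))
      ((rawFiltration h).le_rightCont u)
  exact this _ (MeasurableSpace.measurableSet_generateFrom hA)

lemma measurable_market_of_ae_eq (h : IsModel P ε ξ η θ) (u : unitInterval) {f g : Ω → ℝ}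
    (hg : Measurable[marketFiltration P h u] g) (hfg : ∀ᵐ ω ∂P, f ω = g ω) :
    Measurable[marketFiltration P h u] f := by
  intro B hB
  have hN : P {ω | ¬ f ω = g ω} = 0 := ae_iff.1 hfg
  have : f ⁻¹' B = (g ⁻¹' B \ {ω | ¬ f ω = g ω}) ∪ (f ⁻¹' B ∩ {ω | ¬ f ω = g ω}) := by
    ext ω
    by_cases hω : f ω = g ω
    · simp [hω]
    · simp [hω]
  rw [this]
  exact MeasurableSet.union ((hg hB).diff (measurableSet_market_of_null h u hN))
    (measurableSet_market_of_null h u (measure_mono_null inter_subset_right hN))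

/-- Before time `1/2` the market filtration is trivial. -/
lemma market_trivial [IsProbabilityMeasure P] (h : IsModel P ε ξ η θ) {s : unitInterval}
    (hs : (s : ℝ) < 1 / 2) {A : Set Ω} (hA : MeasurableSet[marketFiltration P h s] A) :
    P A = 0 ∨ P Aᶜ = 0 := by
  -- The right-continuous filtration looks slightly beyond `s`; `u` is chosen so that it still
  -- precedes the first jump.
  obtain ⟨u, hu1, hu2⟩ : ∃ u : unitInterval, s < u ∧ (u : ℝ) < 1 / 2 := by
    obtain ⟨r, hr1, hr2⟩ := exists_between hs
    exact ⟨⟨r, s.2.1.trans hr1.le, by linarith⟩, hr1, hr2⟩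
  rw [marketFiltration_eq, Filtration.rightCont_eq_of_not_isMax _
    (not_isMax_iff.2 ⟨u, hu1⟩)] at hA
  have hinf : (⨅ j > s, rawFiltration h j) ≤ rawFiltration h u := iInf₂_le u hu1
  have hA' : MeasurableSet[rawFiltration h u] A := hinf _ hA
  have hle : rawFiltration h u ≤ atomSigma P univ := by
    refine rawFiltration_le_atomSigma h fun j hj => ⟨(1, 0), ?_⟩
    have hj2 : (j : ℝ) < 1 / 2 := lt_of_le_of_lt hj hu2
    filter_upwards [h.ae_half_lt_jumpTime] with ω hω _
    have h1 : ¬ (jumpTime (θ ω) ≤ j) := by linarith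
    have h2 : ¬ ((1 : ℝ) / 2 ≤ j) := by linarith
    simp only [observed, askProcess, ask, h1, h2, if_false]
    norm_num
  have := hle _ hA'
  rcases this with h1 | h1
  · left; simpa using h1
  · right; simpa [compl_eq_univ_sdiff] using h1

/-- The event that there has been no second jump and `ξ = v` is an atom. -/
lemma market_atom (h : IsModel P ε ξ η θ) {s : unitInterval} (v : ℝ)
    {A : Set Ω} (hA : MeasurableSet[marketFiltration P h s] A) :
    P ({ω | (s : ℝ) < jumpTime (θ ω) ∧ ξ ω = v} ∩ A) = 0 ∨
      P ({ω | (s : ℝ) < jumpTime (θ ω) ∧ ξ ω = v} \ A) = 0 := by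
  have hraw : ∀ u : unitInterval, s < u →
      rawFiltration h u ≤ atomSigma P {ω | (u : ℝ) < jumpTime (θ ω) ∧ ξ ω = v} := by
    intro u hu
    refine rawFiltration_le_atomSigma h fun j hj =>
      ⟨((1 + (v - 1) * (if (1 : ℝ) / 2 ≤ j then 1 else 0)), 0), ?_⟩
    have hju : (j : ℝ) ≤ u := hj
    filter_upwards with ω hω
    obtain ⟨h1, h2⟩ := hω
    have h3 : ¬ (jumpTime (θ ω) ≤ j) := by linarith
    simp only [observed, askProcess, ask, h3, h2, if_false]
    norm_num
  by_cases hs1 : s < 1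
  · rw [marketFiltration_eq, Filtration.rightCont_eq_of_not_isMax _
      (not_isMax_iff.2 ⟨1, hs1⟩)] at hA
    have hinf : ∀ u, s < u → (⨅ j > s, rawFiltration h j) ≤ rawFiltration h u :=
      fun u hu => iInf₂_le u hu
    have hA' : ∀ u, s < u → P ({ω | (u : ℝ) < jumpTime (θ ω) ∧ ξ ω = v} ∩ A) = 0 ∨
        P ({ω | (u : ℝ) < jumpTime (θ ω) ∧ ξ ω = v} \ A) = 0 := fun u hu =>
      hraw u hu _ (hinf u hu _ hA)
    obtain ⟨u, hu1, hu2, hu3⟩ := exists_seq_strictAnti_tendsto' hs1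
    have hu3' : Tendsto (fun k => (u k : ℝ)) atTop (𝓝 (s : ℝ)) :=
      (continuous_subtype_val.tendsto s).comp hu3
    -- The raw filtration at a time `u > s` only yields the atom `{u < σ, ξ = v}`. Letting `u`
    -- decrease to `s`, these sets increase to the desired one. If `A` charges one of them, it
    -- almost surely contains all later ones, hence their union.
    set D : ℕ → Set Ω := fun k => {ω | (u k : ℝ) < jumpTime (θ ω) ∧ ξ ω = v} with hD
    have hmono : Monotone D := by
      intro j k hjk ω hω
      exact ⟨lt_of_le_of_lt (hu1.antitone hjk : (u k : ℝ) ≤ u j) hω.1, hω.2⟩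
    have hU : {ω | (s : ℝ) < jumpTime (θ ω) ∧ ξ ω = v} = ⋃ k, D k := by
      ext ω
      simp only [mem_ofPred_eq, mem_iUnion, hD]
      constructor
      · rintro ⟨h1, h2⟩
        obtain ⟨k, hk⟩ := (hu3'.eventually (gt_mem_nhds h1)).exists
        exact ⟨k, hk, h2⟩
      · rintro ⟨k, h1, h2⟩
        exact ⟨lt_trans ((hu2 k).1 : (s : ℝ) < u k) h1, h2⟩
    rw [hU]
    by_cases hall : ∀ k, P (D k ∩ A) = 0
    · left
      rw [iUnion_inter]
      exact measure_iUnion_null hall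
    · push Not at hall
      obtain ⟨k₀, hk₀⟩ := hall
      right
      rw [iUnion_sdiff]
      refine measure_iUnion_null fun k => ?_
      have h1 : P (D (max k k₀) ∩ A) ≠ 0 := fun hz =>
        hk₀ (measure_mono_null (inter_subset_inter_left _ (hmono (le_max_right _ _))) hz)
      have h2 := (hA' (u (max k k₀)) (hu2 _).1).resolve_left h1
      exact measure_mono_null (sdiff_subset_sdiff_left (hmono (le_max_left _ _))) h2
  · left
    have hs2 : (1 : ℝ) ≤ s := by
      have : (1 : unitInterval) ≤ s := not_lt.1 hs1
      exact this
    have : {ω | (s : ℝ) < jumpTime (θ ω) ∧ ξ ω = v} = ∅ := by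
      ext ω
      simp only [mem_ofPred_eq, mem_empty_iff_false, iff_false, not_and]
      intro h1
      linarith [jumpTime_le_one (θ ω)]
    rw [this, empty_inter, measure_empty]

variable [IsProbabilityMeasure P]

/-- For `r < t` the event `{σ ≤ r}` is read off the observed indicator at time `r`; this is why the
indicator belongs to the filtration. -/
lemma measurable_min_jumpTime (h : IsModel P ε ξ η θ) (t : unitInterval) :
    Measurable[marketFiltration P h t] fun ω => min (jumpTime (θ ω)) t := by
  refine measurable_of_Iic fun r => ?_
  by_cases hr : (t : ℝ) ≤ r
  · convert MeasurableSet.univ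
    ext ω
    simp [hr]
  · have hrt : r < t := not_le.1 hr
    have heq : (fun ω => min (jumpTime (θ ω)) (t : ℝ)) ⁻¹' Iic r = {ω | jumpTime (θ ω) ≤ r} := by
      ext ω
      simp [hr]
    rw [heq]
    by_cases hr0 : r < 0
    · refine measurableSet_market_of_null h t (measure_mono_null ?_ (ae_iff.1 h.ae_half_lt_jumpTime))
      intro ω hω
      simp only [mem_ofPred_eq] at hω ⊢
      linarith
    · have hmem : r ∈ unitInterval := ⟨not_lt.1 hr0, hrt.le.trans t.2.2⟩
      have hobs := measurable_observed_market h (j := ⟨r, hmem⟩) (u := t) hrt.le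
      have : {ω | jumpTime (θ ω) ≤ r} = observed ξ η θ ⟨r, hmem⟩ ⁻¹' {z | z.2 = 1} := by
        ext ω
        simp [observed]
      rw [this]
      exact hobs (measurable_snd (measurableSet_singleton (1 : ℝ)))

end Filtration

/-! ### Martingales with jumps at times `1/2` and `σ` only -/

/-- The path of a process which is equal to `c₀` before time `1/2`, to `K x t` from then on
and before time `s`, and to `J x e s` from time `s` on. -/
noncomputable def jumpPath (c₀ : ℝ) (K : ℝ → ℝ → ℝ) (J : ℝ → ℝ → ℝ → ℝ) (x e s t : ℝ) : ℝ :=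
  if t < 1 / 2 then c₀ else if t < s then K x t else J x e s

section Path

variable {c₀ : ℝ} {K : ℝ → ℝ → ℝ} {J : ℝ → ℝ → ℝ → ℝ} {x e s t : ℝ}

lemma jumpPath_early (ht : t < 1 / 2) : jumpPath c₀ K J x e s t = c₀ := if_pos ht

lemma jumpPath_mid (h1 : 1 / 2 ≤ t) (h2 : t < s) : jumpPath c₀ K J x e s t = K x t := by
  rw [jumpPath, if_neg (not_lt.2 h1), if_pos h2]

lemma jumpPath_late (h1 : 1 / 2 ≤ t) (h2 : s ≤ t) : jumpPath c₀ K J x e s t = J x e s := by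
  rw [jumpPath, if_neg (not_lt.2 h1), if_neg (not_lt.2 h2)]

end Path

lemma isCadlagPath_jumpPath {c₀ : ℝ} {K : ℝ → ℝ → ℝ} {J : ℝ → ℝ → ℝ → ℝ} {x e s : ℝ}
    (hK : Continuous (K x)) (hs : 1 / 2 < s) :
    IsCadlagPath fun t => jumpPath c₀ K J x e s t := by
  have hc : ∀ {t : unitInterval} {l : Filter unitInterval}, l ≤ 𝓝 t →
      Tendsto (fun u : unitInterval => K x u) l (𝓝 (K x t)) := fun {t l} hl =>
    ((hK.comp continuous_subtype_val).tendsto t).mono_left hl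
  have hval : Continuous (fun u : unitInterval => (u : ℝ)) := continuous_subtype_val
  intro t
  constructor
  · rcases lt_or_ge (t : ℝ) (1 / 2) with h1 | h1
    · have hev : ∀ᶠ u : unitInterval in 𝓝[≥] t, jumpPath c₀ K J x e s u = c₀ := by
        filter_upwards [nhdsWithin_le_nhds (hval.tendsto t (gt_mem_nhds h1))] with u hu
        simp only [mem_preimage, mem_ofPred_eq] at hu
        exact jumpPath_early hu
      have ht : jumpPath c₀ K J x e s t = c₀ := jumpPath_early h1
      have := (tendsto_const_nhds (x := c₀) (f := 𝓝[≥] t)).congr' (hev.mono fun u hu => hu.symm)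
      simpa only [ContinuousWithinAt, ht] using this
    · rcases lt_or_ge (t : ℝ) s with h2 | h2
      · have hev : ∀ᶠ u : unitInterval in 𝓝[≥] t, jumpPath c₀ K J x e s u = K x u := by
          filter_upwards [nhdsWithin_le_nhds (hval.tendsto t (gt_mem_nhds h2)),
            self_mem_nhdsWithin] with u hu hu2
          simp only [mem_preimage, mem_ofPred_eq] at hu
          have : (t : ℝ) ≤ u := hu2
          exact jumpPath_mid (h1.trans this) hu
        have ht : jumpPath c₀ K J x e s t = K x t := jumpPath_mid h1 h2
        have := (hc (t := t) (l := 𝓝[≥] t) nhdsWithin_le_nhds).congr'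
          (hev.mono fun u hu => hu.symm)
        simpa only [ContinuousWithinAt, ht] using this
      · have hev : ∀ᶠ u : unitInterval in 𝓝[≥] t, jumpPath c₀ K J x e s u = J x e s := by
          filter_upwards [self_mem_nhdsWithin] with u hu2
          have : (t : ℝ) ≤ u := hu2
          exact jumpPath_late (h1.trans this) (h2.trans this)
        have ht : jumpPath c₀ K J x e s t = J x e s := jumpPath_late h1 h2
        have := (tendsto_const_nhds (x := J x e s) (f := 𝓝[≥] t)).congr'
          (hev.mono fun u hu => hu.symm)
        simpa only [ContinuousWithinAt, ht] using this
  · rcases le_or_gt (t : ℝ) (1 / 2) with h1 | h1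
    · refine ⟨c₀, tendsto_const_nhds.congr' ?_⟩
      filter_upwards [self_mem_nhdsWithin] with u hu
      have : (u : ℝ) < t := hu
      exact (jumpPath_early (this.trans_le h1)).symm
    · rcases le_or_gt (t : ℝ) s with h2 | h2
      · refine ⟨K x t, (hc nhdsWithin_le_nhds).congr' ?_⟩
        filter_upwards [nhdsWithin_le_nhds (hval.tendsto t (lt_mem_nhds h1)),
            self_mem_nhdsWithin] with u hu hu2
        simp only [mem_preimage, mem_ofPred_eq] at hu
        have : (u : ℝ) < t := hu2
        exact (jumpPath_mid hu.le (this.trans_le h2)).symm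
      · refine ⟨J x e s, tendsto_const_nhds.congr' ?_⟩
        filter_upwards [nhdsWithin_le_nhds (hval.tendsto t (lt_mem_nhds h2))] with u hu
        simp only [mem_preimage, mem_ofPred_eq] at hu
        exact (jumpPath_late (hs.trans hu).le hu.le).symm

/-- The argument of `J` recovers `η` after the jump by inverting `S_t / S_{1/2} = 1 + a_σ (η - 1)`;
`x` and `y` stand for the prices at times `1/2` and `t`, and `i` for the indicator of `{σ ≤ t}`. -/
lemma measurable_ite_jump {Ω : Type*} [MeasurableSpace Ω] {K : ℝ → ℝ → ℝ} {J : ℝ → ℝ → ℝ → ℝ}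
    (hK : Measurable fun z : ℝ × ℝ => K z.1 z.2)
    (hJ : Measurable fun z : ℝ × ℝ × ℝ => J z.1 z.2.1 z.2.2) {x y : Ω → ℝ} {s i : Ω → ℝ}
    (hx : Measurable x) (hy : Measurable y) (hs : Measurable s) (hi : Measurable i) (t : ℝ) :
    Measurable fun ω => if i ω = 1 then
      J (x ω) (1 + (y ω / x ω - 1) / coefA (s ω)) (s ω) else K (x ω) t := by
  have hA := continuous_coefA.measurable.comp hs
  refine Measurable.ite (hi (measurableSet_singleton 1)) ?_ ?_
  · exact hJ.comp (hx.prodMk ((measurable_const.add (((hy.div hx).sub_const 1).div hA)).prodMk hs))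
  · exact hK.comp (hx.prodMk measurable_const)

section Martingale

variable {Ω : Type*} [MeasurableSpace Ω] {P : Measure Ω} [P.IsComplete] [IsProbabilityMeasure P]
  {ε : ℝ} {ξ η θ : Ω → ℝ} {c₀ : ℝ} {K : ℝ → ℝ → ℝ} {J : ℝ → ℝ → ℝ → ℝ}
  {X : unitInterval → Ω → ℝ}

lemma IsModel.measurable_jumpPath (h : IsModel P ε ξ η θ)
    (hX : ∀ᵐ ω ∂P, ∀ t : unitInterval, X t ω = jumpPath c₀ K J (ξ ω) (η ω) (jumpTime (θ ω)) t)
    (hK : Measurable fun z : ℝ × ℝ => K z.1 z.2)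
    (hJ : Measurable fun z : ℝ × ℝ × ℝ => J z.1 z.2.1 z.2.2) (t : unitInterval) :
    Measurable[marketFiltration P h t] (X t) := by
  rcases lt_or_ge (t : ℝ) (1 / 2) with ht | ht
  · refine measurable_market_of_ae_eq h t (measurable_const (a := c₀)) ?_
    filter_upwards [hX] with ω hω
    rw [hω t, jumpPath, if_pos ht]
  · have hhalf : halfTime ≤ t := ht
    have m1 : Measurable[marketFiltration P h t] fun ω => (observed ξ η θ halfTime ω).1 :=
      measurable_fst.comp (measurable_observed_market h hhalf)
    have m2 : Measurable[marketFiltration P h t] fun ω => (observed ξ η θ t ω).1 :=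
      measurable_fst.comp (measurable_observed_market h le_rfl)
    have m3 : Measurable[marketFiltration P h t] fun ω => (observed ξ η θ t ω).2 :=
      measurable_snd.comp (measurable_observed_market h le_rfl)
    refine measurable_market_of_ae_eq h t
      (@measurable_ite_jump Ω (marketFiltration P h t) K J hK hJ _ _ _ _ m1 m2
        (measurable_min_jumpTime h t) m3 t) ?_
    filter_upwards [hX, h.ae_half_lt_jumpTime, h.ae_xi] with ω hω hs hx
    have hx0 : ξ ω ≠ 0 := by rcases hx with hx | hx <;> rw [hx] <;> norm_num
    have hhv : ((halfTime : unitInterval) : ℝ) = 1 / 2 := rfl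
    have h1 : (observed ξ η θ halfTime ω).1 = ξ ω := by
      simp only [observed, askProcess, ask, hhv, le_refl, if_true, not_le.2 hs, if_false]
      ring
    rw [hω t, jumpPath, if_neg (not_lt.2 ht), h1]
    rcases lt_or_ge (t : ℝ) (jumpTime (θ ω)) with hts | hts
    · have h2 : (observed ξ η θ t ω).2 = 0 := by simp [observed, not_le.2 hts]
      rw [h2, if_pos hts]
      simp
    · have h2 : (observed ξ η θ t ω).2 = 1 := by simp [observed, hts]
      have h3 : (observed ξ η θ t ω).1 = ξ ω * (1 + coefA (jumpTime (θ ω)) * (η ω - 1)) := by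
        simp only [observed, askProcess, ask, ht, hts, if_true]; ring
      have hA := (coefA_mem ⟨hs.le, jumpTime_le_one (θ ω)⟩).1
      have hA0 : coefA (jumpTime (θ ω)) ≠ 0 := by linarith
      rw [h2, if_neg (not_lt.2 hts), if_pos rfl, min_eq_left hts, h3]
      congr 1
      field_simp
      ring

lemma measurableSet_lt_jumpTime (h : IsModel P ε ξ η θ) (s : ℝ) :
    MeasurableSet {ω | s < jumpTime (θ ω)} :=
  measurableSet_lt measurable_const (measurable_jumpTime.comp h.measurable_theta)

lemma measurableSet_lt_jumpTime_and (h : IsModel P ε ξ η θ) (s v : ℝ) :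
    MeasurableSet {ω | s < jumpTime (θ ω) ∧ ξ ω = v} :=
  (measurableSet_lt_jumpTime h s).inter (h.measurable_xi (measurableSet_singleton v))

/-- Independence of `ξ` from `(η, θ)` lets the event `{ξ = v}` factor out. -/
lemma IsModel.setIntegral_atom (h : IsModel P ε ξ η θ) {F : ℝ × ℝ → ℝ} (hF : Measurable F)
    (s v : ℝ) : ∫ ω in {ω | s < jumpTime (θ ω) ∧ ξ ω = v}, F (η ω, θ ω) ∂P =
      P.real {ω | ξ ω = v} * ∫ ω in {ω | s < jumpTime (θ ω)}, F (η ω, θ ω) ∂P := by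
  have hv : MeasurableSet {ω | ξ ω = v} := h.measurable_xi (measurableSet_singleton v)
  have hB : MeasurableSet {z : ℝ × ℝ | s < jumpTime z.2} :=
    measurableSet_lt measurable_const (measurable_jumpTime.comp measurable_snd)
  have key := h.indep_xi.integral_fun_comp_mul_comp
    (f := ({v} : Set ℝ).indicator (fun _ => (1 : ℝ)))
    (g := {z : ℝ × ℝ | s < jumpTime z.2}.indicator F)
    h.measurable_xi.aemeasurable (h.measurable_eta.prodMk h.measurable_theta).aemeasurable
    ((measurable_const.indicator (measurableSet_singleton v)).aestronglyMeasurable)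
    ((hF.indicator hB).aestronglyMeasurable)
  have e1 : ∀ ω, ({v} : Set ℝ).indicator (fun _ => (1 : ℝ)) (ξ ω) *
      {z : ℝ × ℝ | s < jumpTime z.2}.indicator F (η ω, θ ω) =
      {ω | s < jumpTime (θ ω) ∧ ξ ω = v}.indicator (fun ω => F (η ω, θ ω)) ω := by
    intro ω
    by_cases h1 : ξ ω = v <;> by_cases h2 : s < jumpTime (θ ω) <;> simp [h1, h2, indicator]
  have e2 : ∀ ω, ({v} : Set ℝ).indicator (fun _ => (1 : ℝ)) (ξ ω) =
      {ω | ξ ω = v}.indicator (fun _ => (1 : ℝ)) ω := fun ω => rfl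
  have e3 : ∀ ω, {z : ℝ × ℝ | s < jumpTime z.2}.indicator F (η ω, θ ω) =
      {ω | s < jumpTime (θ ω)}.indicator (fun ω => F (η ω, θ ω)) ω := fun ω => rfl
  simp_rw [e1, e2, e3] at key
  rw [integral_indicator (measurableSet_lt_jumpTime_and h s v),
    integral_indicator (measurableSet_lt_jumpTime h s),
    integral_indicator_const _ hv, smul_eq_mul, mul_one] at key
  exact key

/-- The conditions under which `jumpPath` is the path of a martingale. -/
structure IsMartingaleData (P : Measure Ω) (η θ : Ω → ℝ) (c₀ : ℝ) (K : ℝ → ℝ → ℝ)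
    (J : ℝ → ℝ → ℝ → ℝ) : Prop where
  measurable_K : Measurable fun z : ℝ × ℝ => K z.1 z.2
  measurable_J : Measurable fun z : ℝ × ℝ × ℝ => J z.1 z.2.1 z.2.2
  continuous : ∀ v, v = 3 ∨ v = 1 / 2 → Continuous (K v)
  integrable : ∀ v, v = 3 ∨ v = 1 / 2 → Integrable (fun ω => J v (η ω) (jumpTime (θ ω))) P
  integral : ∀ v, v = 3 ∨ v = 1 / 2 → ∀ s : ℝ, 1 / 2 ≤ s → s < 1 →
    ∫ ω in {ω | s < jumpTime (θ ω)}, J v (η ω) (jumpTime (θ ω)) ∂P =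
      Real.exp (-(s - 1 / 2)) * K v s
  mean : 5 / 6 * K 3 (1 / 2) + 1 / 6 * K (1 / 2) (1 / 2) = c₀

lemma IsMartingaleData.integrable_xi (h : IsModel P ε ξ η θ) (hd : IsMartingaleData P η θ c₀ K J) :
    Integrable (fun ω => J (ξ ω) (η ω) (jumpTime (θ ω))) P := by
  have m3 : MeasurableSet {ω | ξ ω = 3} := h.measurable_xi (measurableSet_singleton _)
  have m2 : MeasurableSet {ω | ξ ω = 1 / 2} := h.measurable_xi (measurableSet_singleton _)
  have i := ((hd.integrable 3 (Or.inl rfl)).indicator m3).add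
    ((hd.integrable (1 / 2) (Or.inr rfl)).indicator m2)
  refine i.congr ?_
  filter_upwards [h.ae_xi] with ω hω
  rcases hω with hω | hω <;> simp only [Pi.add_apply, indicator, mem_ofPred_eq, hω] <;> norm_num

lemma IsMartingaleData.setIntegral_atom_eq_zero (h : IsModel P ε ξ η θ)
    (hd : IsMartingaleData P η θ c₀ K J) {v s : ℝ} (hv : v = 3 ∨ v = 1 / 2) (hs : 1 / 2 ≤ s)
    (hs1 : s < 1) :
    ∫ ω in {ω | s < jumpTime (θ ω) ∧ ξ ω = v},
      (J v (η ω) (jumpTime (θ ω)) - K v s) ∂P = 0 := by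
  have hF : Measurable fun z : ℝ × ℝ => J v z.1 (jumpTime z.2) - K v s :=
    (hd.measurable_J.comp (measurable_const.prodMk
      (measurable_fst.prodMk (measurable_jumpTime.comp measurable_snd)))).sub_const _
  rw [h.setIntegral_atom hF s v, integral_sub (hd.integrable v hv).integrableOn
    (integrable_const _), hd.integral v hv s hs hs1, setIntegral_const,
    h.measure_lt_jumpTime hs hs1, smul_eq_mul, sub_self, mul_zero]

/-- An event of the filtration at time `s` either misses the atom `{s < σ, ξ = v}` or contains it up
to a null set. In the second case the integral is the one over the whole atom, which vanishes by the
criterion. -/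
lemma IsMartingaleData.setIntegral_eq (h : IsModel P ε ξ η θ)
    (hd : IsMartingaleData P η θ c₀ K J) {s : unitInterval} {A : Set Ω}
    (hA : MeasurableSet[marketFiltration P h s] A) (hs : (1 : ℝ) / 2 ≤ s) {v : ℝ}
    (hv : v = 3 ∨ v = 1 / 2) :
    ∫ ω in A, {ω | (s : ℝ) < jumpTime (θ ω) ∧ ξ ω = v}.indicator
      (fun ω => J v (η ω) (jumpTime (θ ω)) - K v s) ω ∂P = 0 := by
  have hD := measurableSet_lt_jumpTime_and h s v
  rw [setIntegral_indicator hD, inter_comm]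
  rcases market_atom h v hA with h0 | h0
  · exact setIntegral_measure_zero _ h0
  · rcases lt_or_ge (s : ℝ) 1 with hs1 | hs1
    · have hae : ({ω | (s : ℝ) < jumpTime (θ ω) ∧ ξ ω = v} ∩ A : Set Ω) =ᵐ[P]
          {ω | (s : ℝ) < jumpTime (θ ω) ∧ ξ ω = v} := by
        refine inter_eventuallyEq_left.2 ?_
        exact ae_le_set.2 h0
      rw [setIntegral_congr_set hae]
      exact hd.setIntegral_atom_eq_zero h hv hs hs1
    · have : {ω | (s : ℝ) < jumpTime (θ ω) ∧ ξ ω = v} = ∅ := by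
        ext ω
        simp only [mem_ofPred_eq, mem_empty_iff_false, iff_false, not_and]
        intro h1
        linarith [jumpTime_le_one (θ ω)]
      rw [this, empty_inter, Measure.restrict_empty, integral_zero_measure]

lemma IsMartingaleData.integrable_jumpPath (h : IsModel P ε ξ η θ)
    (hd : IsMartingaleData P η θ c₀ K J)
    (hX : ∀ᵐ ω ∂P, ∀ t : unitInterval, X t ω = jumpPath c₀ K J (ξ ω) (η ω) (jumpTime (θ ω)) t)
    (t : unitInterval) : Integrable (X t) P := by
  rcases lt_or_ge (t : ℝ) (1 / 2) with ht | ht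
  · refine (integrable_const c₀).congr ?_
    filter_upwards [hX] with ω hω
    rw [hω t, jumpPath, if_pos ht]
  · have hm := (h.measurable_jumpPath hX hd.measurable_K hd.measurable_J t).mono
      ((marketFiltration P h).le t) le_rfl
    refine ((hd.integrable_xi h).norm.add (integrable_const (|K 3 t| + |K (1 / 2) t|))).mono'
      hm.aestronglyMeasurable ?_
    filter_upwards [hX, h.ae_xi] with ω hω hx
    rw [hω t, jumpPath, if_neg (not_lt.2 ht)]
    simp only [Pi.add_apply]
    have p1 := abs_nonneg (K 3 t)
    have p2 := abs_nonneg (K (1 / 2) t)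
    have p3 := norm_nonneg (J (ξ ω) (η ω) (jumpTime (θ ω)))
    split_ifs
    · rcases hx with hx | hx <;> rw [hx] at p3 ⊢ <;> rw [Real.norm_eq_abs (K _ _)] <;> linarith
    · linarith

/-- It suffices to show that `X s` and the terminal value `X 1` have the same integral over every
event known at time `s`; the tower property then yields all pairs of times. After `1/2` the two
differ only on the two atoms with no jump yet. Before `1/2` the filtration is trivial and only the
overall mean matters. -/
theorem IsMartingaleData.isCadlagMartingale (h : IsModel P ε ξ η θ)
    (hd : IsMartingaleData P η θ c₀ K J)
    (hX : ∀ᵐ ω ∂P, ∀ t : unitInterval, X t ω = jumpPath c₀ K J (ξ ω) (η ω) (jumpTime (θ ω)) t) :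
    IsCadlagMartingale X (marketFiltration P h) P := by
  have hInt := hd.integrable_jumpPath h hX
  have hone : ∀ᵐ ω ∂P, X 1 ω = J (ξ ω) (η ω) (jumpTime (θ ω)) := by
    filter_upwards [hX] with ω hω
    rw [hω 1, jumpPath, if_neg (by norm_num), if_neg]
    simpa using jumpTime_le_one (θ ω)
  have hadapted : ∀ t, Measurable[marketFiltration P h t] (X t) :=
    h.measurable_jumpPath hX hd.measurable_K hd.measurable_J
  -- after time `1/2`
  have hlate : ∀ s : unitInterval, (1 : ℝ) / 2 ≤ s → ∀ A, MeasurableSet[marketFiltration P h s] A →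
      ∫ ω in A, X s ω ∂P = ∫ ω in A, X 1 ω ∂P := by
    intro s hs A hA
    have hdiff : ∀ᵐ ω ∂P, X 1 ω - X s ω =
        {ω | (s : ℝ) < jumpTime (θ ω) ∧ ξ ω = 3}.indicator
          (fun ω => J 3 (η ω) (jumpTime (θ ω)) - K 3 s) ω +
        {ω | (s : ℝ) < jumpTime (θ ω) ∧ ξ ω = 1 / 2}.indicator
          (fun ω => J (1 / 2) (η ω) (jumpTime (θ ω)) - K (1 / 2) s) ω := by
      filter_upwards [hX, hone, h.ae_xi] with ω hω h1 hx
      rw [h1, hω s, jumpPath, if_neg (not_lt.2 hs)]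
      by_cases hsj : (s : ℝ) < jumpTime (θ ω)
      · rcases hx with hx | hx <;> simp only [indicator, mem_ofPred_eq, hsj, hx] <;> norm_num
      · simp [indicator, hsj]
    have hi : ∀ v, v = 3 ∨ v = 1 / 2 → Integrable ({ω | (s : ℝ) < jumpTime (θ ω) ∧ ξ ω = v}.indicator
          (fun ω => J v (η ω) (jumpTime (θ ω)) - K v s)) P := fun v hv =>
      ((hd.integrable v hv).sub (integrable_const _)).indicator (measurableSet_lt_jumpTime_and h s v)
    have hz : ∫ ω in A, (X 1 ω - X s ω) ∂P = 0 := by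
      rw [integral_congr_ae (ae_restrict_of_ae hdiff),
        integral_add (hi 3 (Or.inl rfl)).integrableOn (hi (1 / 2) (Or.inr rfl)).integrableOn,
        hd.setIntegral_eq h hA hs (Or.inl rfl), hd.setIntegral_eq h hA hs (Or.inr rfl), add_zero]
    rw [integral_sub (hInt 1).integrableOn (hInt s).integrableOn] at hz
    linarith
  have hmean : ∫ ω, X 1 ω ∂P = c₀ := by
    -- The mean of `X 1` equals that of `X` at time `1/2`, which `hd.mean` evaluates.
    have e1 := hlate halfTime le_rfl univ MeasurableSet.univ
    rw [setIntegral_univ, setIntegral_univ] at e1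
    have m3 : MeasurableSet {ω | ξ ω = 3} := h.measurable_xi (measurableSet_singleton _)
    have m2 : MeasurableSet {ω | ξ ω = 1 / 2} := h.measurable_xi (measurableSet_singleton _)
    have e2 : ∫ ω, X halfTime ω ∂P = ∫ ω, ({ω | ξ ω = 3}.indicator (fun _ => K 3 (1 / 2)) ω +
        {ω | ξ ω = 1 / 2}.indicator (fun _ => K (1 / 2) (1 / 2)) ω) ∂P := by
      refine integral_congr_ae ?_
      filter_upwards [hX, h.ae_xi, h.ae_half_lt_jumpTime] with ω hω hx hs
      have hhv : ((halfTime : unitInterval) : ℝ) = 1 / 2 := rfl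
      rw [hω halfTime, jumpPath, hhv, if_neg (lt_irrefl _), if_pos hs]
      rcases hx with hx | hx <;> simp only [indicator, mem_ofPred_eq, hx] <;> norm_num
    rw [← e1, e2, integral_add ((integrable_const _).indicator m3)
      ((integrable_const _).indicator m2), integral_indicator_const _ m3,
      integral_indicator_const _ m2, h.xi_up, h.xi_down, smul_eq_mul, smul_eq_mul, hd.mean]
  have hall : ∀ s : unitInterval, ∀ A, MeasurableSet[marketFiltration P h s] A →
      ∫ ω in A, X s ω ∂P = ∫ ω in A, X 1 ω ∂P := by
    intro s A hA
    rcases lt_or_ge (s : ℝ) (1 / 2) with hs | hs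
    · rcases market_trivial h hs hA with h0 | h0
      · rw [setIntegral_measure_zero _ h0, setIntegral_measure_zero _ h0]
      · have hAu : A =ᵐ[P] univ := by rw [eventuallyEq_univ]; exact h0
        rw [setIntegral_congr_set hAu, setIntegral_congr_set hAu, setIntegral_univ,
          setIntegral_univ, hmean]
        have : ∀ᵐ ω ∂P, X s ω = c₀ := by
          filter_upwards [hX] with ω hω
          rw [hω s, jumpPath, if_pos hs]
        rw [integral_congr_ae this]; simp
    · exact hlate s hs A hA
  have hcond : ∀ s, X s =ᵐ[P] P[X 1 | marketFiltration P h s] := fun s =>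
    ae_eq_condExp_of_forall_setIntegral_eq ((marketFiltration P h).le s) (hInt 1)
      (fun A _ _ => (hInt s).integrableOn) (fun A hA _ => hall s A hA)
      (hadapted s).stronglyMeasurable.aestronglyMeasurable
  refine ⟨⟨fun t => (hadapted t).stronglyMeasurable, fun s t hst => ?_⟩, ?_⟩
  · calc P[X t | marketFiltration P h s]
        =ᵐ[P] P[P[X 1 | marketFiltration P h t] | marketFiltration P h s] :=
          condExp_congr_ae (hcond t)
      _ =ᵐ[P] P[X 1 | marketFiltration P h s] :=
          condExp_condExp_of_le ((marketFiltration P h).mono hst) ((marketFiltration P h).le t)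
      _ =ᵐ[P] X s := (hcond s).symm
  · filter_upwards [hX, h.ae_xi, h.ae_half_lt_jumpTime] with ω hω hx hs
    have : (fun t => X t ω) =
        fun t : unitInterval => jumpPath c₀ K J (ξ ω) (η ω) (jumpTime (θ ω)) t := funext hω
    rw [this]
    exact isCadlagPath_jumpPath (hd.continuous _ hx) hs

end Martingale

/-! ### The switching time of the approximating processes -/

/-- The relative excess over the bid price of `M̃ⁿ`, at time `1/2 + y` and before the jump at `σ`. -/
noncomputable def premium (n : ℕ) (b y : ℝ) : ℝ :=
  -b / 3 * ((Real.exp (n * y) - 1) * (1 - 1 / (n : ℝ)) + y)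

lemma continuous_premium (n : ℕ) (b : ℝ) : Continuous (premium n b) := by
  unfold premium; fun_prop

lemma premium_zero (n : ℕ) (b : ℝ) : premium n b 0 = 0 := by simp [premium]

lemma strictMono_premium {n : ℕ} {b : ℝ} (hb : b < 0) : StrictMono (premium n b) := by
  intro y z hyz
  have h1 := one_div_natCast_le_one n
  have h2 : Real.exp (n * y) ≤ Real.exp (n * z) :=
    Real.exp_le_exp.2 (mul_le_mul_of_nonneg_left hyz.le (Nat.cast_nonneg n))
  have h3 : (Real.exp (n * y) - 1) * (1 - 1 / (n : ℝ)) ≤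
      (Real.exp (n * z) - 1) * (1 - 1 / (n : ℝ)) :=
    mul_le_mul_of_nonneg_right (by linarith) (by linarith)
  unfold premium
  exact mul_lt_mul_of_pos_left (by linarith) (by linarith)

/-- With the integrating factor `e^{-n (u - 1/2)}`, the linear equation `p' = n p - n a b` of the
premium becomes a pure integration. The same antiderivative serves for `tildeA` and for the
martingale property of the price. -/
lemma hasDerivAt_exp_mul_premium {n : ℕ} (hn : n ≠ 0) (b u : ℝ) :
    HasDerivAt (fun u => Real.exp (-(n * (u - 1 / 2))) * premium n b (u - 1 / 2))
      (-(n * coefA u * b * Real.exp (-(n * (u - 1 / 2))))) u := by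
  have hn0 : (n : ℝ) ≠ 0 := by exact_mod_cast hn
  have e1 : ∀ u : ℝ, Real.exp (-(n * (u - 1 / 2))) * premium n b (u - 1 / 2) =
      -b / 3 * ((1 - Real.exp (-(n * (u - 1 / 2)))) * (1 - 1 / (n : ℝ)) +
        (u - 1 / 2) * Real.exp (-(n * (u - 1 / 2)))) := by
    intro u
    have : Real.exp (-(n * (u - 1 / 2))) * Real.exp (n * (u - 1 / 2)) = 1 := by
      rw [← Real.exp_add]; simp
    unfold premium
    linear_combination (-b / 3 * (1 - 1 / (n : ℝ))) * this
  simp_rw [e1]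
  have hid : HasDerivAt (fun u : ℝ => u - 1 / 2) 1 u := (hasDerivAt_id u).sub_const _
  have hexp : HasDerivAt (fun u : ℝ => Real.exp (-(n * (u - 1 / 2))))
      (Real.exp (-(n * (u - 1 / 2))) * -(n * 1)) u := ((hid.const_mul (n : ℝ)).neg).exp
  have := (((hexp.const_sub 1).mul_const (1 - 1 / (n : ℝ))).add (hid.mul hexp)).const_mul (-b / 3)
  refine this.congr_deriv ?_
  unfold coefA
  field_simp
  ring

lemma integral_coefA_exp {n : ℕ} (hn : n ≠ 0) (b s t : ℝ) :
    ∫ r in s..t, n * coefA r * b * Real.exp (-(n * (r - 1 / 2))) =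
      Real.exp (-(n * (s - 1 / 2))) * premium n b (s - 1 / 2) -
        Real.exp (-(n * (t - 1 / 2))) * premium n b (t - 1 / 2) := by
  have hA := continuous_coefA
  have := intervalIntegral.integral_eq_sub_of_hasDerivAt
    (f := fun u => -(Real.exp (-(n * (u - 1 / 2))) * premium n b (u - 1 / 2)))
    (f' := fun u => n * coefA u * b * Real.exp (-(n * (u - 1 / 2)))) (a := s) (b := t)
    (fun u _ => (hasDerivAt_exp_mul_premium hn b u).fun_neg.congr_deriv (neg_neg _))
    (Continuous.intervalIntegrable (by fun_prop) _ _)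
  rw [this]; ring

lemma tildeA_eq {n : ℕ} (hn : n ≠ 0) (lam x b t : ℝ) :
    tildeA lam x n b t = -((1 - lam) * x * premium n b (t - 1 / 2)) := by
  have h1 : Real.exp (n * (t - 1 / 2)) * Real.exp (-(n * (t - 1 / 2))) = 1 := by
    rw [← Real.exp_add]; simp
  rw [tildeA, integral_coefA_exp hn, sub_self, premium_zero]
  linear_combination (-((1 - lam) * x * premium n b (t - 1 / 2))) * h1

/-- The deterministic time at which `M̃ⁿ` reaches the ask price when there is no earlier jump. -/
def IsSwitchTime (lam : ℝ) (n : ℕ) (b r : ℝ) : Prop :=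
  r ∈ Ioo (1 / 2 : ℝ) 1 ∧ (1 - lam) * (1 + premium n b (r - 1 / 2)) = 1

/-- The premium starts at `0`, and at time `1` it exceeds the value `lam / (1 - lam)` at which bid
plus premium equals ask. -/
lemma exists_isSwitchTime {lam : ℝ} (h0 : 0 < lam) (h1 : lam < 1 / 14) {n : ℕ} (hn : 2 ≤ n) {b : ℝ}
    (hb : b ≤ -1 / 2) : ∃ r, IsSwitchTime lam n b r := by
  have hn2 : (2 : ℝ) ≤ n := by exact_mod_cast hn
  -- Here `-b/3 ≥ 1/6`, the exponential term is at least `1/2` and the linear term is `1/2`, so the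
  -- premium is at least `1/6`, while `lam / (1 - lam) < 1/13`.
  have hhigh : lam / (1 - lam) < premium n b (1 - 1 / 2) := by
    have e1 : (n : ℝ) / 2 ≤ Real.exp (n * (1 - 1 / 2)) - 1 := by
      have := Real.add_one_le_exp ((n : ℝ) * (1 - 1 / 2)); linarith
    have e2 : 1 / (n : ℝ) ≤ 1 / 2 := one_div_le_one_div_of_le (by norm_num) hn2
    have e3 : (1 : ℝ) * (1 / 2) ≤ (Real.exp (n * (1 - 1 / 2)) - 1) * (1 - 1 / (n : ℝ)) :=
      mul_le_mul (by linarith) (by linarith) (by norm_num) (by linarith)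
    have e4 : lam / (1 - lam) < 1 / 13 := by
      rw [div_lt_div_iff₀ (by linarith) (by norm_num)]; linarith
    unfold premium
    nlinarith
  have hc : ContinuousOn (fun r => premium n b (r - 1 / 2)) (Icc (1 / 2) 1) :=
    ((continuous_premium n b).comp (by fun_prop)).continuousOn
  have hpos : 0 < lam / (1 - lam) := div_pos h0 (by linarith)
  obtain ⟨r, hr, hr2⟩ := intermediate_value_Ioo (by norm_num : (1 / 2 : ℝ) ≤ 1) hc
    (show lam / (1 - lam) ∈ _ from ⟨by simpa [premium_zero] using hpos, hhigh⟩)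
  refine ⟨r, hr, ?_⟩
  simp only at hr2
  rw [hr2]
  have : 1 - lam ≠ 0 := by linarith
  field_simp
  ring

lemma IsSwitchTime.premium_eq {lam : ℝ} (h1 : lam < 1 / 14) {n : ℕ} {b r : ℝ}
    (hr : IsSwitchTime lam n b r) : premium n b (r - 1 / 2) = lam / (1 - lam) := by
  have := hr.2
  rw [eq_div_iff (by linarith)]
  linarith

lemma tildeM_mid {n : ℕ} (hn : n ≠ 0) {lam x e s b t : ℝ} (h1 : 1 / 2 < t) (h2 : t < s) :
    tildeM lam x e s n b t = (1 - lam) * x * (1 + premium n b (t - 1 / 2)) := by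
  rw [tildeM, if_neg (not_le.2 h1), if_pos h2, tildeA_eq hn]; ring

lemma ask_self {x e s : ℝ} (hs : 1 / 2 ≤ s) : ask x e s s = x * (1 + coefA s * (e - 1)) := by
  simp only [ask, hs, le_refl, if_true]; ring

lemma tildeM_late {n : ℕ} {lam x e s b t : ℝ} (h1 : 1 / 2 < s) (h2 : s ≤ t) :
    tildeM lam x e s n b t = (1 - lam) * x * (1 + coefA s * (e - 1)) := by
  rw [tildeM, if_neg (not_le.2 (h1.trans_le h2)), if_neg (not_lt.2 h2), ask_self h1.le]; ring

/-- Monotonicity of the premium makes the hitting set the interval `(r, s)`. If the jump comes no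
later than `r` the set is empty and the infimum takes its default value `1`, so `Z` then follows the
tilted processes up to the end. -/
lemma tildeSigma_down {n : ℕ} (hn : n ≠ 0) {lam x e s b r : ℝ} (hb : b < 0) (hx : x = 1 / 2)
    (hl : lam < 1 / 14) (hr : IsSwitchTime lam n b r) (hs1 : s ≤ 1) :
    tildeSigma lam x e s n b = if s ≤ r then 1 else r := by
  have hset : {t | 1 / 2 < t ∧ t < s ∧ x < tildeM lam x e s n b t} = Ioo r s := by
    ext t
    simp only [mem_ofPred_eq, mem_Ioo]
    have key : 1 / 2 < t → t < s → (x < tildeM lam x e s n b t ↔ r < t) := by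
      intro h1 h2
      rw [tildeM_mid hn h1 h2, hx]
      have hm := (strictMono_premium (n := n) hb).lt_iff_lt (a := r - 1 / 2) (b := t - 1 / 2)
      have hl' : 0 < 1 - lam := by linarith
      have h3 : r < t ↔ premium n b (r - 1 / 2) < premium n b (t - 1 / 2) := by
        rw [hm]; constructor <;> intro h <;> linarith
      rw [h3, hr.premium_eq hl, div_lt_iff₀ hl']
      constructor <;> intro h <;> nlinarith
    constructor
    · rintro ⟨h1, h2, h3⟩
      exact ⟨(key h1 h2).1 h3, h2⟩
    · rintro ⟨h1, h2⟩
      have h0 := hr.1.1.trans h1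
      exact ⟨h0, h2, (key h0 h2).2 h1⟩
  rw [tildeSigma, if_pos (by rw [hx]; norm_num), hset]
  split_ifs with hsr
  · rw [Ioo_eq_empty (not_lt.2 hsr), empty_union, csInf_singleton]
  · have hglb := (isGLB_Ioo (not_le.1 hsr)).union (isGLB_singleton (a := (1 : ℝ)))
    rw [hglb.csInf_eq ⟨1, Or.inr rfl⟩]
    exact min_eq_left hr.1.2.le

/-! ### Closed forms of the approximating processes -/

/-- The time from which on `Z^{0,n}` and `Z^{1,n}` have returned to the original jump intensity. -/
noncomputable def returnTime (r x : ℝ) : ℝ := if x < 1 then r else 1 / 2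

/-- The value of `Z^{0,n}` after time `1/2` and before the jump at `σ`. -/
noncomputable def preDensity (lam : ℝ) (n : ℕ) (r x t : ℝ) : ℝ :=
  1 / wealthHalf lam x * Real.exp (-((n : ℝ) - 1) * (min t (returnTime r x) - 1 / 2))

/-- The value of `Z^{1,n} / Z^{0,n}` after time `1/2` and before the jump at `σ`. -/
noncomputable def prePrice (lam : ℝ) (n : ℕ) (b r x t : ℝ) : ℝ :=
  if x < 1 then (1 - lam) * x * (1 + premium n b (min t r - 1 / 2)) else x

variable {Ω : Type*} [MeasurableSpace Ω]

/-- The value of `Z^{0,n}` after the jump at `σ`. -/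
noncomputable def postDensity (P : Measure Ω) (η : Ω → ℝ) (lam : ℝ) (n : ℕ) (g : ℝ → ℝ)
    (r x e s : ℝ) : ℝ :=
  if s ≤ returnTime r x then
    1 / wealthHalf lam x * Real.exp (-((n : ℝ) - 1) * (s - 1 / 2)) * (n * g e)
  else 1 / wealthHalf lam x * Real.exp (-((n : ℝ) - 1) * (returnTime r x - 1 / 2)) *
    jumpDensity P η lam n (clampTime s) e

/-- The value of `Z^{1,n} / Z^{0,n}` after the jump at `σ`. -/
noncomputable def postPrice (lam : ℝ) (n : ℕ) (r x e s : ℝ) : ℝ :=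
  if s ≤ returnTime r x then (1 - lam) * x * (1 + coefA s * (e - 1))
  else (1 - lam) * x * (1 + coefA (clampTime s) * (truncEta n e - 1))

variable {P : Measure Ω} {ξ η θ : Ω → ℝ} {etaT : ℕ → Ω → ℝ} {lam b r : ℝ} {n : ℕ} {g : ℝ → ℝ}

lemma tildeZ_mid {lam x e s g t : ℝ} {n : ℕ} (h1 : 1 / 2 ≤ t) (h2 : t < s) :
    tildeZ lam x e s n g t =
      1 / wealthHalf lam x * Real.exp (-((n : ℝ) - 1) * (t - 1 / 2)) := by
  rw [tildeZ, min_eq_left h1, min_eq_right h2.le, max_eq_left (by linarith), if_neg (not_le.2 h2),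
    dualY0, wealth, if_neg (lt_irrefl _), if_pos rfl]
  ring

lemma tildeZ_late {lam x e s g t : ℝ} {n : ℕ} (h1 : 1 / 2 < s) (h2 : s ≤ t) :
    tildeZ lam x e s n g t =
      1 / wealthHalf lam x * Real.exp (-((n : ℝ) - 1) * (s - 1 / 2)) * (n * g) := by
  rw [tildeZ, min_eq_left (h1.le.trans h2), min_eq_left h2, max_eq_left (by linarith), if_pos h2,
    dualY0, wealth, if_neg (lt_irrefl _), if_pos rfl]
  ring

/-- Once `σ̃ₙ` is replaced by the deterministic time `r`, the nested definitions collapse to one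
function of time before the jump and one function of `(η, σ)` after it, the form required by the
martingale criterion. -/
lemma Z0_eq (hn : n ≠ 0) (hb : b < 0) (hbP : b = ∫ ω', etaT n ω' * (η ω' - 1) ∂P)
    (hl : lam < 1 / 14) (hr : IsSwitchTime lam n b r) {ω : Ω} (hg : etaT n ω = g (η ω))
    (hx : ξ ω = 3 ∨ ξ ω = 1 / 2) (hs : 1 / 2 < jumpTime (θ ω)) (t : unitInterval) :
    Z0 P lam ξ η θ etaT n t ω = jumpPath 1 (preDensity lam n r)
      (postDensity P η lam n g r) (ξ ω) (η ω) (jumpTime (θ ω)) t := by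
  have hs1 := jumpTime_le_one (θ ω)
  have ht1 : (t : ℝ) ≤ 1 := t.2.2
  have hclamp : clampTime (jumpTime (θ ω)) = jumpTime (θ ω) := clampTime_of_mem ⟨hs.le, hs1⟩
  have hhat : hatEta P η lam n (jumpTime (θ ω)) ω =
    jumpDensity P η lam n (jumpTime (θ ω)) (η ω) := rfl
  simp only [Z0, ← hbP, hhat, hg]
  set s := jumpTime (θ ω)
  have hr1 := hr.1.1
  rcases lt_trichotomy (t : ℝ) (1 / 2) with ht | ht | ht
  · rw [if_pos ht.le, jumpPath_early ht, dualY0, wealth, if_pos ht, div_one]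
  · rw [if_pos ht.le, jumpPath_mid ht.ge (ht ▸ hs), dualY0, wealth, ht, if_neg (lt_irrefl _),
      if_pos rfl, preDensity, min_eq_left, sub_self, mul_zero, Real.exp_zero, mul_one]
    unfold returnTime
    split_ifs
    · exact hr1.le
    · exact le_rfl
  · rw [if_neg (not_le.2 ht)]
    rcases hx with hx | hx
    · have hsig : tildeSigma lam (ξ ω) (η ω) s n b = 1 / 2 := by
        rw [tildeSigma, if_neg (by rw [hx]; norm_num)]
      have hret : returnTime r (ξ ω) = 1 / 2 := by rw [returnTime, if_neg (by rw [hx]; norm_num)]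
      rw [hsig, if_neg (not_le.2 ht), tildeZ_mid le_rfl hs]
      rcases lt_or_ge (t : ℝ) s with hts | hts
      · rw [jumpPath_mid ht.le hts, preDensity, hret, min_eq_right ht.le, if_neg (not_le.2 hts)]
        ring
      · rw [jumpPath_late ht.le hts, postDensity, hret, if_neg (not_le.2 hs), if_pos hts, hclamp]
        ring
    · have hret : returnTime r (ξ ω) = r := by rw [returnTime, if_pos (by rw [hx]; norm_num)]
      rw [tildeSigma_down hn hb hx hl hr hs1]
      by_cases hsr : s ≤ r
      · rw [if_pos hsr, if_pos ht1]
        rcases lt_or_ge (t : ℝ) s with hts | hts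
        · rw [jumpPath_mid ht.le hts, preDensity, hret, min_eq_left (hts.le.trans hsr),
            tildeZ_mid ht.le hts]
        · rw [jumpPath_late ht.le hts, postDensity, hret, if_pos hsr, tildeZ_late hs hts]
      · rw [if_neg hsr]
        have hrs := not_le.1 hsr
        by_cases htr : (t : ℝ) ≤ r
        · have hts := htr.trans_lt hrs
          rw [if_pos htr, jumpPath_mid ht.le hts, preDensity, hret, min_eq_left htr,
            tildeZ_mid ht.le hts]
        · rw [if_neg htr, tildeZ_mid hr1.le hrs]
          rcases lt_or_ge (t : ℝ) s with hts | hts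
          · rw [jumpPath_mid ht.le hts, preDensity, hret, min_eq_right (not_le.1 htr).le,
              if_neg (not_le.2 hts)]
            ring
          · rw [jumpPath_late ht.le hts, postDensity, hret, if_neg hsr, if_pos hts, hclamp]
            ring

lemma Z1_eq (hn : n ≠ 0) (hb : b < 0) (hbP : b = ∫ ω', etaT n ω' * (η ω' - 1) ∂P)
    (hl : lam < 1 / 14) (hr : IsSwitchTime lam n b r) {ω : Ω} (hg : etaT n ω = g (η ω))
    (hx : ξ ω = 3 ∨ ξ ω = 1 / 2) (hs : 1 / 2 < jumpTime (θ ω)) (t : unitInterval) :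
    Z1 P lam ξ η θ etaT n t ω = jumpPath 1
      (fun x t => preDensity lam n r x t * prePrice lam n b r x t)
      (fun x e s => postDensity P η lam n g r x e s * postPrice lam n r x e s)
      (ξ ω) (η ω) (jumpTime (θ ω)) t := by
  have hs1 := jumpTime_le_one (θ ω)
  have ht1 : (t : ℝ) ≤ 1 := t.2.2
  have hclamp : clampTime (jumpTime (θ ω)) = jumpTime (θ ω) := clampTime_of_mem ⟨hs.le, hs1⟩
  have hhat : hatEta P η lam n (jumpTime (θ ω)) ω =
    jumpDensity P η lam n (jumpTime (θ ω)) (η ω) := rfl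
  simp only [Z1, ← hbP, hhat, hg]
  set s := jumpTime (θ ω)
  have hr1 := hr.1.1
  rcases lt_trichotomy (t : ℝ) (1 / 2) with ht | ht | ht
  · rw [if_pos ht.le, jumpPath_early ht, dualY1, shadow, wealth, if_pos ht, if_pos ht, div_one]
  · rw [if_pos ht.le, jumpPath_mid ht.ge (ht ▸ hs), dualY1, shadow, wealth, ht,
      if_neg (lt_irrefl _), if_neg (lt_irrefl _), if_pos rfl, if_pos rfl, preDensity, min_eq_left,
      sub_self, mul_zero, Real.exp_zero, mul_one, prePrice]
    · rcases hx with hx | hx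
      · rw [if_pos (by rw [hx]; norm_num), if_neg (by rw [hx]; norm_num)]; ring
      · rw [if_neg (by rw [hx]; norm_num), if_pos (by rw [hx]; norm_num), min_eq_left hr1.le,
          sub_self, premium_zero]
        ring
    · unfold returnTime
      split_ifs
      · exact hr1.le
      · exact le_rfl
  · rw [if_neg (not_le.2 ht)]
    rcases hx with hx | hx
    · have hx1 : ¬ ξ ω < 1 := by rw [hx]; norm_num
      have hsig : tildeSigma lam (ξ ω) (η ω) s n b = 1 / 2 := by
        rw [tildeSigma, if_neg hx1]
      have hret : returnTime r (ξ ω) = 1 / 2 := by rw [returnTime, if_neg hx1]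
      rw [hsig, if_neg (not_le.2 ht), tildeZ_mid le_rfl hs]
      rcases lt_or_ge (t : ℝ) s with hts | hts
      · rw [jumpPath_mid ht.le hts, preDensity, hret, min_eq_right ht.le, if_neg (not_le.2 hts),
          prePrice, if_neg hx1]
        ring
      · rw [jumpPath_late ht.le hts, postDensity, postPrice, hret, if_neg (not_le.2 hs),
          if_neg (not_le.2 hs), if_pos hts, hclamp]
        ring
    · have hx1 : ξ ω < 1 := by rw [hx]; norm_num
      have hret : returnTime r (ξ ω) = r := by rw [returnTime, if_pos hx1]
      rw [tildeSigma_down hn hb hx hl hr hs1]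
      by_cases hsr : s ≤ r
      · rw [if_pos hsr, if_pos ht1]
        rcases lt_or_ge (t : ℝ) s with hts | hts
        · rw [jumpPath_mid ht.le hts, preDensity, hret, min_eq_left (hts.le.trans hsr),
            tildeZ_mid ht.le hts, tildeM_mid hn ht hts, prePrice, if_pos hx1,
            min_eq_left (hts.le.trans hsr)]
        · rw [jumpPath_late ht.le hts, postDensity, postPrice, hret, if_pos hsr, if_pos hsr,
            tildeZ_late hs hts, tildeM_late hs hts]
      · rw [if_neg hsr]
        have hrs := not_le.1 hsr
        by_cases htr : (t : ℝ) ≤ r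
        · have hts := htr.trans_lt hrs
          rw [if_pos htr, jumpPath_mid ht.le hts, preDensity, hret, min_eq_left htr,
            tildeZ_mid ht.le hts, tildeM_mid hn ht hts, prePrice, if_pos hx1, min_eq_left htr]
        · rw [if_neg htr, tildeZ_mid hr1.le hrs]
          rcases lt_or_ge (t : ℝ) s with hts | hts
          · have hr2 := hr.2
            rw [jumpPath_mid ht.le hts, preDensity, hret, min_eq_right (not_le.1 htr).le,
              if_neg (not_le.2 hts), prePrice, if_pos hx1, min_eq_right (not_le.1 htr).le]
            -- After `r` the definition uses the ask price `x`, while the closed form stops the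
            -- premium at `r`; the defining equation of `r` says that these agree.
            linear_combination (-(1 / wealthHalf lam (ξ ω) *
              Real.exp (-((n : ℝ) - 1) * (r - 1 / 2)) * ξ ω)) * hr2
          · rw [jumpPath_late ht.le hts, postDensity, postPrice, hret, if_neg hsr, if_neg hsr,
              if_pos hts, hclamp]
            ring

/-! ### Martingale property of the approximating processes -/

lemma wealthHalf_up {lam : ℝ} (h0 : 0 < lam) :
    wealthHalf lam 3 = 5 * (5 + lam) / (6 * (1 + lam)) := by
  have : 1 + lam ≠ 0 := by linarith
  rw [wealthHalf, if_pos (by norm_num), holdHalf]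
  field_simp
  ring

lemma wealthHalf_down {lam : ℝ} (h0 : 0 < lam) :
    wealthHalf lam (1 / 2) = (5 + lam) / 24 := by
  have : 1 + lam ≠ 0 := by linarith
  rw [wealthHalf, if_neg (by norm_num), holdHalf]
  field_simp
  ring

lemma wealthHalf_pos {lam x : ℝ} (h0 : 0 < lam) (hx : x = 3 ∨ x = 1 / 2) :
    0 < wealthHalf lam x := by
  rcases hx with rfl | rfl
  · rw [wealthHalf_up h0]; positivity
  · rw [wealthHalf_down h0]; positivity

/-! ### Integrals of functions of the independent variables `η` and `σ` -/

section Integrals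

variable {Ω : Type*} [MeasurableSpace Ω] {P : Measure Ω} [IsProbabilityMeasure P]
  {ε : ℝ} {ξ η θ : Ω → ℝ}

lemma IsModel.map_theta_eta (h : IsModel P ε ξ η θ) :
    P.map (fun ω => (θ ω, η ω)) = (P.map θ).prod (P.map η) :=
  h.indep_eta_theta.symm.map_prod_eq_prod_map_map h.measurable_theta.aemeasurable
    h.measurable_eta.aemeasurable

/-- A family of densities in the variable `η`, indexed by time. -/
structure IsDensityFamily (P : Measure Ω) (η : Ω → ℝ) (H : ℝ → ℝ → ℝ) : Prop where
  measurable : Measurable fun z : ℝ × ℝ => H (clampTime z.1) z.2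
  nonneg : ∀ u e, 0 ≤ H (clampTime u) e
  integrable : ∀ u, Integrable (fun ω => H (clampTime u) (η ω)) P
  integral : ∀ u, ∫ ω, H (clampTime u) (η ω) ∂P = 1

variable {H : ℝ → ℝ → ℝ}

lemma IsDensityFamily.integrable_prod (h : IsModel P ε ξ η θ) (hH : IsDensityFamily P η H) :
    Integrable (fun z : ℝ × ℝ => H (clampTime (jumpTime z.1)) z.2) ((P.map θ).prod (P.map η)) := by
  have := Measure.isProbabilityMeasure_map (μ := P) h.measurable_theta.aemeasurable
  have := Measure.isProbabilityMeasure_map (μ := P) h.measurable_eta.aemeasurable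
  have hm : Measurable fun z : ℝ × ℝ => H (clampTime (jumpTime z.1)) z.2 :=
    hH.measurable.comp ((measurable_jumpTime.comp measurable_fst).prodMk measurable_snd)
  have hme : ∀ u, AEStronglyMeasurable (fun e => H (clampTime u) e) (P.map η) := fun u =>
    (hH.measurable.comp (measurable_const.prodMk measurable_id)).aestronglyMeasurable
  rw [integrable_prod_iff hm.aestronglyMeasurable]
  refine ⟨ae_of_all _ fun u => ?_, ?_⟩
  · exact (integrable_map_measure (hme (jumpTime u)) h.measurable_eta.aemeasurable).2
      (hH.integrable (jumpTime u))
  · have : ∀ u, ∫ e, ‖H (clampTime (jumpTime u)) e‖ ∂(P.map η) = 1 := by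
      intro u
      simp_rw [Real.norm_of_nonneg (hH.nonneg _ _)]
      rw [integral_map h.measurable_eta.aemeasurable (hme _)]
      exact hH.integral _
    simp_rw [this]
    exact integrable_const _

lemma IsDensityFamily.integrable_comp (h : IsModel P ε ξ η θ) (hH : IsDensityFamily P η H) :
    Integrable (fun ω => H (clampTime (jumpTime (θ ω))) (η ω)) P := by
  have := hH.integrable_prod h
  rw [← h.map_theta_eta] at this
  exact this.comp_measurable (h.measurable_theta.prodMk h.measurable_eta)

/-- Integrating over `η` first gives `1` at each time, so only `P[s < σ]` remains. The atom of `σ`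
at `1` needs no separate treatment. -/
lemma IsDensityFamily.setIntegral_comp (h : IsModel P ε ξ η θ) (hH : IsDensityFamily P η H)
    {s : ℝ} (hs : 1 / 2 ≤ s) (hs1 : s < 1) :
    ∫ ω in {ω | s < jumpTime (θ ω)}, H (clampTime (jumpTime (θ ω))) (η ω) ∂P =
      Real.exp (-(s - 1 / 2)) := by
  have := Measure.isProbabilityMeasure_map (μ := P) h.measurable_theta.aemeasurable
  have := Measure.isProbabilityMeasure_map (μ := P) h.measurable_eta.aemeasurable
  have hi := hH.integrable_prod h
  have hB : MeasurableSet {u : ℝ | s < jumpTime u} :=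
    measurableSet_lt measurable_const measurable_jumpTime
  have hme : ∀ u, AEStronglyMeasurable (fun e => H (clampTime u) e) (P.map η) := fun u =>
    (hH.measurable.comp (measurable_const.prodMk measurable_id)).aestronglyMeasurable
  have e1 : {ω | s < jumpTime (θ ω)} =
      (fun ω => (θ ω, η ω)) ⁻¹' ({u : ℝ | s < jumpTime u} ×ˢ univ) := by
    ext ω; simp
  have e2 := setIntegral_map (μ := P) (g := fun ω => (θ ω, η ω))
    (f := fun z : ℝ × ℝ => H (clampTime (jumpTime z.1)) z.2) (hB.prod MeasurableSet.univ)
    (by rw [h.map_theta_eta]; exact hi.aestronglyMeasurable)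
    (h.measurable_theta.prodMk h.measurable_eta).aemeasurable
  rw [← e1, h.map_theta_eta, setIntegral_prod _ hi.integrableOn] at e2
  rw [← e2, ← h.measure_lt_jumpTime hs hs1]
  have e3 : ∀ u, ∫ e in univ, H (clampTime (jumpTime u)) e ∂(P.map η) = 1 := by
    intro u
    rw [setIntegral_univ, integral_map h.measurable_eta.aemeasurable (hme _)]
    exact hH.integral _
  simp_rw [e3]
  rw [setIntegral_const, smul_eq_mul, mul_one,
    map_measureReal_apply h.measurable_theta hB]
  rfl

lemma IsModel.setIntegral_mul (h : IsModel P ε ξ η θ) {s r : ℝ} (hs : 1 / 2 ≤ s)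
    (hsr : s ≤ r) (hr : r < 1) {f G : ℝ → ℝ} (hf : Measurable f) (hG : Measurable G) :
    ∫ ω in {ω | s < jumpTime (θ ω) ∧ jumpTime (θ ω) ≤ r}, f (jumpTime (θ ω)) * G (η ω) ∂P =
      (∫ u in s..r, f u * Real.exp (-(u - 1 / 2))) * ∫ ω, G (η ω) ∂P := by
  have hB : MeasurableSet {u : ℝ | s < jumpTime u ∧ jumpTime u ≤ r} :=
    (measurableSet_lt measurable_const measurable_jumpTime).inter
      (measurableSet_le measurable_jumpTime measurable_const)
  have hB' : MeasurableSet {ω | s < jumpTime (θ ω) ∧ jumpTime (θ ω) ≤ r} := h.measurable_theta hB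
  have key := h.indep_eta_theta.symm.integral_fun_comp_mul_comp
    (f := {u : ℝ | s < jumpTime u ∧ jumpTime u ≤ r}.indicator (fun u => f (jumpTime u))) (g := G)
    h.measurable_theta.aemeasurable h.measurable_eta.aemeasurable
    (((hf.comp measurable_jumpTime).indicator hB).aestronglyMeasurable) hG.aestronglyMeasurable
  rw [← h.setIntegral_jumpTime hs hsr hr hf, ← integral_indicator hB', ← integral_indicator hB']
  refine Eq.trans (integral_congr_ae (ae_of_all _ fun ω => ?_)) key
  by_cases hω : s < jumpTime (θ ω) ∧ jumpTime (θ ω) ≤ r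
  · simp [indicator, hω]
  · simp only [indicator, mem_ofPred_eq, hω, if_false, zero_mul]

/-- The value after the jump at `σ` of a process whose jump intensity changes at time `r`. -/
noncomputable def switchJump (H : ℝ → ℝ → ℝ) (f₁ f₂ g : ℝ → ℝ) (κ r e u : ℝ) : ℝ :=
  if u ≤ r then f₁ u * g e + f₂ u * (g e * (e - 1)) else κ * H (clampTime u) e

variable {f₁ f₂ g : ℝ → ℝ} {κ r b : ℝ}

lemma integrable_continuous_mul (h : IsModel P ε ξ η θ) {f G : ℝ → ℝ} (hf : Continuous f)
    (hGi : Integrable (fun ω => G (η ω)) P) :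
    Integrable (fun ω => f (jumpTime (θ ω)) * G (η ω)) P := by
  obtain ⟨C, hC⟩ := (isCompact_Icc (a := (1 / 2 : ℝ)) (b := 1)).exists_bound_of_continuousOn
    hf.continuousOn
  refine hGi.bdd_mul (c := C)
    ((hf.measurable.comp (measurable_jumpTime.comp h.measurable_theta)).aestronglyMeasurable) ?_
  filter_upwards [h.ae_half_lt_jumpTime] with ω hω
  exact hC _ ⟨hω.le, jumpTime_le_one _⟩

lemma integrable_switchJump (h : IsModel P ε ξ η θ) (hH : IsDensityFamily P η H)
    (hf₁ : Continuous f₁) (hf₂ : Continuous f₂)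
    (hgi : Integrable (fun ω => g (η ω)) P)
    (hgi' : Integrable (fun ω => g (η ω) * (η ω - 1)) P) :
    Integrable (fun ω => switchJump H f₁ f₂ g κ r (η ω) (jumpTime (θ ω))) P := by
  have i1 := (integrable_continuous_mul h hf₁ hgi).add
    (integrable_continuous_mul h hf₂ (G := fun e => g e * (e - 1)) hgi')
  have i2 := (hH.integrable_comp h).const_mul κ
  have hB : MeasurableSet {ω | jumpTime (θ ω) ≤ r} :=
    measurableSet_le (measurable_jumpTime.comp h.measurable_theta) measurable_const
  refine ((i1.indicator hB).add (i2.indicator hB.compl)).congr (ae_of_all _ fun ω => ?_)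
  by_cases hω : jumpTime (θ ω) ≤ r
  · simp [switchJump, indicator, hω]
  · simp [switchJump, indicator, hω]

lemma setIntegral_switchJump_of_ge (h : IsModel P ε ξ η θ) (hH : IsDensityFamily P η H) {s : ℝ}
    (hs : 1 / 2 ≤ s) (hs1 : s < 1) (hrs : r ≤ s) :
    ∫ ω in {ω | s < jumpTime (θ ω)}, switchJump H f₁ f₂ g κ r (η ω) (jumpTime (θ ω)) ∂P =
      κ * Real.exp (-(s - 1 / 2)) := by
  have hB : MeasurableSet {ω | s < jumpTime (θ ω)} :=
    measurableSet_lt measurable_const (measurable_jumpTime.comp h.measurable_theta)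
  rw [← hH.setIntegral_comp h hs hs1, ← integral_const_mul]
  refine setIntegral_congr_fun hB fun ω hω => ?_
  simp only [mem_ofPred_eq] at hω
  simp only [switchJump, if_neg (not_le.2 (hrs.trans_lt hω))]

lemma setIntegral_switchJump_of_le (h : IsModel P ε ξ η θ) (hH : IsDensityFamily P η H)
    (hf₁ : Continuous f₁) (hf₂ : Continuous f₂) (hg : Measurable g)
    (hgi : Integrable (fun ω => g (η ω)) P)
    (hgi' : Integrable (fun ω => g (η ω) * (η ω - 1)) P)
    (hg1 : ∫ ω, g (η ω) ∂P = 1) (hg2 : ∫ ω, g (η ω) * (η ω - 1) ∂P = b) {s : ℝ}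
    (hs : 1 / 2 ≤ s) (hsr : s ≤ r) (hr1 : r < 1) :
    ∫ ω in {ω | s < jumpTime (θ ω)}, switchJump H f₁ f₂ g κ r (η ω) (jumpTime (θ ω)) ∂P =
      (∫ u in s..r, (f₁ u + f₂ u * b) * Real.exp (-(u - 1 / 2))) +
        κ * Real.exp (-(r - 1 / 2)) := by
  have hInt := integrable_switchJump (κ := κ) (r := r) h hH hf₁ hf₂ hgi hgi'
  have hB1 : MeasurableSet {ω | s < jumpTime (θ ω) ∧ jumpTime (θ ω) ≤ r} :=
    (measurableSet_lt measurable_const (measurable_jumpTime.comp h.measurable_theta)).inter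
      (measurableSet_le (measurable_jumpTime.comp h.measurable_theta) measurable_const)
  have hB2 : MeasurableSet {ω | r < jumpTime (θ ω)} :=
    measurableSet_lt measurable_const (measurable_jumpTime.comp h.measurable_theta)
  have hU : {ω | s < jumpTime (θ ω)} =
      {ω | s < jumpTime (θ ω) ∧ jumpTime (θ ω) ≤ r} ∪ {ω | r < jumpTime (θ ω)} := by
    ext ω
    simp only [mem_ofPred_eq, mem_union]
    constructor
    · intro h1
      rcases le_or_gt (jumpTime (θ ω)) r with h2 | h2
      · exact Or.inl ⟨h1, h2⟩
      · exact Or.inr h2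
    · rintro (h1 | h1)
      · exact h1.1
      · exact hsr.trans_lt h1
  have hdis : Disjoint {ω | s < jumpTime (θ ω) ∧ jumpTime (θ ω) ≤ r} {ω | r < jumpTime (θ ω)} := by
    rw [Set.disjoint_left]
    rintro ω ⟨_, h1⟩ h2
    exact absurd h2 (not_lt.2 h1)
  rw [hU, setIntegral_union hdis hB2 hInt.integrableOn hInt.integrableOn,
    setIntegral_switchJump_of_ge h hH (hs.trans hsr) hr1 le_rfl]
  congr 1
  have i1 := integrable_continuous_mul h hf₁ hgi
  have i2 := integrable_continuous_mul h hf₂ (G := fun e => g e * (e - 1)) hgi'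
  have e1 : ∫ ω in {ω | s < jumpTime (θ ω) ∧ jumpTime (θ ω) ≤ r},
      switchJump H f₁ f₂ g κ r (η ω) (jumpTime (θ ω)) ∂P =
      ∫ ω in {ω | s < jumpTime (θ ω) ∧ jumpTime (θ ω) ≤ r}, (f₁ (jumpTime (θ ω)) * g (η ω) +
        f₂ (jumpTime (θ ω)) * (g (η ω) * (η ω - 1))) ∂P := by
    refine setIntegral_congr_fun hB1 fun ω hω => ?_
    simp only [mem_ofPred_eq] at hω
    simp only [switchJump, if_pos hω.2]
  rw [e1, integral_add i1.integrableOn i2.integrableOn,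
    h.setIntegral_mul hs hsr hr1 hf₁.measurable hg,
    h.setIntegral_mul hs hsr hr1 hf₂.measurable (G := fun e => g e * (e - 1))
      (hg.mul (measurable_id.sub_const 1)), hg1, hg2, mul_one, ← intervalIntegral.integral_mul_const,
    ← intervalIntegral.integral_add]
  · congr 1; ext u; ring
  · exact Continuous.intervalIntegrable (by fun_prop) _ _
  · exact Continuous.intervalIntegrable (by fun_prop) _ _

end Integrals

/-! ### Verification of the martingale criterion for `Z⁰` and `Z¹` -/

section Approx

variable {Ω : Type*} [MeasurableSpace Ω] {P : Measure Ω} [IsProbabilityMeasure P]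
  {ε lam b r : ℝ} {n : ℕ} {ξ η θ : Ω → ℝ} {etaT : ℕ → Ω → ℝ} {g : ℝ → ℝ}

/-- The index `n` is large enough for `M̃ⁿ` to reach the ask price at a time `r < 1` and for
the truncation of `η` to be negligible; `g` represents the density `η̃ⁿ` as a function of `η`. -/
structure IsApprox (P : Measure Ω) (η : Ω → ℝ) (etaT : ℕ → Ω → ℝ) (lam : ℝ) (n : ℕ) (b r : ℝ)
    (g : ℝ → ℝ) : Prop where
  n_ne : n ≠ 0
  large : 1 ≤ 2 * lam * n
  neg : b < 0
  eq_b : b = ∫ ω, etaT n ω * (η ω - 1) ∂P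
  switch : IsSwitchTime lam n b r
  measurable : Measurable g
  factor : ∀ ω, etaT n ω = g (η ω)

lemma IsTilting.integrable (ht : IsTilting P η etaT) (n : ℕ) : Integrable (etaT n) P := by
  by_contra hcon
  have := ht.mean n
  rw [integral_undef hcon] at this
  norm_num at this

lemma IsTilting.integrable_mul (hε : ε ∈ Ioo (0 : ℝ) (1 / 3)) (h : IsModel P ε ξ η θ)
    (ht : IsTilting P η etaT) (n : ℕ) : Integrable (fun ω => etaT n ω * (η ω - 1)) P := by
  refine (ht.integrable n).mul_bdd (c := 1)
    (h.measurable_eta.sub_const 1).aestronglyMeasurable ?_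
  filter_upwards [h.ae_eta_mem hε] with ω hω
  rw [Real.norm_eq_abs, abs_le]
  constructor <;> linarith [hω.1, hω.2]

lemma isDensityFamily_jumpDensity (hε : ε ∈ Ioo (0 : ℝ) (1 / 3)) (hl : lam ∈ Ioo 0 (costBound ε))
    (h : IsModel P ε ξ η θ) (hn : n ≠ 0) : IsDensityFamily P η (jumpDensity P η lam n) where
  measurable := h.measurable_jumpDensity hε hl hn
  nonneg u e := (h.jumpDensity_pos hε hl hn (clampTime_mem u) e).le
  integrable u := h.integrable_jumpDensity hε hl hn (clampTime_mem u)
  integral u := h.integral_jumpDensity hε hl hn (clampTime_mem u)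

lemma isDensityFamily_jumpPrice (hε : ε ∈ Ioo (0 : ℝ) (1 / 3)) (hl : lam ∈ Ioo 0 (costBound ε))
    (h : IsModel P ε ξ η θ) (hn : n ≠ 0) : IsDensityFamily P η (jumpPrice P η lam n) where
  measurable := h.measurable_jumpPrice hε hl hn
  nonneg u e := h.jumpPrice_nonneg hε hl hn (clampTime_mem u) e
  integrable u := h.integrable_jumpPrice hε hl hn (clampTime_mem u)
  integral u := h.integral_jumpPrice hε hl hn (clampTime_mem u)

lemma measurable_wealthHalf (lam : ℝ) : Measurable (wealthHalf lam) := by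
  unfold wealthHalf
  exact Measurable.ite measurableSet_Ioi (by fun_prop) (by fun_prop)

lemma measurable_returnTime (r : ℝ) : Measurable (returnTime r) := by
  unfold returnTime
  exact Measurable.ite measurableSet_Iio measurable_const measurable_const

lemma measurable_preDensity (lam : ℝ) (n : ℕ) (r : ℝ) :
    Measurable fun z : ℝ × ℝ => preDensity lam n r z.1 z.2 := by
  have h1 := measurable_wealthHalf lam
  have h2 := measurable_returnTime r
  unfold preDensity
  fun_prop

lemma measurable_prePrice (lam : ℝ) (n : ℕ) (b r : ℝ) :
    Measurable fun z : ℝ × ℝ => prePrice lam n b r z.1 z.2 := by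
  have h1 := (continuous_premium n b).measurable
  unfold prePrice
  exact Measurable.ite (measurableSet_lt measurable_fst measurable_const) (by fun_prop) (by fun_prop)

lemma measurableSet_le_returnTime (r : ℝ) :
    MeasurableSet {z : ℝ × ℝ × ℝ | z.2.2 ≤ returnTime r z.1} :=
  measurableSet_le (by fun_prop) ((measurable_returnTime r).comp measurable_fst)

lemma measurable_postDensity (hε : ε ∈ Ioo (0 : ℝ) (1 / 3)) (hl : lam ∈ Ioo 0 (costBound ε))
    (h : IsModel P ε ξ η θ) (hn : n ≠ 0) (hg : Measurable g) (r : ℝ) :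
    Measurable fun z : ℝ × ℝ × ℝ => postDensity P η lam n g r z.1 z.2.1 z.2.2 := by
  have h1 := measurable_wealthHalf lam
  have h2 := measurable_returnTime r
  have h3 : Measurable fun z : ℝ × ℝ × ℝ => jumpDensity P η lam n (clampTime z.2.2) z.2.1 :=
    (h.measurable_jumpDensity hε hl hn).comp
      (g := fun z : ℝ × ℝ => jumpDensity P η lam n (clampTime z.1) z.2)
      (f := fun z : ℝ × ℝ × ℝ => (z.2.2, z.2.1)) (by fun_prop)
  have h4 : Measurable fun z : ℝ × ℝ × ℝ => 1 / wealthHalf lam z.1 *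
      Real.exp (-((n : ℝ) - 1) * (z.2.2 - 1 / 2)) * (n * g z.2.1) := by fun_prop
  have h5 : Measurable fun z : ℝ × ℝ × ℝ => 1 / wealthHalf lam z.1 *
      Real.exp (-((n : ℝ) - 1) * (returnTime r z.1 - 1 / 2)) := by fun_prop
  unfold postDensity
  exact Measurable.ite (measurableSet_le_returnTime r) h4 (h5.mul h3)

lemma measurable_postPrice (lam : ℝ) (n : ℕ) (r : ℝ) :
    Measurable fun z : ℝ × ℝ × ℝ => postPrice lam n r z.1 z.2.1 z.2.2 := by
  have h1 := continuous_coefA.measurable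
  have h2 := measurable_clampTime
  unfold postPrice truncEta
  exact Measurable.ite (measurableSet_le_returnTime r) (by fun_prop) (by fun_prop)

lemma continuous_preDensity (lam : ℝ) (n : ℕ) (r x : ℝ) : Continuous (preDensity lam n r x) := by
  unfold preDensity; fun_prop

lemma continuous_prePrice (lam : ℝ) (n : ℕ) (b r x : ℝ) :
    Continuous (prePrice lam n b r x) := by
  have h1 := continuous_premium n b
  unfold prePrice
  split_ifs <;> fun_prop

lemma postDensity_eq_switchJump (x : ℝ) : postDensity P η lam n g r x =
    switchJump (jumpDensity P η lam n)
      (fun u => 1 / wealthHalf lam x * Real.exp (-((n : ℝ) - 1) * (u - 1 / 2)) * n) (fun _ => 0) g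
      (1 / wealthHalf lam x * Real.exp (-((n : ℝ) - 1) * (returnTime r x - 1 / 2)))
      (returnTime r x) := by
  ext e u
  unfold postDensity switchJump
  split_ifs <;> ring

/-- The price factor `1 + a_u (e - 1)` is split into its constant part and the part proportional to
`e - 1`, since only the means of `g` and of `g (e - 1)` are known. -/
lemma postPrice_eq_switchJump (x : ℝ) :
    (fun e s => postDensity P η lam n g r x e s * postPrice lam n r x e s) =
    switchJump (jumpPrice P η lam n)
      (fun u => 1 / wealthHalf lam x * Real.exp (-((n : ℝ) - 1) * (u - 1 / 2)) * n *
        ((1 - lam) * x))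
      (fun u => 1 / wealthHalf lam x * Real.exp (-((n : ℝ) - 1) * (u - 1 / 2)) * n *
        ((1 - lam) * x) * coefA u) g
      (1 / wealthHalf lam x * Real.exp (-((n : ℝ) - 1) * (returnTime r x - 1 / 2)) * x)
      (returnTime r x) := by
  ext e u
  unfold postDensity postPrice switchJump jumpPrice
  split_ifs <;> ring

lemma IsApprox.integrable_g (ha : IsApprox P η etaT lam n b r g) (ht : IsTilting P η etaT) :
    Integrable (fun ω => g (η ω)) P := by
  simpa only [← ha.factor] using ht.integrable n

lemma IsApprox.integrable_g_mul (hε : ε ∈ Ioo (0 : ℝ) (1 / 3)) (h : IsModel P ε ξ η θ)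
    (ha : IsApprox P η etaT lam n b r g) (ht : IsTilting P η etaT) :
    Integrable (fun ω => g (η ω) * (η ω - 1)) P := by
  simpa only [← ha.factor] using ht.integrable_mul hε h n

lemma IsApprox.integral_g (ha : IsApprox P η etaT lam n b r g) (ht : IsTilting P η etaT) :
    ∫ ω, g (η ω) ∂P = 1 := by
  simpa only [← ha.factor] using ht.mean n

lemma IsApprox.integral_g_mul (ha : IsApprox P η etaT lam n b r g) :
    ∫ ω, g (η ω) * (η ω - 1) ∂P = b := by
  rw [ha.eq_b]; simp only [← ha.factor]

lemma exp_mul_exp_eq (n : ℕ) (u : ℝ) :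
    Real.exp (-((n : ℝ) - 1) * (u - 1 / 2)) * Real.exp (-(u - 1 / 2)) =
      Real.exp (-(n * (u - 1 / 2))) := by
  rw [← Real.exp_add]; congr 1; ring

lemma integral_exp_intensity (n : ℕ) (s t : ℝ) :
    ∫ u in s..t, n * Real.exp (-(n * (u - 1 / 2))) =
      Real.exp (-(n * (s - 1 / 2))) - Real.exp (-(n * (t - 1 / 2))) := by
  have hd : ∀ u : ℝ, HasDerivAt (fun u : ℝ => -Real.exp (-(n * (u - 1 / 2))))
      (n * Real.exp (-(n * (u - 1 / 2)))) u := by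
    intro u
    have hid : HasDerivAt (fun u : ℝ => u - 1 / 2) 1 u := (hasDerivAt_id u).sub_const _
    refine (((hid.const_mul (n : ℝ)).fun_neg).exp.fun_neg).congr_deriv ?_
    ring
  rw [intervalIntegral.integral_eq_sub_of_hasDerivAt (fun u _ => hd u)
    (Continuous.intervalIntegrable (by fun_prop) _ _)]
  ring

lemma IsApprox.returnTime_mem (ha : IsApprox P η etaT lam n b r g) (x : ℝ) :
    returnTime r x ∈ Ico (1 / 2 : ℝ) 1 := by
  unfold returnTime
  split_ifs
  · exact ⟨ha.switch.1.1.le, ha.switch.1.2⟩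
  · exact ⟨le_rfl, by norm_num⟩

lemma IsApprox.prePrice_of_ge (ha : IsApprox P η etaT lam n b r g) {x t : ℝ}
    (ht : returnTime r x ≤ t) : prePrice lam n b r x t = x := by
  unfold returnTime at ht
  unfold prePrice
  split_ifs at ht ⊢ with hx
  · rw [min_eq_right ht]
    have := ha.switch.2
    linear_combination x * this
  · rfl

/-- Up to the return time the density decays at rate `n - 1`; combined with the survival probability
`e^{-(u - 1/2)}` this is the survival function of a jump with intensity `n`, which the factor `n` in
the jump balances. Afterwards the density is constant until the jump, whose factor has mean one. -/
theorem IsApprox.isMartingaleData_density (hε : ε ∈ Ioo (0 : ℝ) (1 / 3))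
    (hl : lam ∈ Ioo 0 (costBound ε)) (h : IsModel P ε ξ η θ)
    (ha : IsApprox P η etaT lam n b r g) (ht : IsTilting P η etaT) :
    IsMartingaleData P η θ 1 (preDensity lam n r) (postDensity P η lam n g r) where
  measurable_K := measurable_preDensity lam n r
  measurable_J := measurable_postDensity hε hl h ha.n_ne ha.measurable r
  continuous v _ := continuous_preDensity lam n r v
  integrable v _ := by
    rw [postDensity_eq_switchJump]
    exact integrable_switchJump h (isDensityFamily_jumpDensity hε hl h ha.n_ne) (by fun_prop)
      continuous_const (ha.integrable_g ht) (ha.integrable_g_mul hε h ht)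
  integral v _ s hs hs1 := by
    have hH := isDensityFamily_jumpDensity hε hl h ha.n_ne
    rw [postDensity_eq_switchJump, preDensity]
    rcases le_total (returnTime r v) s with hrs | hsr
    · rw [setIntegral_switchJump_of_ge h hH hs hs1 hrs, min_eq_right hrs]
      ring
    · rw [setIntegral_switchJump_of_le h hH (by fun_prop) continuous_const ha.measurable
        (ha.integrable_g ht) (ha.integrable_g_mul hε h ht) (ha.integral_g ht) ha.integral_g_mul hs
        hsr (ha.returnTime_mem v).2, min_eq_left hsr]
      have e1 : ∀ u : ℝ, (1 / wealthHalf lam v * Real.exp (-((n : ℝ) - 1) * (u - 1 / 2)) * n +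
          0 * b) * Real.exp (-(u - 1 / 2)) =
          1 / wealthHalf lam v * (n * Real.exp (-(n * (u - 1 / 2)))) := by
        intro u
        rw [← exp_mul_exp_eq]; ring
      simp_rw [e1]
      rw [intervalIntegral.integral_const_mul, integral_exp_intensity]
      linear_combination (1 / wealthHalf lam v) * exp_mul_exp_eq n (returnTime r v) -
        (1 / wealthHalf lam v) * exp_mul_exp_eq n s
  mean := by
    have h0 := hl.1
    have m : ∀ v, min (1 / 2) (returnTime r v) = 1 / 2 := fun v =>
      min_eq_left (ha.returnTime_mem v).1
    simp only [preDensity, m, sub_self, mul_zero, Real.exp_zero, mul_one]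
    -- The identity `(1 + lam)/(5 + lam) + 4/(5 + lam) = 1` reflects the optimality of `holdHalf`.
    rw [wealthHalf_up h0, wealthHalf_down h0]
    have : 5 + lam ≠ 0 := by linarith
    field_simp
    ring

theorem IsApprox.isMartingaleData_price (hε : ε ∈ Ioo (0 : ℝ) (1 / 3))
    (hl : lam ∈ Ioo 0 (costBound ε)) (h : IsModel P ε ξ η θ)
    (ha : IsApprox P η etaT lam n b r g) (ht : IsTilting P η etaT) :
    IsMartingaleData P η θ 1 (fun x t => preDensity lam n r x t * prePrice lam n b r x t)
      (fun x e s => postDensity P η lam n g r x e s * postPrice lam n r x e s) where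
  measurable_K := (measurable_preDensity lam n r).mul (measurable_prePrice lam n b r)
  measurable_J := (measurable_postDensity hε hl h ha.n_ne ha.measurable r).mul
    (measurable_postPrice lam n r)
  continuous v _ := (continuous_preDensity lam n r v).mul (continuous_prePrice lam n b r v)
  integrable v _ := by
    have hA := continuous_coefA
    have := integrable_switchJump (H := jumpPrice P η lam n) (f₁ := fun u =>
        1 / wealthHalf lam v * Real.exp (-((n : ℝ) - 1) * (u - 1 / 2)) * n * ((1 - lam) * v))
      (f₂ := fun u => 1 / wealthHalf lam v * Real.exp (-((n : ℝ) - 1) * (u - 1 / 2)) * n *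
        ((1 - lam) * v) * coefA u)
      (κ := 1 / wealthHalf lam v * Real.exp (-((n : ℝ) - 1) * (returnTime r v - 1 / 2)) * v)
      (r := returnTime r v) h (isDensityFamily_jumpPrice hε hl h ha.n_ne) (by fun_prop)
      (by fun_prop) (ha.integrable_g ht) (ha.integrable_g_mul hε h ht)
    rwa [← postPrice_eq_switchJump] at this
  integral v hv s hs hs1 := by
    have hA := continuous_coefA
    have hH := isDensityFamily_jumpPrice hε hl h ha.n_ne
    have hsw := postPrice_eq_switchJump (P := P) (η := η) (lam := lam) (n := n) (g := g) (r := r) v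
    have hsw' : ∀ e u, postDensity P η lam n g r v e u * postPrice lam n r v e u = _ :=
      fun e u => congrFun (congrFun hsw e) u
    simp only [hsw']
    rcases le_total (returnTime r v) s with hrs | hsr
    · rw [setIntegral_switchJump_of_ge h hH hs hs1 hrs, preDensity, min_eq_right hrs,
        ha.prePrice_of_ge hrs]
      ring
    · rw [setIntegral_switchJump_of_le h hH (by fun_prop) (by fun_prop) ha.measurable
        (ha.integrable_g ht) (ha.integrable_g_mul hε h ht) (ha.integral_g ht) ha.integral_g_mul hs
        hsr (ha.returnTime_mem v).2, preDensity, min_eq_left hsr]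
      rcases hv with rfl | rfl
      · have hret : returnTime r 3 = 1 / 2 := by rw [returnTime, if_neg (by norm_num)]
        rw [hret] at hsr ⊢
        obtain rfl : s = 1 / 2 := le_antisymm hsr hs
        rw [intervalIntegral.integral_same, prePrice, if_neg (by norm_num)]
        ring
      · have hret : returnTime r (1 / 2) = r := by rw [returnTime, if_pos (by norm_num)]
        rw [hret] at hsr ⊢
        rw [prePrice, if_pos (by norm_num), min_eq_left hsr]
        have e1 : ∀ u : ℝ, (1 / wealthHalf lam (1 / 2) *
            Real.exp (-((n : ℝ) - 1) * (u - 1 / 2)) * n * ((1 - lam) * (1 / 2)) +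
            1 / wealthHalf lam (1 / 2) * Real.exp (-((n : ℝ) - 1) * (u - 1 / 2)) * n *
            ((1 - lam) * (1 / 2)) * coefA u * b) * Real.exp (-(u - 1 / 2)) =
            1 / wealthHalf lam (1 / 2) * ((1 - lam) * (1 / 2)) *
            (n * Real.exp (-(n * (u - 1 / 2))) +
              n * coefA u * b * Real.exp (-(n * (u - 1 / 2)))) := by
          intro u
          rw [← exp_mul_exp_eq]; ring
        simp_rw [e1]
        rw [intervalIntegral.integral_const_mul, intervalIntegral.integral_add
          (Continuous.intervalIntegrable (by fun_prop) _ _)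
          (Continuous.intervalIntegrable (by fun_prop) _ _), integral_exp_intensity,
          integral_coefA_exp ha.n_ne, ← exp_mul_exp_eq, ← exp_mul_exp_eq]
        -- The terms at `s` give the claimed value. Those at `r` cancel exactly because the price at
        -- `r` is the ask price, from which the untilted regime starts.
        have h2 := ha.switch.2
        linear_combination (-(1 / wealthHalf lam (1 / 2)) * (1 / 2) *
          Real.exp (-((n : ℝ) - 1) * (r - 1 / 2)) * Real.exp (-(r - 1 / 2))) * h2
  mean := by
    have h0 := hl.1
    have m : ∀ v, min (1 / 2) (returnTime r v) = 1 / 2 := fun v =>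
      min_eq_left (ha.returnTime_mem v).1
    have m2 : min (1 / 2) r = 1 / 2 := min_eq_left ha.switch.1.1.le
    have p3 : ¬ ((3 : ℝ) < 1) := by norm_num
    have p2 : (1 : ℝ) / 2 < 1 := by norm_num
    simp only [preDensity, prePrice, m, m2, p3, p2, if_true, if_false, sub_self, mul_zero,
      Real.exp_zero, mul_one, premium_zero, add_zero]
    rw [wealthHalf_up h0, wealthHalf_down h0]
    have : 5 + lam ≠ 0 := by linarith
    field_simp
    ring

end Approx

/-! ### Consistent price systems -/

/-- Change of measure: if `Z⁰` and `Z⁰ T` are martingales, then `T` is a martingale under the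
measure with density process `Z⁰`. -/
lemma martingale_withDensity {Ω : Type*} {m : MeasurableSpace Ω} {P : Measure Ω}
    [IsProbabilityMeasure P] {𝓕 : Filtration unitInterval m} {U V T : unitInterval → Ω → ℝ} {C : ℝ}
    (hU : Martingale U 𝓕 P) (hV : Martingale V 𝓕 P) (hT : StronglyAdapted 𝓕 T)
    (hTC : ∀ t, ∀ᵐ ω ∂P, ‖T t ω‖ ≤ C) (hpos : ∀ᵐ ω ∂P, 0 ≤ U 1 ω)
    (hTV : ∀ t, ∀ᵐ ω ∂P, V t ω = U t ω * T t ω)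
    [IsProbabilityMeasure (P.withDensity fun ω => ENNReal.ofReal (U 1 ω))] :
    Martingale T 𝓕 (P.withDensity fun ω => ENNReal.ofReal (U 1 ω)) := by
  set Q := P.withDensity fun ω => ENNReal.ofReal (U 1 ω) with hQ
  have hQP : Q ≪ P := withDensity_absolutelyContinuous _ _
  have hUm : Measurable fun ω => ENNReal.ofReal (U 1 ω) :=
    ((hU.1 1).mono (𝓕.le 1)).measurable.ennreal_ofReal
  have hTm : ∀ t, AEStronglyMeasurable (T t) P := fun t =>
    ((hT t).mono (𝓕.le t)).aestronglyMeasurable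
  have hTQ : ∀ t, Integrable (T t) Q := fun t =>
    Integrable.of_bound ((hT t).mono (𝓕.le t)).aestronglyMeasurable C (hQP.ae_le (hTC t))
  have hUT : ∀ t, Integrable (fun ω => T t ω * U 1 ω) P := fun t =>
    (hU.integrable 1).bdd_mul (hTm t) (hTC t)
  -- Bayes' rule: the terminal density `U 1` may be replaced by its conditional expectation `U t`,
  -- as `T t` is known at time `t`. The martingale property of `V = U T` then transfers to `T`.
  have key : ∀ t A, MeasurableSet[𝓕 t] A → ∫ ω in A, T t ω ∂Q = ∫ ω in A, V t ω ∂P := by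
    intro t A hA
    have hA' := 𝓕.le t A hA
    rw [hQ, setIntegral_withDensity_eq_setIntegral_toReal_smul hUm
      (ae_of_all _ fun ω => ENNReal.ofReal_lt_top) _ hA']
    have e1 : ∫ ω in A, (ENNReal.ofReal (U 1 ω)).toReal • T t ω ∂P =
        ∫ ω in A, T t ω * U 1 ω ∂P := by
      refine integral_congr_ae (ae_restrict_of_ae ?_)
      filter_upwards [hpos] with ω hω
      rw [ENNReal.toReal_ofReal hω, smul_eq_mul, mul_comm]
    have e2 : P[fun ω => T t ω * U 1 ω | 𝓕 t] =ᵐ[P] fun ω => T t ω * (P[U 1 | 𝓕 t]) ω :=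
      condExp_mul_of_stronglyMeasurable_left (hT t) (hUT t) (hU.integrable 1)
    rw [e1, ← setIntegral_condExp (𝓕.le t) (hUT t) hA]
    refine integral_congr_ae (ae_restrict_of_ae ?_)
    filter_upwards [e2, hU.2 t 1 t.2.2, hTV t] with ω h1 h2 h3
    rw [h1, h2, h3, mul_comm]
  refine ⟨hT, fun s t hst => ?_⟩
  refine (ae_eq_condExp_of_forall_setIntegral_eq (𝓕.le s) (hTQ t)
    (fun A _ _ => (hTQ s).integrableOn) (fun A hA _ => ?_) (hT s).aestronglyMeasurable).symm
  rw [key s A hA, key t A (𝓕.mono hst A hA), hV.setIntegral_eq hst hA]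

section CPS

variable {Ω : Type*} [MeasurableSpace Ω] {P : Measure Ω} [IsProbabilityMeasure P]
  {ε lam b r : ℝ} {n : ℕ} {ξ η θ : Ω → ℝ} {etaT : ℕ → Ω → ℝ} {g : ℝ → ℝ}

lemma jumpPath_mul {c d : ℝ} {K L : ℝ → ℝ → ℝ} {J I : ℝ → ℝ → ℝ → ℝ} {x e s t : ℝ} :
    jumpPath (c * d) (fun x t => K x t * L x t) (fun x e s => J x e s * I x e s) x e s t =
      jumpPath c K J x e s t * jumpPath d L I x e s t := by
  unfold jumpPath; split_ifs <;> rfl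

lemma IsApprox.ae_Z0_eq (h : IsModel P ε ξ η θ) (hl : lam < 1 / 14)
    (ha : IsApprox P η etaT lam n b r g) :
    ∀ᵐ ω ∂P, ∀ t : unitInterval, Z0 P lam ξ η θ etaT n t ω = jumpPath 1 (preDensity lam n r)
      (postDensity P η lam n g r) (ξ ω) (η ω) (jumpTime (θ ω)) t := by
  filter_upwards [h.ae_xi, h.ae_half_lt_jumpTime] with ω hx hs t
  exact Z0_eq ha.n_ne ha.neg ha.eq_b hl ha.switch (ha.factor ω) hx hs t

lemma IsApprox.ae_Z1_eq (h : IsModel P ε ξ η θ) (hl : lam < 1 / 14)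
    (ha : IsApprox P η etaT lam n b r g) :
    ∀ᵐ ω ∂P, ∀ t : unitInterval, Z1 P lam ξ η θ etaT n t ω = jumpPath 1
      (fun x t => preDensity lam n r x t * prePrice lam n b r x t)
      (fun x e s => postDensity P η lam n g r x e s * postPrice lam n r x e s)
      (ξ ω) (η ω) (jumpTime (θ ω)) t := by
  filter_upwards [h.ae_xi, h.ae_half_lt_jumpTime] with ω hx hs t
  exact Z1_eq ha.n_ne ha.neg ha.eq_b hl ha.switch (ha.factor ω) hx hs t

lemma IsApprox.jumpPath_density_pos (hε : ε ∈ Ioo (0 : ℝ) (1 / 3))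
    (hl : lam ∈ Ioo 0 (costBound ε)) (h : IsModel P ε ξ η θ)
    (ha : IsApprox P η etaT lam n b r g) (ht : IsTilting P η etaT) {ω : Ω}
    (hx : ξ ω = 3 ∨ ξ ω = 1 / 2) (s t : ℝ) :
    0 < jumpPath 1 (preDensity lam n r) (postDensity P η lam n g r) (ξ ω) (η ω) s t := by
  have hw := wealthHalf_pos hl.1 hx
  have hn : (0 : ℝ) < n := by exact_mod_cast Nat.pos_of_ne_zero ha.n_ne
  have hg : 0 < g (η ω) := by rw [← ha.factor]; exact ht.pos n ω
  have hj := h.jumpDensity_pos hε hl ha.n_ne (clampTime_mem s) (η ω)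
  unfold jumpPath preDensity postDensity
  split_ifs <;> positivity

/-- The ratio `Z^{1,n} / Z^{0,n}` lies in the bid-ask spread. -/
lemma IsApprox.jumpPath_price_mem (hε : ε ∈ Ioo (0 : ℝ) (1 / 3))
    (hl : lam ∈ Ioo 0 (costBound ε)) (ha : IsApprox P η etaT lam n b r g) {x e s t : ℝ}
    (hx : x = 3 ∨ x = 1 / 2) (he : e ∈ Ioc (0 : ℝ) 2) (hs : 1 / 2 < s) (hs1 : s ≤ 1) :
    jumpPath 1 (prePrice lam n b r) (postPrice lam n r) x e s t ∈
      Icc ((1 - lam) * ask x e s t) (ask x e s t) := by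
  have h0 := hl.1
  have h14 := lam_lt hε hl
  have hx0 : 0 < x := by rcases hx with rfl | rfl <;> norm_num
  rcases lt_or_ge t (1 / 2) with ht | ht
  · have h1 : ask x e s t = 1 := by
      simp only [ask, not_le.2 ht, not_le.2 (ht.trans hs), if_false]; ring
    rw [jumpPath_early ht, h1]
    constructor <;> linarith
  · rcases lt_or_ge t s with hts | hts
    · have h1 : ask x e s t = x := by
        simp only [ask, ht, not_le.2 hts, if_false, if_true]; ring
      rw [jumpPath_mid ht hts, h1]
      unfold prePrice
      split_ifs with hx1
      · have hm := (strictMono_premium (n := n) ha.neg).monotone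
        have p1 := hm (show (0 : ℝ) ≤ min t r - 1 / 2 by
          linarith [le_min ht ha.switch.1.1.le])
        have p2 := hm (show min t r - 1 / 2 ≤ r - 1 / 2 by linarith [min_le_right t r])
        rw [premium_zero] at p1
        have h2 := ha.switch.2
        have h3 : 0 ≤ (1 - lam) * x := mul_nonneg (by linarith) hx0.le
        constructor
        · nlinarith
        · have h4 : (1 - lam) * x * (1 + premium n b (min t r - 1 / 2)) ≤
              (1 - lam) * x * (1 + premium n b (r - 1 / 2)) :=
            mul_le_mul_of_nonneg_left (by linarith) h3
          have h5 : (1 - lam) * x * (1 + premium n b (r - 1 / 2)) = x := by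
            linear_combination x * h2
          linarith
      · constructor
        · nlinarith
        · exact le_rfl
    · have h1 : ask x e s t = x * (1 + coefA s * (e - 1)) := by
        simp only [ask, ht, hts, if_true]; ring
      have hA := coefA_mem ⟨hs.le, hs1⟩
      have hS : 0 ≤ 1 + coefA s * (e - 1) := by nlinarith [hA.1, hA.2, he.1, he.2]
      rw [jumpPath_late ht hts, h1]
      unfold postPrice
      rw [clampTime_of_mem ⟨hs.le, hs1⟩]
      have hxS : 0 ≤ x * (1 + coefA s * (e - 1)) := mul_nonneg hx0.le hS
      split_ifs
      · constructor <;> nlinarith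
      · have hn : (0 : ℝ) < n := by exact_mod_cast Nat.pos_of_ne_zero ha.n_ne
        have htr : e ≤ truncEta n e := le_max_left _ _
        have hA0 : 0 ≤ coefA s := by linarith [hA.1]
        have hmul := mul_le_mul_of_nonneg_left htr hA0
        have hup : (1 - lam) * (1 + coefA s * (truncEta n e - 1)) ≤ 1 + coefA s * (e - 1) := by
          rcases le_total (1 / (n : ℝ)) e with hc | hc
          · have : truncEta n e = e := max_eq_left hc
            rw [this]; nlinarith
          · have hte : truncEta n e = 1 / n := max_eq_right hc
            rw [hte]
            -- When truncation acts, staying below the ask reduces to `(1 - lam) a / n ≤ lam (1 -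
            -- a)`. This holds since `a ≤ 1/3` gives `a / n ≤ 2 lam / 3 ≤ lam (1 - a)`, which is the
            -- reason for `1 ≤ 2 * lam * n` in `IsApprox`.
            have hinv : 1 / (n : ℝ) ≤ 2 * lam := by
              rw [div_le_iff₀ hn]; exact ha.large
            have hinv0 : 0 < 1 / (n : ℝ) := by positivity
            have q1 : coefA s * (1 / (n : ℝ)) ≤ 1 / 3 * (2 * lam) :=
              mul_le_mul hA.2 hinv hinv0.le (by norm_num)
            have q2 : 0 ≤ lam * (coefA s * (1 / (n : ℝ))) := by positivity
            have q3 : 0 ≤ coefA s * e := mul_nonneg hA0 he.1.le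
            have q4 : lam * coefA s ≤ lam * (1 / 3) := mul_le_mul_of_nonneg_left hA.2 h0.le
            nlinarith
        constructor
        · have : (1 - lam) * (1 + coefA s * (e - 1)) ≤
              (1 - lam) * (1 + coefA s * (truncEta n e - 1)) :=
            mul_le_mul_of_nonneg_left (by linarith) (by linarith)
          nlinarith
        · nlinarith

lemma ask_le {x e s t : ℝ} (hx : x = 3 ∨ x = 1 / 2) (he : e ∈ Ioc (0 : ℝ) 2) (hs : 1 / 2 < s)
    (hs1 : s ≤ 1) : 0 ≤ ask x e s t ∧ ask x e s t ≤ 4 := by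
  have hA := coefA_mem ⟨hs.le, hs1⟩
  have h1 : 0 ≤ 1 + (x - 1) * (if 1 / 2 ≤ t then (1 : ℝ) else 0) ∧
      1 + (x - 1) * (if 1 / 2 ≤ t then (1 : ℝ) else 0) ≤ 3 := by
    rcases hx with rfl | rfl <;> split_ifs <;> norm_num
  have h2 : 0 ≤ 1 + coefA s * (e - 1) * (if s ≤ t then (1 : ℝ) else 0) ∧
      1 + coefA s * (e - 1) * (if s ≤ t then (1 : ℝ) else 0) ≤ 4 / 3 := by
    split_ifs
    · constructor <;> nlinarith [hA.1, hA.2, he.1, he.2]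
    · norm_num
  unfold ask
  constructor
  · exact mul_nonneg h1.1 h2.1
  · nlinarith [mul_le_mul h1.2 h2.2 h2.1 (by norm_num)]

variable [P.IsComplete]

/-- The measure has terminal density `Z0` at time `1`. The quotient `Z1 / Z0` is bounded by `4`, the
maximal ask price, so it is a genuine martingale and no localisation is needed. -/
theorem IsApprox.isConsistentPriceSystem (hε : ε ∈ Ioo (0 : ℝ) (1 / 3))
    (hl : lam ∈ Ioo 0 (costBound ε)) (h : IsModel P ε ξ η θ)
    (ha : IsApprox P η etaT lam n b r g) (ht : IsTilting P η etaT) :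
    IsCadlagMartingale (Z0 P lam ξ η θ etaT n) (marketFiltration P h) P ∧
    IsCadlagMartingale (Z1 P lam ξ η θ etaT n) (marketFiltration P h) P ∧
    IsConsistentPriceSystem P (marketFiltration P h) lam (askProcess ξ η θ)
      (Z0 P lam ξ η θ etaT n) (Z1 P lam ξ η θ etaT n) := by
  have h14 := lam_lt hε hl
  have e0 := ha.ae_Z0_eq h h14
  have e1 := ha.ae_Z1_eq h h14
  have hM0 := (ha.isMartingaleData_density hε hl h ht).isCadlagMartingale h e0
  have hM1 := (ha.isMartingaleData_price hε hl h ht).isCadlagMartingale h e1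
  refine ⟨hM0, hM1, ?_⟩
  set U := Z0 P lam ξ η θ etaT n with hU
  set V := Z1 P lam ξ η θ etaT n with hV
  set T : unitInterval → Ω → ℝ := fun t ω => V t ω / U t ω with hT
  have hpos : ∀ᵐ ω ∂P, ∀ t, 0 < U t ω := by
    filter_upwards [e0, h.ae_xi] with ω hω hx t
    rw [hω t]
    exact ha.jumpPath_density_pos hε hl h ht hx _ _
  have hTeq : ∀ᵐ ω ∂P, ∀ t : unitInterval, T t ω =
      jumpPath 1 (prePrice lam n b r) (postPrice lam n r) (ξ ω) (η ω) (jumpTime (θ ω)) t := by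
    filter_upwards [e0, e1, hpos] with ω h0 h1 hp t
    have hp' := hp t
    rw [hT]
    simp only
    rw [div_eq_iff hp'.ne', h0 t, h1 t, mul_comm, ← jumpPath_mul, one_mul]
  have hVU : ∀ᵐ ω ∂P, ∀ t, V t ω = U t ω * T t ω := by
    filter_upwards [hpos] with ω hp t
    rw [hT]
    simp only
    rw [mul_div_cancel₀ _ (hp t).ne']
  have hspread : ∀ᵐ ω ∂P, ∀ t, T t ω ∈ Icc ((1 - lam) * askProcess ξ η θ t ω)
      (askProcess ξ η θ t ω) := by
    filter_upwards [hTeq, h.ae_xi, h.ae_half_lt_jumpTime, h.ae_eta_mem hε] with ω hω hx hs he t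
    rw [hω t]
    exact ha.jumpPath_price_mem hε hl hx he hs (jumpTime_le_one _)
  have hbound : ∀ᵐ ω ∂P, ∀ t, ‖T t ω‖ ≤ 4 := by
    filter_upwards [hspread, h.ae_xi, h.ae_half_lt_jumpTime, h.ae_eta_mem hε] with ω hω hx hs he t
    obtain ⟨a1, a2⟩ := ask_le (t := t) hx he hs (jumpTime_le_one _)
    have a3 := (hω t).1
    have a4 := (hω t).2
    have a5 : 0 ≤ (1 - lam) * askProcess ξ η θ t ω := mul_nonneg (by linarith) a1
    have a6 : askProcess ξ η θ t ω ≤ 4 := a2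
    rw [Real.norm_eq_abs, abs_le]
    constructor <;> linarith
  have hUint := hM0.1.integrable
  have hUone : ∫ ω, U 1 ω ∂P = 1 := by
    have h1 := hM0.1.setIntegral_eq (i := 0) (j := 1) zero_le_one MeasurableSet.univ
    rw [setIntegral_univ, setIntegral_univ] at h1
    rw [← h1]
    have : ∀ᵐ ω ∂P, U 0 ω = 1 := by
      filter_upwards [e0] with ω hω
      rw [hω 0, jumpPath_early]; simp
    rw [integral_congr_ae this]; simp
  have hpos1 : ∀ᵐ ω ∂P, 0 ≤ U 1 ω := hpos.mono fun ω hω => (hω 1).le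
  have hQprob : IsProbabilityMeasure (P.withDensity fun ω => ENNReal.ofReal (U 1 ω)) := by
    refine ⟨?_⟩
    rw [withDensity_apply _ MeasurableSet.univ, Measure.restrict_univ,
      ← ofReal_integral_eq_lintegral_ofReal (hUint 1) hpos1, hUone, ENNReal.ofReal_one]
  have hUm : Measurable fun ω => ENNReal.ofReal (U 1 ω) :=
    ((hM0.1.1 1).mono ((marketFiltration P h).le 1)).measurable.ennreal_ofReal
  have hQP : (P.withDensity fun ω => ENNReal.ofReal (U 1 ω)) ≪ P :=
    withDensity_absolutelyContinuous _ _
  refine ⟨P.withDensity fun ω => ENNReal.ofReal (U 1 ω), T, hQprob, hQP, ?_, ?_, ?_, hspread, hVU⟩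
  · refine withDensity_absolutelyContinuous' hUm.aemeasurable ?_
    filter_upwards [hpos] with ω hω
    exact (ENNReal.ofReal_pos.2 (hω 1)).ne'
  · refine ⟨hM0.1.1, hM0.2, hUint, fun t A hA => ?_⟩
    have hA' := (marketFiltration P h).le t A hA
    rw [measureReal_def, withDensity_apply _ hA',
      ← ofReal_integral_eq_lintegral_ofReal (hUint 1).integrableOn (ae_restrict_of_ae hpos1),
      ENNReal.toReal_ofReal (integral_nonneg_of_ae (ae_restrict_of_ae hpos1)),
      hM0.1.setIntegral_eq (j := 1) t.2.2 hA]
  · refine Locally.of_prop ⟨martingale_withDensity (C := 4) hM0.1 hM1.1 (fun t => ?_)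
      (fun t => hbound.mono fun ω hω => hω t) hpos1 (fun t => hVU.mono fun ω hω => hω t), ?_⟩
    · exact ((hM1.1.1 t).measurable.div (hM0.1.1 t).measurable).stronglyMeasurable
    · refine hQP.ae_le ?_
      filter_upwards [hTeq, h.ae_half_lt_jumpTime] with ω hω hs
      have : (fun t => T t ω) = fun t : unitInterval =>
        jumpPath 1 (prePrice lam n b r) (postPrice lam n r) (ξ ω) (η ω) (jumpTime (θ ω)) t :=
        funext hω
      rw [this]
      exact isCadlagPath_jumpPath (continuous_prePrice lam n b r _) hs

end CPS

/-! ### Convergence to the dual optimiser -/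

/-- On the down branch the holdings are revalued from bid to ask; `a_{1/2} = 1/3` produces the
factor `1 + 3 lam / (1 - lam)`, the same number that `tendsto_exp_switchTime` produces from the
switching time. -/
lemma wealthPlus_eq {lam x : ℝ} (hl : lam < 1 / 14) (hx : x = 3 ∨ x = 1 / 2) :
    wealthPlus lam x = wealthHalf lam x * (if 1 < x then 1 else 1 + 3 * lam / (1 - lam)) := by
  have : 1 - lam ≠ 0 := by linarith
  unfold wealthPlus
  rcases hx with rfl | rfl
  · rw [if_pos (by norm_num), if_pos (by norm_num)]; ring
  · rw [if_neg (by norm_num), if_neg (by norm_num), holdPlus, if_neg (by norm_num), coefA]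
    field_simp
    ring

/-- The two branches defining `holdPlus` become one formula when expressed through the wealth after
time `1/2`. -/
lemma holdPlus_eq {lam x : ℝ} (h0 : 0 < lam) (hl : lam < 1 / 14) (hx : x = 3 ∨ x = 1 / 2) :
    holdPlus lam x = wealthPlus lam x / x * (1 / (lam + (1 - lam) * coefA (1 / 2))) := by
  have h1 : 1 - lam ≠ 0 := by linarith
  rw [wealthPlus_eq hl hx]
  unfold holdPlus coefA
  rcases hx with rfl | rfl
  · rw [if_pos (by norm_num), if_pos (by norm_num)]; ring
  · rw [if_neg (by norm_num), if_neg (by norm_num)]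
    have h2 : lam + (1 - lam) * (1 / 3 - 1 / 3 * (1 / 2 - 1 / 2)) = (1 + 2 * lam) / 3 := by ring
    have h3 : 1 + 3 * lam / (1 - lam) = (1 + 2 * lam) / (1 - lam) := by field_simp; ring
    have h4 : 1 + 2 * lam ≠ 0 := by intro h; linarith
    rw [h2, h3]
    field_simp
    norm_num [mul_comm]

/-- Since `a' = -1/3`, the integrand is the derivative of a multiple of `1 / (lam + (1 - lam) a_u)`,
and the initial value `holdPlus` is the same expression at `1/2`. -/
lemma hold_eq {lam x s : ℝ} (h0 : 0 < lam) (hl : lam < 1 / 14) (hx : x = 3 ∨ x = 1 / 2)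
    (hs : 1 / 2 < s) (hs1 : s ≤ 1) :
    hold lam x s s = wealthPlus lam x / x * (1 / (lam + (1 - lam) * coefA s)) := by
  rw [hold, if_neg (by linarith), if_neg (not_le.2 hs), min_self]
  have hpos : ∀ u ∈ uIcc (1 / 2 : ℝ) s, lam + (1 - lam) * coefA u ≠ 0 := by
    intro u hu
    rw [uIcc_of_le hs.le] at hu
    have := (coefA_mem ⟨hu.1, hu.2.trans hs1⟩).1
    nlinarith
  have hd : ∀ u ∈ uIcc (1 / 2 : ℝ) s,
      HasDerivAt (fun u => wealthPlus lam x / x * (1 / (lam + (1 - lam) * coefA u)))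
      (wealthPlus lam x / x * ((1 - lam) / (lam + (1 - lam) * coefA u) ^ 2) * (1 / 3)) u := by
    intro u hu
    have h1 : HasDerivAt coefA (-(1 / 3 * 1)) u := by
      unfold coefA
      exact (((hasDerivAt_id u).sub_const _).const_mul _).const_sub _
    have h2 := (((h1.const_mul (1 - lam)).const_add lam).fun_inv (hpos u hu)).const_mul
      (wealthPlus lam x / x)
    simp only [one_div]
    refine h2.congr_deriv ?_
    ring
  have hc := continuous_coefA
  rw [intervalIntegral.integral_eq_sub_of_hasDerivAt hd, holdPlus_eq h0 hl hx]
  · ring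
  · refine ContinuousOn.intervalIntegrable ?_
    refine ContinuousOn.mul (ContinuousOn.mul continuousOn_const ?_) continuousOn_const
    exact ContinuousOn.div continuousOn_const (by fun_prop) fun u hu => pow_ne_zero 2 (hpos u hu)

/-- After the jump, the optimal wealth is that of the limiting strategy `ℓ = 1/c`, so its reciprocal
is the limit of the jump densities times that of the densities before the jump. -/
lemma wealth_late {lam x e s t : ℝ} (h0 : 0 < lam) (hl : lam < 1 / 14) (hx : x = 3 ∨ x = 1 / 2)
    (hs : 1 / 2 < s) (hs1 : s ≤ 1) (hst : s ≤ t) :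
    wealth lam x e s t =
      wealthPlus lam x * (1 + 1 / (lam + (1 - lam) * coefA s) * oneReturn lam s e) := by
  have ht := hs.trans_le hst
  have hx0 : x ≠ 0 := by rcases hx with rfl | rfl <;> norm_num
  rw [wealth, if_neg (not_lt.2 ht.le), if_neg ht.ne', if_neg (not_lt.2 hst),
    hold_eq h0 hl hx hs hs1, ask_self hs.le, oneReturn]
  field_simp

lemma wealth_mid {lam x e s t : ℝ} (h1 : 1 / 2 < t) (h2 : t < s) :
    wealth lam x e s t = wealthPlus lam x := by
  rw [wealth, if_neg (not_lt.2 h1.le), if_neg h1.ne', if_pos h2]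

lemma shadow_mid {lam x e s t : ℝ} (h1 : 1 / 2 < t) (h2 : t < s) :
    shadow lam x e s t = x := by
  rw [shadow, if_neg (not_lt.2 h1.le), if_neg h1.ne', if_pos h2]

lemma shadow_late {lam x e s t : ℝ} (hs : 1 / 2 < s) (hst : s ≤ t) :
    shadow lam x e s t = (1 - lam) * x * (1 + coefA s * (e - 1)) := by
  have ht := hs.trans_le hst
  rw [shadow, if_neg (not_lt.2 ht.le), if_neg ht.ne', if_neg (not_lt.2 hst), ask_self hs.le]
  ring

section Switch

variable {lam : ℝ} {b r : ℕ → ℝ}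

lemma tendsto_switchTime (hl : lam < 1 / 14) (hb : Tendsto b atTop (𝓝 (-1)))
    (hr : ∀ᶠ n in atTop, IsSwitchTime lam n (b n) (r n)) :
    Tendsto r atTop (𝓝 (1 / 2)) := by
  have hbig : Tendsto (fun n : ℕ => 1 / 2 + 12 * (lam / (1 - lam)) * (1 / (n : ℝ))) atTop
      (𝓝 (1 / 2 + 12 * (lam / (1 - lam)) * 0)) :=
    (tendsto_one_div_atTop_nhds_zero_nat.const_mul _).const_add _
  rw [mul_zero, add_zero] at hbig
  refine tendsto_of_tendsto_of_tendsto_of_le_of_le' tendsto_const_nhds hbig ?_ ?_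
  · filter_upwards [hr] with n hn using hn.1.1.le
  · filter_upwards [hr, hb.eventually (gt_mem_nhds (show (-1 : ℝ) < -1 / 2 by norm_num)),
      eventually_ge_atTop 2] with n hn hbn hn2
    have hn2' : (2 : ℝ) ≤ n := by exact_mod_cast hn2
    have hp := hn.premium_eq hl
    have hy := hn.1.1
    set y := r n - 1 / 2 with hy_def
    have hy0 : 0 < y := by linarith
    have e1 : (n : ℝ) * y ≤ Real.exp (n * y) - 1 := by
      have := Real.add_one_le_exp ((n : ℝ) * y); linarith
    have e2 : 1 / (n : ℝ) ≤ 1 / 2 := one_div_le_one_div_of_le (by norm_num) hn2'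
    have e3 : (n : ℝ) * y * (1 / 2) ≤ (Real.exp (n * y) - 1) * (1 - 1 / (n : ℝ)) :=
      mul_le_mul e1 (by linarith) (by norm_num) (le_trans (by positivity) e1)
    -- From `-b/3 ≥ 1/6` and `1 - 1/n ≥ 1/2` the premium is at least `n y / 12`. As it equals `lam /
    -- (1 - lam)`, this bounds `y` by a constant over `n`.
    have e4 : 1 / 6 * ((n : ℝ) * y * (1 / 2)) ≤ premium n (b n) y := by
      unfold premium
      refine mul_le_mul (by linarith) (by linarith) (by positivity) (by linarith)
    rw [hp] at e4
    have e5 : y ≤ 12 * (lam / (1 - lam)) * (1 / (n : ℝ)) := by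
      rw [mul_one_div, le_div_iff₀ (by linarith)]
      linarith
    linarith

/-- With `y = r n - 1/2`, the equation for the premium can be solved for `e^{n y}` in terms of `y`,
`b n` and `1/n`, all of which converge. Then `e^{-(n-1) y} = e^y / e^{n y}` and `y → 0`. -/
lemma tendsto_exp_switchTime (h0 : 0 < lam) (hl : lam < 1 / 14) (hb : Tendsto b atTop (𝓝 (-1)))
    (hr : ∀ᶠ n in atTop, IsSwitchTime lam n (b n) (r n)) :
    Tendsto (fun n : ℕ => Real.exp (-((n : ℝ) - 1) * (r n - 1 / 2))) atTop
      (𝓝 (1 / (1 + 3 * lam / (1 - lam)))) := by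
  have hr0 := (tendsto_switchTime hl hb hr).sub_const (1 / 2)
  rw [sub_self] at hr0
  have hinv := tendsto_one_div_atTop_nhds_zero_nat (𝕜 := ℝ)
  have hE : Tendsto (fun n : ℕ => 1 + (lam / (1 - lam) / (-(b n) / 3) - (r n - 1 / 2)) /
      (1 - 1 / (n : ℝ))) atTop (𝓝 (1 + (lam / (1 - lam) / (-(-1) / 3) - 0) / (1 - 0))) := by
    refine (((tendsto_const_nhds.div (hb.neg.div_const 3) (by norm_num)).sub hr0).div
      (hinv.const_sub 1) (by norm_num)).const_add 1
  have hlim : 1 + (lam / (1 - lam) / (-(-1) / 3) - 0) / (1 - 0) = 1 + 3 * lam / (1 - lam) := by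
    field_simp
    ring
  rw [hlim] at hE
  have hpos : 0 < 1 + 3 * lam / (1 - lam) := by
    have : 0 < 1 - lam := by linarith
    positivity
  have hfin : Tendsto (fun n : ℕ => Real.exp (r n - 1 / 2) /
      (1 + (lam / (1 - lam) / (-(b n) / 3) - (r n - 1 / 2)) / (1 - 1 / (n : ℝ)))) atTop
      (𝓝 (Real.exp 0 / (1 + 3 * lam / (1 - lam)))) :=
    ((Real.continuous_exp.tendsto 0).comp hr0).div hE hpos.ne'
  rw [Real.exp_zero] at hfin
  refine hfin.congr' ?_
  filter_upwards [hr, hb.eventually (gt_mem_nhds (show (-1 : ℝ) < -1 / 2 by norm_num)),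
    eventually_ge_atTop 2] with n hn hbn hn2
  have hn2' : (2 : ℝ) ≤ n := by exact_mod_cast hn2
  have hp := hn.premium_eq hl
  have e2 : 1 / (n : ℝ) ≤ 1 / 2 := one_div_le_one_div_of_le (by norm_num) hn2'
  have e3 : 1 - 1 / (n : ℝ) ≠ 0 := by intro h; linarith
  have e4 : -(b n) / 3 ≠ 0 := by intro h; linarith
  have hEn : 1 + (lam / (1 - lam) / (-(b n) / 3) - (r n - 1 / 2)) / (1 - 1 / (n : ℝ)) =
      Real.exp (n * (r n - 1 / 2)) := by
    rw [← hp, premium, mul_div_cancel_left₀ _ e4, add_sub_cancel_right, mul_div_cancel_right₀ _ e3]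
    ring
  rw [hEn, ← Real.exp_sub]
  congr 1
  ring

lemma tendsto_returnTime (hl : lam < 1 / 14) (hb : Tendsto b atTop (𝓝 (-1)))
    (hr : ∀ᶠ n in atTop, IsSwitchTime lam n (b n) (r n)) (x : ℝ) :
    Tendsto (fun n => returnTime (r n) x) atTop (𝓝 (1 / 2)) := by
  unfold returnTime
  split_ifs
  · exact tendsto_switchTime hl hb hr
  · exact tendsto_const_nhds

lemma tendsto_density_return (h0 : 0 < lam) (hl : lam < 1 / 14)
    (hb : Tendsto b atTop (𝓝 (-1)))
    (hr : ∀ᶠ n in atTop, IsSwitchTime lam n (b n) (r n)) {x : ℝ} (hx : x = 3 ∨ x = 1 / 2) :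
    Tendsto (fun n : ℕ => 1 / wealthHalf lam x *
      Real.exp (-((n : ℝ) - 1) * (returnTime (r n) x - 1 / 2))) atTop
      (𝓝 (1 / wealthPlus lam x)) := by
  rw [wealthPlus_eq hl hx, ← one_div_mul_one_div]
  refine Tendsto.const_mul _ ?_
  unfold returnTime
  rcases hx with rfl | rfl
  · simp only [show ¬ ((3 : ℝ) < 1) by norm_num, show (1 : ℝ) < 3 by norm_num, if_true, if_false,
      sub_self, mul_zero, Real.exp_zero, div_one]
    exact tendsto_const_nhds
  · simp only [show (1 : ℝ) / 2 < 1 by norm_num, show ¬ ((1 : ℝ) < 1 / 2) by norm_num, if_true,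
      if_false]
    exact tendsto_exp_switchTime h0 hl hb hr

end Switch

section Convergence

variable {Ω : Type*} [MeasurableSpace Ω] {P : Measure Ω} [IsProbabilityMeasure P]
  {ε lam : ℝ} {b r : ℕ → ℝ} {ξ η θ : Ω → ℝ} {etaT : ℕ → Ω → ℝ} {g : ℕ → ℝ → ℝ}

/-- At a fixed time after `1/2`, before or after the jump, the return time has eventually passed, so
only the final regime of the approximation matters. At `1/2` itself the value is constant in `n`:
this is how the limit loses right continuity. -/
lemma tendsto_jumpPath_density (hε : ε ∈ Ioo (0 : ℝ) (1 / 3)) (hl : lam ∈ Ioo 0 (costBound ε))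
    (h : IsModel P ε ξ η θ) (hb : Tendsto b atTop (𝓝 (-1)))
    (ha : ∀ᶠ n in atTop, IsApprox P η etaT lam n (b n) (r n) (g n)) {x e s t : ℝ}
    (hx : x = 3 ∨ x = 1 / 2) (he : 0 < e) (hs : 1 / 2 < s) (hs1 : s ≤ 1) :
    Tendsto (fun n => jumpPath 1 (preDensity lam n (r n)) (postDensity P η lam n (g n) (r n))
      x e s t) atTop (𝓝 (dualY0 lam x e s t)) := by
  have h14 := lam_lt hε hl
  have hr : ∀ᶠ n in atTop, IsSwitchTime lam n (b n) (r n) := ha.mono fun n hn => hn.switch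
  have hret := tendsto_returnTime h14 hb hr x
  have hden := tendsto_density_return hl.1 h14 hb hr hx
  rcases lt_trichotomy t (1 / 2) with ht | ht | ht
  · simp only [jumpPath_early ht, dualY0, wealth, if_pos ht, div_one]
    exact tendsto_const_nhds
  · subst ht
    simp only [jumpPath_mid le_rfl hs, dualY0, wealth, lt_irrefl, if_false, if_true]
    refine tendsto_const_nhds.congr' ?_
    filter_upwards [ha] with n hn
    rw [preDensity, min_eq_left (hn.returnTime_mem x).1]
    simp
  · rcases lt_or_ge t s with hts | hts
    · simp only [jumpPath_mid ht.le hts, dualY0, wealth_mid ht hts]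
      refine hden.congr' ?_
      filter_upwards [hret.eventually (gt_mem_nhds ht)] with n hn
      rw [preDensity, min_eq_right hn.le]
    · simp only [jumpPath_late ht.le hts, dualY0, wealth_late hl.1 h14 hx hs hs1 hts]
      rw [← one_div_mul_one_div]
      refine (hden.mul (h.tendsto_jumpDensity hε hl ⟨hs.le, hs1⟩ he)).congr' ?_
      filter_upwards [hret.eventually (gt_mem_nhds hs)] with n hn
      rw [postDensity, if_neg (not_le.2 hn), clampTime_of_mem ⟨hs.le, hs1⟩]

lemma tendsto_jumpPath_price (hε : ε ∈ Ioo (0 : ℝ) (1 / 3)) (hl : lam ∈ Ioo 0 (costBound ε))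
    (hb : Tendsto b atTop (𝓝 (-1)))
    (ha : ∀ᶠ n in atTop, IsApprox P η etaT lam n (b n) (r n) (g n)) {x e s t : ℝ}
    (hx : x = 3 ∨ x = 1 / 2) (he : 0 < e) (hs : 1 / 2 < s) (hs1 : s ≤ 1) :
    Tendsto (fun n => jumpPath 1 (prePrice lam n (b n) (r n)) (postPrice lam n (r n))
      x e s t) atTop (𝓝 (shadow lam x e s t)) := by
  have h14 := lam_lt hε hl
  have hr : ∀ᶠ n in atTop, IsSwitchTime lam n (b n) (r n) := ha.mono fun n hn => hn.switch
  have hret := tendsto_returnTime h14 hb hr x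
  rcases lt_trichotomy t (1 / 2) with ht | ht | ht
  · simp only [jumpPath_early ht, shadow, if_pos ht]
    exact tendsto_const_nhds
  · subst ht
    simp only [jumpPath_mid le_rfl hs, shadow, lt_irrefl, if_false, if_true]
    refine tendsto_const_nhds.congr' ?_
    filter_upwards [ha] with n hn
    unfold prePrice
    rw [min_eq_left hn.switch.1.1.le, sub_self, premium_zero]
    rcases hx with rfl | rfl <;> norm_num
  · rcases lt_or_ge t s with hts | hts
    · simp only [jumpPath_mid ht.le hts, shadow_mid ht hts]
      refine tendsto_const_nhds.congr' ?_
      filter_upwards [hret.eventually (gt_mem_nhds ht), ha] with n hn han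
      exact (han.prePrice_of_ge hn.le).symm
    · simp only [jumpPath_late ht.le hts, shadow_late hs hts]
      refine tendsto_const_nhds.congr' ?_
      filter_upwards [hret.eventually (gt_mem_nhds hs),
        tendsto_one_div_atTop_nhds_zero_nat.eventually (gt_mem_nhds he)] with n hn hn2
      have : truncEta n e = e := max_eq_left hn2.le
      rw [postPrice, if_neg (not_le.2 hn), clampTime_of_mem ⟨hs.le, hs1⟩, this]

end Convergence

/-! ### Convergence in probability at stopping times -/

section StoppingTimes

variable {Ω : Type*} [MeasurableSpace Ω] {P : Measure Ω} [IsProbabilityMeasure P]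
  {ε lam : ℝ} {b r : ℕ → ℝ} {ξ η θ : Ω → ℝ} {etaT : ℕ → Ω → ℝ} {g : ℕ → ℝ → ℝ}

lemma IsTilting.exists_isApprox (hε : ε ∈ Ioo (0 : ℝ) (1 / 3)) (hl : lam ∈ Ioo 0 (costBound ε))
    (ht : IsTilting P η etaT) : ∃ (r : ℕ → ℝ) (g : ℕ → ℝ → ℝ), ∀ᶠ n in atTop,
      IsApprox P η etaT lam n (∫ ω, etaT n ω * (η ω - 1) ∂P) (r n) (g n) := by
  have hg : ∀ n, ∃ g : ℝ → ℝ, Measurable g ∧ etaT n = g ∘ η := fun n =>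
    (ht.measurable n).exists_eq_measurable_comp
  choose g hgm hgf using hg
  -- Switching times exist only for large `n`; the choice is arbitrary for the others.
  refine ⟨fun n => Classical.epsilon (IsSwitchTime lam n (∫ ω, etaT n ω * (η ω - 1) ∂P)), g, ?_⟩
  have hlarge : Tendsto (fun n : ℕ => 2 * lam * (n : ℝ)) atTop atTop :=
    tendsto_natCast_atTop_atTop.const_mul_atTop (by linarith [hl.1])
  filter_upwards [eventually_ge_atTop 2, hlarge.eventually_ge_atTop 1,
    ht.tendsto.eventually (gt_mem_nhds (show (-1 : ℝ) < -1 / 2 by norm_num))] with n h2 hn hb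
  exact ⟨by omega, hn, by linarith, rfl,
    Classical.epsilon_spec (exists_isSwitchTime hl.1 (lam_lt hε hl) h2 hb.le), hgm n,
    fun ω => congrFun (hgf n) ω⟩

lemma dualY1_eq (lam x e s t : ℝ) :
    dualY1 lam x e s t = dualY0 lam x e s t * shadow lam x e s t := by
  rw [dualY1, dualY0]; ring

lemma ae_tendsto_Z (hε : ε ∈ Ioo (0 : ℝ) (1 / 3)) (hl : lam ∈ Ioo 0 (costBound ε))
    (h : IsModel P ε ξ η θ) (hb : Tendsto b atTop (𝓝 (-1)))
    (ha : ∀ᶠ n in atTop, IsApprox P η etaT lam n (b n) (r n) (g n)) :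
    ∀ᵐ ω ∂P, ∀ t : unitInterval,
      Tendsto (fun n => Z0 P lam ξ η θ etaT n t ω) atTop (𝓝 (Y0 lam ξ η θ t ω)) ∧
      Tendsto (fun n => Z1 P lam ξ η θ etaT n t ω) atTop (𝓝 (Y1 lam ξ η θ t ω)) := by
  have h14 := lam_lt hε hl
  filter_upwards [h.ae_xi, h.ae_half_lt_jumpTime, h.ae_eta_mem hε] with ω hx hs he t
  have hs1 := jumpTime_le_one (θ ω)
  have h0 := tendsto_jumpPath_density (t := t) hε hl h hb ha hx he.1 hs hs1
  have h1 := tendsto_jumpPath_price (t := t) hε hl hb ha hx he.1 hs hs1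
  constructor
  · refine h0.congr' ?_
    filter_upwards [ha] with n hn
    exact (Z0_eq hn.n_ne hn.neg hn.eq_b h14 hn.switch (hn.factor ω) hx hs t).symm
  · rw [Y1, dualY1_eq]
    refine (h0.mul h1).congr' ?_
    filter_upwards [ha] with n hn
    rw [Z1_eq hn.n_ne hn.neg hn.eq_b h14 hn.switch (hn.factor ω) hx hs t, ← jumpPath_mul, one_mul]

lemma measurable_jumpPath_comp {c : ℝ} {K : ℝ → ℝ → ℝ} {J : ℝ → ℝ → ℝ → ℝ}
    (hK : Measurable fun z : ℝ × ℝ => K z.1 z.2)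
    (hJ : Measurable fun z : ℝ × ℝ × ℝ => J z.1 z.2.1 z.2.2) {x e s t : Ω → ℝ}
    (hx : Measurable x) (he : Measurable e) (hs : Measurable s) (ht : Measurable t) :
    Measurable fun ω => jumpPath c K J (x ω) (e ω) (s ω) (t ω) := by
  unfold jumpPath
  exact Measurable.ite (measurableSet_lt ht measurable_const) measurable_const
    (Measurable.ite (measurableSet_lt ht hs) (hK.comp (hx.prodMk ht))
      (hJ.comp (hx.prodMk (he.prodMk hs))))

lemma measurable_of_isStoppingTime {𝓕 : Filtration unitInterval ‹MeasurableSpace Ω›}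
    {τ : Ω → unitInterval} (hτ : IsStoppingTime 𝓕 fun ω => (τ ω : WithTop unitInterval)) :
    Measurable τ := by
  refine measurable_of_Iic fun t => ?_
  have := 𝓕.le t _ (hτ t)
  simp only [WithTop.coe_le_coe] at this
  exact this

/-- Almost surely the convergence holds at all times simultaneously, hence at any measurable random
time. The index is shifted by `N` because measurability of the approximations comes from their
closed forms, available only for large `n`. -/
theorem tendstoInMeasure_Z (hε : ε ∈ Ioo (0 : ℝ) (1 / 3)) (hl : lam ∈ Ioo 0 (costBound ε))
    (h : IsModel P ε ξ η θ) (hb : Tendsto b atTop (𝓝 (-1)))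
    (ha : ∀ᶠ n in atTop, IsApprox P η etaT lam n (b n) (r n) (g n)) {τ : Ω → unitInterval}
    (hτ : Measurable τ) :
    TendstoInMeasure P
      (fun n ω => (Z0 P lam ξ η θ etaT n (τ ω) ω, Z1 P lam ξ η θ etaT n (τ ω) ω)) atTop
      (fun ω => (Y0 lam ξ η θ (τ ω) ω, Y1 lam ξ η θ (τ ω) ω)) := by
  have h14 := lam_lt hε hl
  obtain ⟨N, hN⟩ := eventually_atTop.1 ha
  have hσ : Measurable fun ω => jumpTime (θ ω) := measurable_jumpTime.comp h.measurable_theta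
  have hτ' : Measurable fun ω => (τ ω : ℝ) := measurable_subtype_coe.comp hτ
  have hmeas : ∀ n, AEStronglyMeasurable (fun ω => (Z0 P lam ξ η θ etaT (n + N) (τ ω) ω,
      Z1 P lam ξ η θ etaT (n + N) (τ ω) ω)) P := by
    intro n
    have hn := hN (n + N) (Nat.le_add_left _ _)
    have hK := measurable_preDensity lam (n + N) (r (n + N))
    have hJ := measurable_postDensity hε hl h hn.n_ne hn.measurable (r (n + N))
    refine AEStronglyMeasurable.prodMk ?_ ?_
    · refine (measurable_jumpPath_comp (c := 1) hK hJ h.measurable_xi h.measurable_eta hσ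
        hτ').aestronglyMeasurable.congr ?_
      filter_upwards [hn.ae_Z0_eq h h14] with ω hω using (hω _).symm
    · refine (measurable_jumpPath_comp (c := 1)
        (K := fun x t => preDensity lam (n + N) (r (n + N)) x t *
          prePrice lam (n + N) (b (n + N)) (r (n + N)) x t)
        (J := fun x e s => postDensity P η lam (n + N) (g (n + N)) (r (n + N)) x e s *
          postPrice lam (n + N) (r (n + N)) x e s)
        (hK.mul (measurable_prePrice lam _ _ _)) (hJ.mul (measurable_postPrice lam _ _))
        h.measurable_xi h.measurable_eta hσ hτ').aestronglyMeasurable.congr ?_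
      filter_upwards [hn.ae_Z1_eq h h14] with ω hω using (hω _).symm
  have hlim := tendstoInMeasure_of_tendsto_ae hmeas
    (g := fun ω => (Y0 lam ξ η θ (τ ω) ω, Y1 lam ξ η θ (τ ω) ω)) (by
      filter_upwards [ae_tendsto_Z hε hl h hb ha] with ω hω
      have := ((hω (τ ω)).1.prodMk_nhds (hω (τ ω)).2)
      exact this.comp (tendsto_add_atTop_nat N))
  intro δ hδ
  exact (tendsto_add_atTop_iff_nat N).1 (hlim δ hδ)

end StoppingTimes

/-! ### Right jumps of the dual optimiser -/

section RightJumps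

variable {F : ℝ → ℝ} {s c m d : ℝ}

lemma tendsto_right_half (hs : 1 / 2 < s) (h2 : ∀ t, 1 / 2 < t → t < s → F t = m) :
    Tendsto (fun t : unitInterval => F t) (𝓝[>] halfTime) (𝓝 m) := by
  refine tendsto_const_nhds.congr' ?_
  have hval : Continuous (fun u : unitInterval => (u : ℝ)) := continuous_subtype_val
  filter_upwards [nhdsWithin_le_nhds (hval.tendsto halfTime (gt_mem_nhds hs)),
    self_mem_nhdsWithin] with u hu hu2
  simp only [mem_preimage, mem_ofPred_eq] at hu
  have : (1 / 2 : ℝ) < u := hu2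
  exact (h2 u this hu).symm

/-- The value at `1/2` is left free, so an isolated value there, with jumps on both sides, is
allowed. -/
lemma isLadlagPath_of_piecewise (h1 : ∀ t < 1 / 2, F t = c)
    (h2 : ∀ t, 1 / 2 < t → t < s → F t = m) (h3 : ∀ t, 1 / 2 < t → s ≤ t → F t = d) :
    IsLadlagPath fun t => F t := by
  have hval : Continuous (fun u : unitInterval => (u : ℝ)) := continuous_subtype_val
  have hlt : ∀ (t : unitInterval) (q : ℝ), (t : ℝ) < q → ∀ l ≤ 𝓝 t,
      ∀ᶠ u : unitInterval in l, (u : ℝ) < q := fun t q h l hl =>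
    hl (hval.tendsto t (gt_mem_nhds h))
  have hgt : ∀ (t : unitInterval) (q : ℝ), q < t → ∀ l ≤ 𝓝 t,
      ∀ᶠ u : unitInterval in l, q < (u : ℝ) := fun t q h l hl =>
    hl (hval.tendsto t (lt_mem_nhds h))
  intro t
  constructor
  · rcases le_or_gt (t : ℝ) (1 / 2) with ht | ht
    · refine ⟨c, tendsto_const_nhds.congr' ?_⟩
      filter_upwards [self_mem_nhdsWithin] with u hu
      have : (u : ℝ) < t := hu
      exact (h1 u (this.trans_le ht)).symm
    · rcases le_or_gt (t : ℝ) s with hts | hts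
      · refine ⟨m, tendsto_const_nhds.congr' ?_⟩
        filter_upwards [hgt t _ ht _ nhdsWithin_le_nhds, self_mem_nhdsWithin] with u hu hu2
        have : (u : ℝ) < t := hu2
        exact (h2 u hu (this.trans_le hts)).symm
      · refine ⟨d, tendsto_const_nhds.congr' ?_⟩
        filter_upwards [hgt t _ ht _ nhdsWithin_le_nhds,
          hgt t _ hts _ nhdsWithin_le_nhds] with u hu hu2
        exact (h3 u hu hu2.le).symm
  · rcases lt_or_ge (t : ℝ) (1 / 2) with ht | ht
    · refine ⟨c, tendsto_const_nhds.congr' ?_⟩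
      filter_upwards [hlt t _ ht _ nhdsWithin_le_nhds] with u hu
      exact (h1 u hu).symm
    · rcases lt_or_ge (t : ℝ) s with hts | hts
      · refine ⟨m, tendsto_const_nhds.congr' ?_⟩
        filter_upwards [hlt t _ hts _ nhdsWithin_le_nhds, self_mem_nhdsWithin] with u hu hu2
        have : (t : ℝ) < u := hu2
        exact (h2 u (ht.trans_lt this) hu).symm
      · refine ⟨d, tendsto_const_nhds.congr' ?_⟩
        filter_upwards [self_mem_nhdsWithin] with u hu2
        have : (t : ℝ) < u := hu2
        exact (h3 u (ht.trans_lt this) (hts.trans this.le)).symm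

variable {lam x e : ℝ}

lemma isLadlagPath_dual (lam x e s : ℝ) :
    (IsLadlagPath fun t => dualY0 lam x e s t) ∧ IsLadlagPath fun t => dualY1 lam x e s t := by
  constructor
  · refine isLadlagPath_of_piecewise (F := dualY0 lam x e s) (s := s) (c := 1)
      (m := 1 / wealthPlus lam x)
      (d := 1 / (wealthPlus lam x + hold lam x s s * ((1 - lam) * ask x e s s - x))) ?_ ?_ ?_
    · intro t ht
      rw [dualY0, wealth, if_pos ht, div_one]
    · intro t h1 h2
      rw [dualY0, wealth_mid h1 h2]
    · intro t h1 h2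
      rw [dualY0, wealth, if_neg (not_lt.2 h1.le), if_neg h1.ne', if_neg (not_lt.2 h2)]
  · refine isLadlagPath_of_piecewise (F := dualY1 lam x e s) (s := s) (c := 1)
      (m := x / wealthPlus lam x)
      (d := (1 - lam) * ask x e s s /
        (wealthPlus lam x + hold lam x s s * ((1 - lam) * ask x e s s - x))) ?_ ?_ ?_
    · intro t ht
      rw [dualY1, wealth, shadow, if_pos ht, if_pos ht, div_one]
    · intro t h1 h2
      rw [dualY1, wealth_mid h1 h2, shadow_mid h1 h2]
    · intro t h1 h2
      rw [dualY1, wealth, shadow, if_neg (not_lt.2 h1.le), if_neg h1.ne', if_neg (not_lt.2 h2),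
        if_neg (not_lt.2 h1.le), if_neg h1.ne', if_neg (not_lt.2 h2)]

lemma dualY0_half (lam x e s : ℝ) : dualY0 lam x e s halfTime = 1 / wealthHalf lam x := by
  have : (halfTime : ℝ) = 1 / 2 := rfl
  rw [dualY0, this, wealth, if_neg (lt_irrefl _), if_pos rfl]

lemma dualY1_half (lam e s : ℝ) :
    dualY1 lam (1 / 2) e s halfTime = (1 - lam) * (1 / 2) / wealthHalf lam (1 / 2) := by
  have : (halfTime : ℝ) = 1 / 2 := rfl
  rw [dualY1, this, wealth, shadow, if_neg (lt_irrefl _), if_pos rfl, if_neg (lt_irrefl _),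
    if_pos rfl, if_neg (by norm_num)]

/-- Immediately after `1/2` the wealth is multiplied by `(1 + 2 lam)/(1 - lam)` and the shadow price
by `1/(1 - lam)`. Hence `Ŷ⁰` is multiplied by `(1 - lam)/(1 + 2 lam)` and `Ŷ¹` by `1/(1 + 2 lam)`,
both below one. -/
theorem rightJump_dual (h0 : 0 < lam) (hl : lam < 1 / 14) (e : ℝ) (hs : 1 / 2 < s) :
    ∃ y₀ y₁ : ℝ,
      Tendsto (fun t : unitInterval => dualY0 lam (1 / 2) e s t) (𝓝[>] halfTime) (𝓝 y₀) ∧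
      Tendsto (fun t : unitInterval => dualY1 lam (1 / 2) e s t) (𝓝[>] halfTime) (𝓝 y₁) ∧
      y₀ < dualY0 lam (1 / 2) e s halfTime ∧ y₁ < dualY1 lam (1 / 2) e s halfTime ∧
      y₀ - dualY0 lam (1 / 2) e s halfTime = dualY0 lam (1 / 2) e s halfTime *
        (-lam / (lam + (1 - lam) * coefA (1 / 2))) ∧
      y₁ - dualY1 lam (1 / 2) e s halfTime = dualY1 lam (1 / 2) e s halfTime *
        (-lam * (1 - coefA (1 / 2)) / (lam + (1 - lam) * coefA (1 / 2))) := by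
  have hw := wealthHalf_pos h0 (.inr rfl : (1 / 2 : ℝ) = 3 ∨ (1 / 2 : ℝ) = 1 / 2)
  have h1 : 0 < 1 - lam := by linarith
  have h2 : 0 < 1 + 2 * lam := by linarith
  have hp : wealthPlus lam (1 / 2) = wealthHalf lam (1 / 2) * ((1 + 2 * lam) / (1 - lam)) := by
    rw [wealthPlus_eq hl (.inr rfl), if_neg (by norm_num)]
    congr 1
    field_simp
    ring
  have hA : coefA (1 / 2) = 1 / 3 := by unfold coefA; norm_num
  have hd : lam + (1 - lam) * (1 / 3) = (1 + 2 * lam) / 3 := by ring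
  rw [dualY0_half, dualY1_half, hA, hd]
  generalize wealthHalf lam (1 / 2) = w at hw hp
  have d0 : 1 / wealthPlus lam (1 / 2) - 1 / w = 1 / w * (-lam / ((1 + 2 * lam) / 3)) := by
    rw [hp]; field_simp; ring
  have d1 : 1 / 2 / wealthPlus lam (1 / 2) - (1 - lam) * (1 / 2) / w =
      (1 - lam) * (1 / 2) / w * (-lam * (1 - 1 / 3) / ((1 + 2 * lam) / 3)) := by
    rw [hp]; field_simp; ring
  have n0 : 0 < 1 / w * (lam / ((1 + 2 * lam) / 3)) := by positivity
  have n1 : 0 < (1 - lam) * (1 / 2) / w * (lam * (1 - 1 / 3) / ((1 + 2 * lam) / 3)) :=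
    mul_pos (by positivity) (div_pos (mul_pos h0 (by norm_num)) (by positivity))
  refine ⟨1 / wealthPlus lam (1 / 2), 1 / 2 / wealthPlus lam (1 / 2),
    tendsto_right_half (F := dualY0 lam (1 / 2) e s) hs fun t h1 h2 => by
      rw [dualY0, wealth_mid h1 h2],
    tendsto_right_half (F := dualY1 lam (1 / 2) e s) hs fun t h1 h2 => by
      rw [dualY1, wealth_mid h1 h2, shadow_mid h1 h2], ?_, ?_, d0, d1⟩
  · rw [neg_div, mul_neg] at d0
    linarith
  · rw [neg_mul, neg_div, mul_neg] at d1
    linarith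

end RightJumps

end LadlagExample

/-! ### The main theorem -/

theorem mainTheorem9 (ε : ℝ) (hε : ε ∈ Set.Ioo (0 : ℝ) (1 / 3)) :
    ∃ lam₀ ∈ Set.Ioo (0 : ℝ) 1, ∀ lam ∈ Set.Ioo (0 : ℝ) lam₀,
    ∀ (Ω : Type*) [MeasurableSpace Ω] (P : Measure Ω) [IsProbabilityMeasure P] [P.IsComplete]
      (ξ η θ : Ω → ℝ) (h : LadlagExample.IsModel P ε ξ η θ)
      (etaT : ℕ → Ω → ℝ), LadlagExample.IsTilting P η etaT →
      -- martingales and consistent price systems, for sufficiently large `n`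
      (∀ᶠ n in atTop,
        LadlagExample.IsCadlagMartingale (LadlagExample.Z0 P lam ξ η θ etaT n)
          (LadlagExample.marketFiltration P h) P ∧
        LadlagExample.IsCadlagMartingale (LadlagExample.Z1 P lam ξ η θ etaT n)
          (LadlagExample.marketFiltration P h) P ∧
        LadlagExample.IsConsistentPriceSystem P (LadlagExample.marketFiltration P h) lam
          (LadlagExample.askProcess ξ η θ) (LadlagExample.Z0 P lam ξ η θ etaT n)
          (LadlagExample.Z1 P lam ξ η θ etaT n)) ∧
      -- convergence in probability at all `[0,1]`-valued stopping times
      (∀ τ : Ω → unitInterval,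
        IsStoppingTime (LadlagExample.marketFiltration P h)
          (fun ω => (τ ω : WithTop unitInterval)) →
        TendstoInMeasure P
          (fun n ω => (LadlagExample.Z0 P lam ξ η θ etaT n (τ ω) ω,
            LadlagExample.Z1 P lam ξ η θ etaT n (τ ω) ω)) atTop
          (fun ω => (LadlagExample.Y0 lam ξ η θ (τ ω) ω,
            LadlagExample.Y1 lam ξ η θ (τ ω) ω))) ∧
      -- the limit is làdlàg, with a right jump at time `1/2` on `{ξ = 1/2}`
      (∀ᵐ ω ∂P, LadlagExample.IsLadlagPath (fun t => LadlagExample.Y0 lam ξ η θ t ω) ∧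
        LadlagExample.IsLadlagPath (fun t => LadlagExample.Y1 lam ξ η θ t ω)) ∧
      (∀ᵐ ω ∂P, ξ ω = 1 / 2 → ∃ y₀ y₁ : ℝ,
        Tendsto (fun t => LadlagExample.Y0 lam ξ η θ t ω) (𝓝[>] LadlagExample.halfTime)
          (𝓝 y₀) ∧
        Tendsto (fun t => LadlagExample.Y1 lam ξ η θ t ω) (𝓝[>] LadlagExample.halfTime)
          (𝓝 y₁) ∧
        y₀ < LadlagExample.Y0 lam ξ η θ LadlagExample.halfTime ω ∧
        y₁ < LadlagExample.Y1 lam ξ η θ LadlagExample.halfTime ω ∧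
        y₀ - LadlagExample.Y0 lam ξ η θ LadlagExample.halfTime ω =
          LadlagExample.Y0 lam ξ η θ LadlagExample.halfTime ω *
            (-lam / (lam + (1 - lam) * LadlagExample.coefA (1 / 2))) ∧
        y₁ - LadlagExample.Y1 lam ξ η θ LadlagExample.halfTime ω =
          LadlagExample.Y1 lam ξ η θ LadlagExample.halfTime ω *
            (-lam * (1 - LadlagExample.coefA (1 / 2)) /
              (lam + (1 - lam) * LadlagExample.coefA (1 / 2)))) := by
  refine ⟨LadlagExample.costBound ε, ⟨by unfold LadlagExample.costBound; linarith [hε.2],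
    by unfold LadlagExample.costBound; linarith [hε.1]⟩, ?_⟩
  intro lam hl Ω _ P _ _ ξ η θ h etaT ht
  obtain ⟨r, g, ha⟩ := ht.exists_isApprox hε hl
  refine ⟨?_, ?_, ?_, ?_⟩
  · filter_upwards [ha] with n hn using hn.isConsistentPriceSystem hε hl h ht
  · exact fun τ hτ => LadlagExample.tendstoInMeasure_Z hε hl h ht.tendsto ha
      (LadlagExample.measurable_of_isStoppingTime hτ)
  · exact ae_of_all _ fun ω => LadlagExample.isLadlagPath_dual lam (ξ ω) (η ω) _
  · filter_upwards [h.ae_half_lt_jumpTime] with ω hs hx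
    have := LadlagExample.rightJump_dual hl.1 (LadlagExample.lam_lt hε hl) (η ω) hs
    rw [← hx] at this
    simpa only [LadlagExample.Y0, LadlagExample.Y1, hx] using this
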